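/- **Setting.** Let $(M,g)$ be a smooth pseudo-Riemannian $n$-manifold, $\eta$ a scalar product on $V=\mathbb R^n$ of the same signature, $O(\eta)$ its automorphism group, and $O(\eta,M)\to M$ the bundle of isometries $\omega_x:(T_xM,g_x)\to(V,\eta)$ (a *moving coframe* is a smooth local section). Put $\mathcal R^p=\otimes^4V^*\oplus\cdots\oplus\otimes^{4+p}V^*$ and let $\hat R^{(p)}:O(\eta,M)\to\mathcal R^p$ be the $O(\eta)$-equivariant map giving the components of the Riemann tensor and of its first $p$ covariant derivatives; along a moving coframe it gives $R^{(p)}=(R_{abcd},\dots,R_{abcd;e_1\dots e_p})$. Let $r_{-1}=0$ and $r_p=\operatorname{rank}\hat R^{(p)}$ for $p\ge 0$. - $(M,g)$ is *fully regular* if every $r_p$ is constant on $O(\eta,M)$. Then $q$ is the smallest integer $\ge 0$ with $r_{q-1}=r_q$, and the *order* of $(M,g)$ is $q-1$. - A submanifold $S\subset\mathcal R^p$ is a *$p$-th order normalizing cross-section* if there is a subgroup $G_p\subset O(\eta)$ such that (N1) $G_p$ fixes $S$ pointwise; (N2) $X\in O(\eta)$ and $X(S)\cap S\ne\emptyset$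 imply $X\in G_p$; (N3) $M$ is covered by domains of moving coframes relative to which $R^{(p)}$ takes values in $S$. $(M,g)$ is *curvature regular* if such an $S$ exists for every $p\ge 0$. Then $s_p=\dim G_p$, and $t_p=\operatorname{rank}R^{(p)}$ relative to the coframes in (N3); for a fully regular and curvature regular $(M,g)$ these numbers do not depend on the point or on the choices. - $(M,g)$ is *properly $\mathrm{CH}_k$* if it is curvature regular, $t_k=0$ and $t_{k+1}>0$. It has *$k$-th order pseudo-stabilization* ($k\ge1$) if it is curvature regular and $s_k=s_{k-1}>s_q$. **Proposition.** Let $(M,g)$ be a non-empty, fully regular and curvature regular 3-dimensional Lorentzian manifold of order $q-1=4$. Then $$(r_0,r_1,r_2,r_3,r_4,r_5)=(2,3,4,5,6,6),$$ and $(M,g)$ is either properly $\mathrm{CH}_1$, or properly $\mathrm{CH}_0$ with 1st-order pseudo-stabilization. In either case, the values of $s_p$ and $t_p$ asserted here hold for every choice of the normalizing cross-section and coframes, at every point. -/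

import Mathlib

open scoped Manifold ContDiff Matrix

noncomputable section

namespace LorentzOrder

/-! ## Metrics and moving coframes -/

/-- A smooth pseudo-Riemannian metric on an `n`-dimensional smooth manifold. -/
structure PseudoRiemannianMetric (n : ℕ) (M : Type*) [TopologicalSpace M]
    [ChartedSpace (EuclideanSpace ℝ (Fin n)) M] [IsManifold (𝓡 n) ∞ M] where
  /-- the scalar product on each tangent space -/
  inner (x : M) : TangentSpace (𝓡 n) x →L[ℝ] TangentSpace (𝓡 n) x →L[ℝ] ℝ
  symm (x : M) (v w : TangentSpace (𝓡 n) x) : inner x v w = inner x w v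
  nondegenerate (x : M) (v : TangentSpace (𝓡 n) x) (hv : ∀ w, inner x v w = 0) : v = 0
  contMDiff : ContMDiff (𝓡 n)
    ((𝓡 n).prod 𝓘(ℝ, EuclideanSpace ℝ (Fin n) →L[ℝ] EuclideanSpace ℝ (Fin n) →L[ℝ] ℝ)) ∞
    (fun x ↦ Bundle.TotalSpace.mk'
      (EuclideanSpace ℝ (Fin n) →L[ℝ] EuclideanSpace ℝ (Fin n) →L[ℝ] ℝ) x (inner x))

/-- The Lorentzian scalar product `diag(-1, 1, 1)` on `ℝ³`. -/
def lorentz : Matrix (Fin 3) (Fin 3) ℝ := Matrix.diagonal ![-1, 1, 1]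

section Geometry

variable {n : ℕ} {M : Type*} [TopologicalSpace M]
  [ChartedSpace (EuclideanSpace ℝ (Fin n)) M] [IsManifold (𝓡 n) ∞ M]

/-- Every tangent space is isometric to `(ℝⁿ, η)`. -/
def PseudoRiemannianMetric.HasSignature (g : PseudoRiemannianMetric n M)
    (η : Matrix (Fin n) (Fin n) ℝ) : Prop :=
  ∀ x : M, ∃ e : Fin n → TangentSpace (𝓡 n) x, ∀ a b, g.inner x (e a) (e b) = η a b

/-- An `η`-orthogonal moving coframe, i.e. a smooth local section (over an open set `domain`) of
the bundle `O(η, M)` of isometries `θ_x : (T_x M, g_x) → (ℝⁿ, η)`.  It is recorded through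
the dual frame `e_a(x) = θ_x⁻¹(a-th basis vector)`; the isometry condition is
`g(e_a, e_b) = η_ab`.  Values outside `domain` are irrelevant. -/
structure MovingCoframe (g : PseudoRiemannianMetric n M) (η : Matrix (Fin n) (Fin n) ℝ) where
  /-- the open set on which the coframe is defined -/
  domain : Set M
  isOpen_domain : IsOpen domain
  /-- the dual frame -/
  frame : Fin n → ∀ x : M, TangentSpace (𝓡 n) x
  contMDiffOn (a : Fin n) : ContMDiffOn (𝓡 n) (𝓡 n).tangent ∞
    (fun x ↦ (⟨x, frame a x⟩ : TangentBundle (𝓡 n) M)) domain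
  orthonormal (x : M) (hx : x ∈ domain) (a b : Fin n) :
    g.inner x (frame a x) (frame b x) = η a b

/-! ## Curvature components relative to a moving coframe -/

namespace MovingCoframe

variable {g : PseudoRiemannianMetric n M} {η : Matrix (Fin n) (Fin n) ℝ}
  (θ : MovingCoframe g η)

/-- The frame derivative `e_a(f)` of a function. -/
def frameDeriv (a : Fin n) (f : M → ℝ) (x : M) : ℝ :=
  mfderiv (𝓡 n) 𝓘(ℝ, ℝ) f x (θ.frame a x)

/-- The structure functions `C_abc = g([e_a, e_b], e_c)`. -/
def structureFun (a b c : Fin n) (x : M) : ℝ :=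
  g.inner x (VectorField.mlieBracket (𝓡 n) (θ.frame a) (θ.frame b) x) (θ.frame c x)

/-- The Levi-Civita connection components `Γ_abc = g(∇_{e_a} e_b, e_c)`, by the Koszul formula
(the terms `e_a(g(e_b, e_c))` vanish since `g(e_b, e_c) = η_bc` is constant). -/
def connection (a b c : Fin n) (x : M) : ℝ :=
  (θ.structureFun a b c x - θ.structureFun b c a x + θ.structureFun c a b x) / 2

/-- The Riemann tensor components
`R_abcd = g(∇_{e_a} ∇_{e_b} e_c - ∇_{e_b} ∇_{e_a} e_c - ∇_{[e_a, e_b]} e_c, e_d)`. -/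
def riemann (a b c d : Fin n) (x : M) : ℝ :=
  θ.frameDeriv a (θ.connection b c d) x - θ.frameDeriv b (θ.connection a c d) x
    + ∑ m, ∑ l, η⁻¹ m l * (θ.connection b c l x * θ.connection a m d x
        - θ.connection a c l x * θ.connection b m d x
        - θ.structureFun a b l x * θ.connection m c d x)

/-- The components `T_{i₁…i_k;f}` of the covariant derivative of the covariant `k`-tensor with
components `T_{i₁…i_k}`:
`e_f(T_{i₁…i_k}) - ∑_j T(e_{i₁}, …, ∇_{e_f} e_{i_j}, …, e_{i_k})`. -/
def covDeriv {k : ℕ} (T : (Fin k → Fin n) → M → ℝ) (i : Fin (k + 1) → Fin n) (x : M) : ℝ :=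
  θ.frameDeriv (i (Fin.last k)) (T (Fin.init i)) x
    - ∑ j : Fin k, ∑ m, ∑ l, η⁻¹ m l * θ.connection (i (Fin.last k)) (Fin.init i j) l x
        * T (Function.update (Fin.init i) j m) x

/-- The components `R_{abcd;e₁…e_k}` of the `k`-th covariant derivative of the Riemann tensor. -/
def nablaRiemann : (k : ℕ) → (Fin (4 + k) → Fin n) → M → ℝ
  | 0 => fun i ↦ θ.riemann (i 0) (i 1) (i 2) (i 3)
  | k + 1 => θ.covDeriv (nablaRiemann k)

end MovingCoframe

/-- The space `𝓡^p = ⊗⁴V* ⊕ ⋯ ⊕ ⊗^{4+p}V*`, `V = ℝⁿ`, in components. -/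
abbrev CurvSpace (n p : ℕ) : Type := ∀ k : Fin (p + 1), (Fin (4 + (k : ℕ)) → Fin n) → ℝ

/-- `R^(p) = (R_abcd, R_{abcd;e}, …, R_{abcd;e₁…e_p})` relative to a moving coframe. -/
def MovingCoframe.curvature {g : PseudoRiemannianMetric n M} {η : Matrix (Fin n) (Fin n) ℝ}
    (θ : MovingCoframe g η) (p : ℕ) (x : M) : CurvSpace n p :=
  fun k i ↦ θ.nablaRiemann k i x

/-! ## The group `O(η)` and its action on `𝓡^p` -/

/-- The group `O(η)` of linear automorphisms of `(ℝⁿ, η)`. -/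
def orthGroup (η : Matrix (Fin n) (Fin n) ℝ) : Subgroup (GL (Fin n) ℝ) where
  carrier := {X | (X : Matrix (Fin n) (Fin n) ℝ)ᵀ * η * (X : Matrix (Fin n) (Fin n) ℝ) = η}
  one_mem' := by simp
  mul_mem' := by
    intro X Y hX hY
    simp only [Set.mem_ofPred_eq, Units.val_mul, Matrix.transpose_mul] at hX hY ⊢
    calc _ = (Y : Matrix (Fin n) (Fin n) ℝ)ᵀ * ((X : Matrix (Fin n) (Fin n) ℝ)ᵀ * η * X) * Y := by
          simp only [Matrix.mul_assoc]
      _ = η := by rw [hX, hY]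
  inv_mem' := by
    intro X hX
    simp only [Set.mem_ofPred_eq] at hX ⊢
    have h1 : (X : Matrix (Fin n) (Fin n) ℝ) * ((X⁻¹ : GL (Fin n) ℝ) : Matrix (Fin n) (Fin n) ℝ)
        = 1 := Units.mul_inv X
    have h2 : ((X⁻¹ : GL (Fin n) ℝ) : Matrix (Fin n) (Fin n) ℝ)ᵀ
        * (X : Matrix (Fin n) (Fin n) ℝ)ᵀ = 1 := by
      rw [← Matrix.transpose_mul, h1, Matrix.transpose_one]
    calc _ = ((X⁻¹ : GL (Fin n) ℝ) : Matrix (Fin n) (Fin n) ℝ)ᵀ *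
          ((X : Matrix (Fin n) (Fin n) ℝ)ᵀ * η * X)
          * ((X⁻¹ : GL (Fin n) ℝ) : Matrix (Fin n) (Fin n) ℝ) := by rw [hX]
      _ = (((X⁻¹ : GL (Fin n) ℝ) : Matrix (Fin n) (Fin n) ℝ)ᵀ
          * (X : Matrix (Fin n) (Fin n) ℝ)ᵀ) * η * ((X : Matrix (Fin n) (Fin n) ℝ)
          * ((X⁻¹ : GL (Fin n) ℝ) : Matrix (Fin n) (Fin n) ℝ)) := by
          simp only [Matrix.mul_assoc]
      _ = η := by rw [h1, h2]; simp

/-- Pull-back of (components of) covariant tensors by a matrix `X`: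
`(X* T)(v₁, …, v_k) = T(X v₁, …, X v_k)`.  For invertible `X` this is the natural action of
`X⁻¹` on covariant tensors; equivalently it gives the components in the frame
`e'_a = ∑ b, X_ba e_b`. -/
def pullTensor {p : ℕ} (X : Fin n → Fin n → ℝ) (T : CurvSpace n p) : CurvSpace n p :=
  fun k i ↦ ∑ j : Fin (4 + (k : ℕ)) → Fin n, (∏ s, X (j s) (i s)) * T k j

/-- The natural (left) action of `X ∈ O(η)` on `𝓡^p`: pull-back by `X⁻¹`. -/
def act {p : ℕ} (X : GL (Fin n) ℝ) (T : CurvSpace n p) : CurvSpace n p :=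
  pullTensor (((X⁻¹ : GL (Fin n) ℝ) : Matrix (Fin n) (Fin n) ℝ)) T

/-- The dimension of a (closed) matrix group `G`, i.e. of its Lie algebra
`{ξ | exp(t ξ) ∈ G for all t ∈ ℝ}`. -/
def groupDim (G : Subgroup (GL (Fin n) ℝ)) : ℕ :=
  Module.finrank ℝ (Submodule.span ℝ {ξ : Matrix (Fin n) (Fin n) ℝ |
    ∀ t : ℝ, ∃ X ∈ G, (X : Matrix (Fin n) (Fin n) ℝ) = NormedSpace.exp (t • ξ)})

/-- The tangent space `{A | Aᵀ η X + Xᵀ η A = 0}` of `O(η) ⊂ Matₙ(ℝ)` at `X`. -/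
def orthTangent (η : Matrix (Fin n) (Fin n) ℝ) (X : Matrix (Fin n) (Fin n) ℝ) :
    Submodule ℝ (Fin n → Fin n → ℝ) where
  carrier := {A | (Matrix.of A)ᵀ * η * X + Xᵀ * η * Matrix.of A = 0}
  add_mem' := by
    intro A B hA hB
    simp only [Set.mem_ofPred_eq] at hA hB ⊢
    have : (Matrix.of (A + B) : Matrix (Fin n) (Fin n) ℝ) = Matrix.of A + Matrix.of B := rfl
    rw [this, Matrix.transpose_add, add_mul, add_mul, mul_add, add_add_add_comm, hA, hB, add_zero]
  zero_mem' := by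
    have : (Matrix.of (0 : Fin n → Fin n → ℝ) : Matrix (Fin n) (Fin n) ℝ) = 0 := rfl
    simp [this]
  smul_mem' := by
    intro c A hA
    simp only [Set.mem_ofPred_eq] at hA ⊢
    have : (Matrix.of (c • A) : Matrix (Fin n) (Fin n) ℝ) = c • Matrix.of A := rfl
    rw [this, Matrix.transpose_smul, smul_mul_assoc, smul_mul_assoc, mul_smul_comm, ← smul_add,
      hA, smul_zero]

/-! ## The rank of the classifying map, full regularity, order -/

/-- The lift `\hat R^(p)` of `R^(p)` to the part `π⁻¹(U)` of `O(η, M)` over the domain `U` of the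
moving coframe `θ`.  This part is `U × O(η)`: a pair `(x, X)` stands for the orthonormal frame
`e'_a = ∑ b, X_ba e_b(x)` at `x` (the coframe `X⁻¹ ∘ θ_x`), and `\hat R^(p)` of this frame is the
list of the components of `R, ∇R, …, ∇^p R` in it.  The formula is polynomial in the entries of `X`,
so it is written for all matrices `X`. -/
def MovingCoframe.lift {g : PseudoRiemannianMetric n M} {η : Matrix (Fin n) (Fin n) ℝ}
    (θ : MovingCoframe g η) (p : ℕ) (z : M × (Fin n → Fin n → ℝ)) : CurvSpace n p :=
  pullTensor z.2 (θ.curvature p z.1)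

/-- The rank of `\hat R^(p) : O(η, M) → 𝓡^p` at the point `(x, X)` of `U × O(η) = π⁻¹(U)`: the
dimension of the image of `T_x M × T_X O(η)` under the differential. -/
def MovingCoframe.liftRank {g : PseudoRiemannianMetric n M} {η : Matrix (Fin n) (Fin n) ℝ}
    (θ : MovingCoframe g η) (p : ℕ) (x : M) (X : Fin n → Fin n → ℝ) : ℕ :=
  Module.finrank ℝ (Submodule.map
    (mfderiv ((𝓡 n).prod 𝓘(ℝ, Fin n → Fin n → ℝ)) 𝓘(ℝ, CurvSpace n p)
      (θ.lift p) (x, X)).toLinearMap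
    ((⊤ : Submodule ℝ (TangentSpace (𝓡 n) x)).prod (orthTangent η (Matrix.of X))))

/-- `r_p = r`: the map `\hat R^(p)` has rank `r` at every point of `O(η, M)`. -/
def HasRank (g : PseudoRiemannianMetric n M) (η : Matrix (Fin n) (Fin n) ℝ) (p r : ℕ) : Prop :=
  ∀ θ : MovingCoframe g η, ∀ x ∈ θ.domain, ∀ X ∈ orthGroup η,
    θ.liftRank p x (X : Matrix (Fin n) (Fin n) ℝ) = r

/-- `(M, g)` is fully regular: `r_p` is constant for every `p`. -/
def FullyRegular (g : PseudoRiemannianMetric n M) (η : Matrix (Fin n) (Fin n) ℝ) : Prop :=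
  ∀ p : ℕ, ∃ r : ℕ, HasRank g η p r

/-- The sequence `r_{-1} = 0, r_0, r_1, …`, shifted by one. -/
def prevRank (r : ℕ → ℕ) : ℕ → ℕ
  | 0 => 0
  | p + 1 => r p

/-- `q = q_M`: the smallest integer `q ≥ 0` with `r_{q-1} = r_q`, where `r_{-1} = 0`. -/
def IsStabilizationIndex (g : PseudoRiemannianMetric n M) (η : Matrix (Fin n) (Fin n) ℝ)
    (q : ℕ) : Prop :=
  ∃ r : ℕ → ℕ, (∀ p, HasRank g η p (r p)) ∧ IsLeast {m | prevRank r m = r m} q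

/-- The order of the metric is `q - 1`. -/
def HasOrder (g : PseudoRiemannianMetric n M) (η : Matrix (Fin n) (Fin n) ℝ) (k : ℤ) : Prop :=
  ∃ q : ℕ, IsStabilizationIndex g η q ∧ k = (q : ℤ) - 1

/-! ## Curvature regularity -/

/-- `S` is an embedded smooth submanifold of the vector space `F`: near each of its points a
diffeomorphism of open subsets of `F` carries `S` to a fixed linear subspace. -/
def IsSubmanifold {F : Type*} [NormedAddCommGroup F] [NormedSpace ℝ F] (S : Set F) : Prop :=
  ∃ W : Submodule ℝ F, ∀ x ∈ S, ∃ φ : OpenPartialHomeomorph F F, x ∈ φ.source ∧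
    ContDiffOn ℝ ∞ φ φ.source ∧ ContDiffOn ℝ ∞ φ.symm φ.target ∧ φ.IsImage S (W : Set F)

/-- `S ⊂ 𝓡^p` is a `p`-th order normalizing cross-section for `(M, g)` with group `G = G_p`. -/
structure IsNormalizingCrossSection (g : PseudoRiemannianMetric n M)
    (η : Matrix (Fin n) (Fin n) ℝ) (p : ℕ) (S : Set (CurvSpace n p))
    (G : Subgroup (GL (Fin n) ℝ)) : Prop where
  submanifold : IsSubmanifold S
  le_orthGroup : G ≤ orthGroup η
  /-- (N1) `G` fixes `S` pointwise -/
  fixes : ∀ X ∈ G, ∀ T ∈ S, act X T = T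
  /-- (N2) `X(S) ∩ S ≠ ∅` implies `X ∈ G` -/
  maximal : ∀ X ∈ orthGroup η, ((act X '' S) ∩ S).Nonempty → X ∈ G
  /-- (N3) there is a cover by moving coframes whose curvature components lie in `S` -/
  cover : ∀ x : M, ∃ θ : MovingCoframe g η, x ∈ θ.domain ∧ ∀ y ∈ θ.domain, θ.curvature p y ∈ S

/-- `(M, g)` is curvature regular. -/
def CurvatureRegular (g : PseudoRiemannianMetric n M) (η : Matrix (Fin n) (Fin n) ℝ) : Prop :=
  ∀ p : ℕ, ∃ S G, IsNormalizingCrossSection g η p S G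

/-- `s_p = s`: the `p`-th order degree of frame freedom `dim G_p` is `s`, for every choice of
the normalizing cross-section (and there is one). -/
def HasFrameFreedom (g : PseudoRiemannianMetric n M) (η : Matrix (Fin n) (Fin n) ℝ)
    (p s : ℕ) : Prop :=
  (∃ S G, IsNormalizingCrossSection g η p S G) ∧
    ∀ S G, IsNormalizingCrossSection g η p S G → groupDim G = s

/-- The rank of `R^(p) : U → 𝓡^p` at `x`. -/
def MovingCoframe.curvatureRank {g : PseudoRiemannianMetric n M}
    {η : Matrix (Fin n) (Fin n) ℝ} (θ : MovingCoframe g η) (p : ℕ) (x : M) : ℕ :=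
  Module.finrank ℝ (LinearMap.range
    (mfderiv (𝓡 n) 𝓘(ℝ, CurvSpace n p) (θ.curvature p) x).toLinearMap)

/-- `t_p = t`: the `p`-th order horizontal rank, i.e. the rank of `R^(p)` relative to normalizing
coframes, is `t` at every point, for every choice of the normalizing cross-section (and there is
one) and of the normalizing coframe. -/
def HasHorizontalRank (g : PseudoRiemannianMetric n M) (η : Matrix (Fin n) (Fin n) ℝ)
    (p t : ℕ) : Prop :=
  (∃ S G, IsNormalizingCrossSection g η p S G) ∧
    ∀ S G, IsNormalizingCrossSection g η p S G → ∀ θ : MovingCoframe g η,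
      (∀ y ∈ θ.domain, θ.curvature p y ∈ S) → ∀ x ∈ θ.domain, θ.curvatureRank p x = t

/-! ## Curvature homogeneity and pseudo-stabilization -/

/-- `(M, g)` is properly `CH_k`: it is curvature regular, `t_k = 0` and `t_{k+1} > 0`. -/
def IsProperlyCH (g : PseudoRiemannianMetric n M) (η : Matrix (Fin n) (Fin n) ℝ)
    (k : ℕ) : Prop :=
  CurvatureRegular g η ∧ HasHorizontalRank g η k 0 ∧
    ∃ t, 0 < t ∧ HasHorizontalRank g η (k + 1) t

/-- `k`-th order pseudo-stabilization (`k ≥ 1`): the geometry is curvature regular and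
`s_k = s_{k-1} > s_q`, where `q - 1` is the order. -/
def HasPseudoStabilization (g : PseudoRiemannianMetric n M) (η : Matrix (Fin n) (Fin n) ℝ)
    (k : ℕ) : Prop :=
  1 ≤ k ∧ CurvatureRegular g η ∧ ∃ q s s' : ℕ, IsStabilizationIndex g η q ∧
    HasFrameFreedom g η k s ∧ HasFrameFreedom g η (k - 1) s ∧ HasFrameFreedom g η q s' ∧ s' < s

end Geometry

end LorentzOrder

end

open scoped Manifold ContDiff Matrix Topology

noncomputable section

namespace LorentzOrder

/-! The heart of the matter is the identity `r_p + s_p = t_p + 3`, where 3 is the dimension of the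
Lorentz group `O(1,2)`. At the identity of the fibre, the image of the differential of the lifted
map is the sum of a horizontal part, the image of `dR^(p)`, and a vertical part, the tangent space
to the orbit of the curvature value. The vertical part has dimension `3 - s_p`, since (N1) and (N2)
make `G_p` the full stabilizer in `O(η)` of every point of the cross-section.

For a normalizing coframe the two parts meet only in zero. A common vector would yield a kernel
vector of the differential of the lift. Because the lift has constant rank, that vector is tangent
to a curve along which the lift is constant. Along the curve the curvature stays in one orbit, and
an orbit meets the cross-section in at most one point, so the curvature is constant and the common
vector vanishes (`disjoint_range_curvDeriv`). Counting dimensions gives `rank_add_groupDim`.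

Two geometric inputs are added. First, `s_0 ≥ 2` forces `r_0 = 0`: a curvature tensor annihilated by
a two-dimensional space of infinitesimal isometries has constant-curvature form, and Schur's lemma
then makes the factor constant. Second, the curvature components transform as a tensor under a
change of coframe (`curvature_transition`), so stabilizer dimensions do not depend on the coframe;
hence `s_p` is well defined and `s_{p+1} ≤ s_p`.

The rest is arithmetic. Order 4 means that `0 < r_0 < r_1 < r_2 < r_3 < r_4 = r_5 ≤ 6`. Since `r_0 ≠
0`, `s_0 ≤ 1`, so `r_0 = t_0 + 3 - s_0 ≥ 2`, and the chain leaves only one possibility. Then `s_0 =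
1`, `t_0 = 0` and `t_1 = s_1`, and the dichotomy is `s_1 = 0` or `s_1 = 1`. -/

/-- A curve form of the constant rank theorem: every kernel vector of the differential is tangent
to a curve along which the map is constant. -/
theorem exists_curve_of_constant_rank {E F : Type*} [NormedAddCommGroup E] [NormedSpace ℝ E]
    [FiniteDimensional ℝ E] [NormedAddCommGroup F] [NormedSpace ℝ F] [FiniteDimensional ℝ F]
    {f : E → F} {z₀ : E} (hf : ContDiffAt ℝ ∞ f z₀) {r : ℕ}
    (hr : ∀ᶠ z in 𝓝 z₀, Module.finrank ℝ (LinearMap.range (fderiv ℝ f z).toLinearMap) = r)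
    {v : E} (hv : fderiv ℝ f z₀ v = 0) :
    ∃ γ : ℝ → E, γ 0 = z₀ ∧ HasDerivAt γ v 0 ∧ ∀ᶠ t in 𝓝 (0 : ℝ), f (γ t) = f z₀ := by
  set L := fderiv ℝ f z₀ with hL
  obtain ⟨P, hP⟩ := Submodule.ClosedComplemented.of_finiteDimensional_quotient
    (p := LinearMap.range L.toLinearMap) (Submodule.closed_of_finiteDimensional _)
  obtain ⟨Q, hQ⟩ := Submodule.ClosedComplemented.of_finiteDimensional_quotient
    (p := LinearMap.ker L.toLinearMap) (Submodule.closed_of_finiteDimensional _)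
  let R := LinearMap.range L.toLinearMap
  let K := LinearMap.ker L.toLinearMap
  have hinj : Function.Injective ((P.comp L).prod Q) := by
    rw [injective_iff_map_eq_zero]
    intro e he
    simp only [ContinuousLinearMap.prod_apply, Prod.mk_eq_zero] at he
    have h1 : L e = 0 := by
      have := hP ⟨L e, ⟨e, rfl⟩⟩
      simp only at this
      rw [ContinuousLinearMap.comp_apply, this] at he
      exact congrArg Subtype.val he.1
    have := hQ ⟨e, h1⟩
    simp only at this
    rw [this] at he
    exact congrArg Subtype.val he.2
  have hdim : Module.finrank ℝ E = Module.finrank ℝ (R × K) := by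
    rw [Module.finrank_prod]
    exact (LinearMap.finrank_range_add_finrank_ker L.toLinearMap).symm
  let Ψ' : E ≃L[ℝ] (R × K) :=
    (LinearEquiv.ofInjectiveOfFinrankEq ((P.comp L).prod Q).toLinearMap hinj hdim).toContinuousLinearEquiv
  have hΨ' : (Ψ' : E →L[ℝ] R × K) = (P.comp L).prod Q := by ext <;> rfl
  -- Straightening coordinates: the part of `f` along the range of `L`, completed by the projection
  -- to the kernel. By rank-nullity its derivative at `z₀` is invertible.
  let Ψ : E → R × K := fun z ↦ (P (f z), Q z)
  have hdiff : ∀ᶠ z in 𝓝 z₀, DifferentiableAt ℝ f z := by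
    have h1 : ContDiffAt ℝ 1 f z₀ := hf.of_le (by simp)
    filter_upwards [h1.eventually (by simp)] with z hz
    exact hz.differentiableAt (by simp)
  have hΨd : ∀ z, DifferentiableAt ℝ f z → HasFDerivAt Ψ ((P.comp (fderiv ℝ f z)).prod Q) z := by
    intro z hz
    exact (P.hasFDerivAt.comp z hz.hasFDerivAt).prodMk Q.hasFDerivAt
  have hΨ0 : HasFDerivAt Ψ (Ψ' : E →L[ℝ] R × K) z₀ := by
    rw [hΨ']; exact hΨd z₀ hdiff.self_of_nhds
  have hΨc : ContDiffAt ℝ ∞ Ψ z₀ :=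
    (P.contDiff.contDiffAt.comp z₀ hf).prodMk Q.contDiff.contDiffAt
  let h := hΨc.localInverse hΨ0 (by simp)
  have hh0 : h (Ψ z₀) = z₀ := hΨc.localInverse_apply_image hΨ0 (by simp)
  have hhc : ContDiffAt ℝ ∞ h (Ψ z₀) := hΨc.to_localInverse hΨ0 (by simp)
  have hright : ∀ᶠ w in 𝓝 (Ψ z₀), Ψ (h w) = w :=
    (hΨc.hasStrictFDerivAt' hΨ0 (by simp)).eventually_right_inverse
  have hhd : HasFDerivAt h (Ψ'.symm : R × K →L[ℝ] E) (Ψ z₀) :=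
    (hΨc.hasStrictFDerivAt' hΨ0 (by simp)).to_localInverse.hasFDerivAt
  have hhdiff : ∀ᶠ w in 𝓝 (Ψ z₀), DifferentiableAt ℝ h w := by
    have h1 : ContDiffAt ℝ 1 h (Ψ z₀) := hhc.of_le (by simp)
    filter_upwards [h1.eventually (by simp)] with z hz
    exact hz.differentiableAt (by simp)
  let v' : K := ⟨v, hv⟩
  -- In these coordinates the curve is a straight line in the kernel direction, with the range
  -- component of `f` frozen.
  let ℓ : ℝ → R × K := fun t ↦ (P (f z₀), Q z₀ + t • v')
  have hℓ : ∀ t, HasDerivAt ℓ ((0 : R), v') t := by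
    intro t
    refine (hasDerivAt_const t _).prodMk ?_
    simpa using ((hasDerivAt_id t).smul_const v').const_add (Q z₀)
  have hℓ0 : ℓ 0 = Ψ z₀ := by simp [ℓ, Ψ]
  have hℓt : Filter.Tendsto ℓ (𝓝 0) (𝓝 (Ψ z₀)) := by
    rw [← hℓ0]; exact (hℓ 0).continuousAt
  have hγt : Filter.Tendsto (fun t ↦ h (ℓ t)) (𝓝 0) (𝓝 z₀) := by
    have h1 := hhd.continuousAt.tendsto.comp hℓt
    rwa [hh0] at h1
  have hγd : HasDerivAt (fun t ↦ h (ℓ t)) v 0 := by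
    have hh1 : HasFDerivAt h (Ψ'.symm : R × K →L[ℝ] E) (ℓ 0) := by rwa [hℓ0]
    have h1 := hh1.comp_hasDerivAt (0 : ℝ) (hℓ 0)
    have h2 : (Ψ'.symm : R × K →L[ℝ] E) ((0 : R), v') = v := by
      rw [ContinuousLinearEquiv.coe_coe, ContinuousLinearEquiv.symm_apply_eq]
      have h3 : Ψ' v = ((P.comp L).prod Q) v := by rw [← hΨ']; rfl
      rw [h3]
      have h4 := hQ v'
      simp only [ContinuousLinearMap.prod_apply, ContinuousLinearMap.comp_apply, hv, map_zero]
      rw [← h4]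
    rwa [h2] at h1
  -- the map `P` is injective on the range of the differential at nearby points
  have hPinj : ∀ᶠ z in 𝓝 z₀, ∀ w, P (fderiv ℝ f z w) = 0 → fderiv ℝ f z w = 0 := by
    have hcont : ContinuousAt (fun z ↦ (P.comp (fderiv ℝ f z)).prod Q) z₀ := by
      have h1 : ContinuousAt (fderiv ℝ f) z₀ :=
        (hf.fderiv_right (m := 0) (by simp)).continuousAt
      have h2 : ContinuousAt (fun z ↦ P.comp (fderiv ℝ f z)) z₀ :=
        continuousAt_const.clm_comp h1
      have h3 : Continuous (fun p : (E →L[ℝ] R) × (E →L[ℝ] K) ↦ p.1.prod p.2) :=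
        (ContinuousLinearMap.prodₗᵢ ℝ).continuous
      exact h3.continuousAt.comp (h2.prodMk continuousAt_const)
    -- Invertibility is an open condition, so the derivative of `Ψ` stays invertible near `z₀` and
    -- `P` remains surjective on the range of the derivative of `f`.
    have hnhds := Ψ'.nhds
    rw [hΨ'] at hnhds
    filter_upwards [hr, hcont hnhds] with z hz hz'
    obtain ⟨e, he⟩ := hz'
    simp only at he
    have hsurj : Function.Surjective (P.comp (fderiv ℝ f z)) := by
      intro y
      refine ⟨e.symm (y, 0), ?_⟩
      have h1 : (e : E →L[ℝ] R × K) (e.symm (y, 0)) = (y, 0) := e.apply_symm_apply _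
      rw [he] at h1
      exact congrArg Prod.fst h1
    intro w hw
    let P' : LinearMap.range (fderiv ℝ f z).toLinearMap →ₗ[ℝ] R := P.toLinearMap.domRestrict _
    have hsurj' : Function.Surjective P' := by
      intro y
      obtain ⟨x, hx⟩ := hsurj y
      exact ⟨⟨fderiv ℝ f z x, ⟨x, rfl⟩⟩, hx⟩
    -- The only use of constant rank: a surjection between spaces of equal finite dimension is
    -- injective.
    have hinj' : Function.Injective P' := by
      rw [LinearMap.injective_iff_surjective_of_finrank_eq_finrank]
      · exact hsurj'
      · rw [hz, ← hr.self_of_nhds]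
    have := (injective_iff_map_eq_zero P').1 hinj' ⟨fderiv ℝ f z w, ⟨w, rfl⟩⟩ hw
    exact congrArg Subtype.val this
  refine ⟨fun t ↦ h (ℓ t), by simp only [hℓ0, hh0], hγd, ?_⟩
  have hall := (hℓt.eventually hright.eventually_nhds).and ((hℓt.eventually hhdiff).and
    ((hγt.eventually hPinj).and (hγt.eventually hdiff)))
  obtain ⟨ε, hε, hball⟩ := Metric.eventually_nhds_iff_ball.1 hall
  have hconst : ∀ t ∈ Metric.ball (0 : ℝ) ε, HasDerivAt (fun t ↦ f (h (ℓ t))) 0 t := by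
    intro t ht
    obtain ⟨h1, h2, h3, h4⟩ := hball t ht
    have h5 : HasDerivAt (fun t ↦ h (ℓ t)) (fderiv ℝ h (ℓ t) (0, v')) t :=
      h2.hasFDerivAt.comp_hasDerivAt t (hℓ t)
    have h6 := h4.hasFDerivAt.comp_hasDerivAt t h5
    have h7 : HasDerivAt (fun t ↦ P (f (h (ℓ t)))) (P (fderiv ℝ f (h (ℓ t)) (fderiv ℝ h (ℓ t) (0, v')))) t :=
      P.hasFDerivAt.comp_hasDerivAt t h6
    -- `P ∘ f` is frozen along the curve, so the velocity of `f` is killed by `P`; by injectivity of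
    -- `P` on the range it is zero.
    have h8 : (fun t ↦ P (f (h (ℓ t)))) =ᶠ[𝓝 t] fun _ ↦ P (f z₀) := by
      filter_upwards [(hℓ t).continuousAt.eventually h1] with s hs
      exact congrArg Prod.fst hs
    have h9 := h7.unique ((hasDerivAt_const t (P (f z₀))).congr_of_eventuallyEq h8)
    rw [← h3 _ h9]
    exact h6
  filter_upwards [Metric.ball_mem_nhds (0 : ℝ) hε] with t ht
  have := Metric.isOpen_ball.is_const_of_deriv_eq_zero (convex_ball (0 : ℝ) ε).isPreconnected
    (fun s hs ↦ (hconst s hs).differentiableAt.differentiableWithinAt)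
    (fun s hs ↦ (hconst s hs).deriv) ht (Metric.mem_ball_self hε)
  simpa [hℓ0, hh0] using this

/-! ### Smoothness of frame components and the rules of frame differentiation -/

section FrameCalculus

variable {n : ℕ} {M : Type*} [TopologicalSpace M]
  [ChartedSpace (EuclideanSpace ℝ (Fin n)) M] [IsManifold (𝓡 n) ∞ M]
  {g : PseudoRiemannianMetric n M} {η : Matrix (Fin n) (Fin n) ℝ}

theorem contMDiffAt_mfderiv_apply {f : M → ℝ} {V : ∀ x : M, TangentSpace (𝓡 n) x} {x : M}
    (hf : ContMDiffAt (𝓡 n) 𝓘(ℝ, ℝ) ∞ f x)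
    (hV : ContMDiffAt (𝓡 n) (𝓡 n).tangent ∞ (fun y ↦ (⟨y, V y⟩ : TangentBundle (𝓡 n) M)) x) :
    ContMDiffAt (𝓡 n) 𝓘(ℝ, ℝ) ∞ (fun y ↦ (mfderiv (𝓡 n) 𝓘(ℝ, ℝ) f y (V y) : ℝ)) x := by
  have h1 := ContMDiffAt.clm_apply_of_inCoordinates
    (hf.mfderiv_const (m := ∞) (by simp)) hV hf
  exact (contMDiff_snd_tangentBundle_modelSpace ℝ 𝓘(ℝ, ℝ)).contMDiffAt.comp x h1

theorem PseudoRiemannianMetric.contMDiffAt_inner (g : PseudoRiemannianMetric n M)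
    {V W : ∀ x : M, TangentSpace (𝓡 n) x} {x : M}
    (hV : ContMDiffAt (𝓡 n) (𝓡 n).tangent ∞ (fun y ↦ (⟨y, V y⟩ : TangentBundle (𝓡 n) M)) x)
    (hW : ContMDiffAt (𝓡 n) (𝓡 n).tangent ∞ (fun y ↦ (⟨y, W y⟩ : TangentBundle (𝓡 n) M)) x) :
    ContMDiffAt (𝓡 n) 𝓘(ℝ, ℝ) ∞ (fun y ↦ g.inner y (V y) (W y)) x := by
  have h1 := ContMDiffAt.clm_bundle_apply₂ (F₃ := ℝ) (E₃ := Bundle.Trivial M ℝ) (g.contMDiff x) hV hW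
  rw [Bundle.contMDiffAt_totalSpace] at h1
  exact h1.2

namespace MovingCoframe

variable (θ : MovingCoframe g η) {x : M}

theorem contMDiffAt_frame (hx : x ∈ θ.domain) (a : Fin n) :
    ContMDiffAt (𝓡 n) (𝓡 n).tangent ∞
      (fun x ↦ (⟨x, θ.frame a x⟩ : TangentBundle (𝓡 n) M)) x :=
  (θ.contMDiffOn a).contMDiffAt (θ.isOpen_domain.mem_nhds hx)

theorem contMDiffAt_frameDeriv (hx : x ∈ θ.domain) (a : Fin n) {f : M → ℝ}
    (hf : ContMDiffAt (𝓡 n) 𝓘(ℝ, ℝ) ∞ f x) :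
    ContMDiffAt (𝓡 n) 𝓘(ℝ, ℝ) ∞ (θ.frameDeriv a f) x :=
  contMDiffAt_mfderiv_apply hf (θ.contMDiffAt_frame hx a)

theorem contMDiffAt_bracket (hx : x ∈ θ.domain) (a b : Fin n) :
    ContMDiffAt (𝓡 n) (𝓡 n).tangent ∞ (fun x ↦ (⟨x, VectorField.mlieBracket (𝓡 n) (θ.frame a)
      (θ.frame b) x⟩ : TangentBundle (𝓡 n) M)) x := by
  have : IsManifold (𝓡 n) (((⊤ : ℕ∞) : WithTop ℕ∞) + 1) M := by simpa using! ‹IsManifold (𝓡 n) ∞ M›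
  have : IsManifold (𝓡 n) (minSmoothness ℝ 2) M :=
    IsManifold.of_le (n := ∞) (by simpa using! (mod_cast le_top : ((2 : ℕ∞) : WithTop ℕ∞) ≤ ((⊤ : ℕ∞) : WithTop ℕ∞)))
  exact ContMDiffAt.mlieBracket_vectorField (m := ⊤) (n := ⊤) (θ.contMDiffAt_frame hx a)
    (θ.contMDiffAt_frame hx b) (by simp)

theorem contMDiffAt_structureFun (hx : x ∈ θ.domain) (a b c : Fin n) :
    ContMDiffAt (𝓡 n) 𝓘(ℝ, ℝ) ∞ (θ.structureFun a b c) x :=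
  g.contMDiffAt_inner (θ.contMDiffAt_bracket hx a b) (θ.contMDiffAt_frame hx c)

theorem contMDiffAt_connection (hx : x ∈ θ.domain) (a b c : Fin n) :
    ContMDiffAt (𝓡 n) 𝓘(ℝ, ℝ) ∞ (θ.connection a b c) x := by
  have h : θ.connection a b c = fun x ↦ (1 / 2 : ℝ) *
      (θ.structureFun a b c x - θ.structureFun b c a x + θ.structureFun c a b x) := by
    funext x; simp only [connection]; ring
  rw [h]
  exact contMDiffAt_const.mul (((θ.contMDiffAt_structureFun hx a b c).sub
    (θ.contMDiffAt_structureFun hx b c a)).add (θ.contMDiffAt_structureFun hx c a b))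

theorem contMDiffAt_riemann (hx : x ∈ θ.domain) (a b c d : Fin n) :
    ContMDiffAt (𝓡 n) 𝓘(ℝ, ℝ) ∞ (θ.riemann a b c d) x := by
  have hΓ := θ.contMDiffAt_connection hx
  have hC := θ.contMDiffAt_structureFun hx
  refine ((θ.contMDiffAt_frameDeriv hx a (hΓ _ _ _)).sub
    (θ.contMDiffAt_frameDeriv hx b (hΓ _ _ _))).add ?_
  refine contMDiffAt_finsetSum fun m _ ↦ contMDiffAt_finsetSum fun l _ ↦ ?_
  exact contMDiffAt_const.mul ((((hΓ _ _ _).mul (hΓ _ _ _)).sub ((hΓ _ _ _).mul (hΓ _ _ _))).sub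
    ((hC _ _ _).mul (hΓ _ _ _)))

theorem contMDiffAt_covDeriv (hx : x ∈ θ.domain) {k : ℕ} {T : (Fin k → Fin n) → M → ℝ}
    (hT : ∀ i, ContMDiffAt (𝓡 n) 𝓘(ℝ, ℝ) ∞ (T i) x) (i : Fin (k + 1) → Fin n) :
    ContMDiffAt (𝓡 n) 𝓘(ℝ, ℝ) ∞ (θ.covDeriv T i) x := by
  refine (θ.contMDiffAt_frameDeriv hx _ (hT _)).sub ?_
  refine contMDiffAt_finsetSum fun j _ ↦ contMDiffAt_finsetSum fun m _ ↦
    contMDiffAt_finsetSum fun l _ ↦ ?_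
  exact (contMDiffAt_const.mul (θ.contMDiffAt_connection hx _ _ _)).mul (hT _)

theorem contMDiffAt_nablaRiemann (hx : x ∈ θ.domain) (k : ℕ) :
    ∀ i, ContMDiffAt (𝓡 n) 𝓘(ℝ, ℝ) ∞ (θ.nablaRiemann k i) x := by
  induction k with
  | zero => exact fun i ↦ θ.contMDiffAt_riemann hx _ _ _ _
  | succ k ih => exact θ.contMDiffAt_covDeriv hx ih

theorem contMDiffAt_curvature (hx : x ∈ θ.domain) (p : ℕ) :
    ContMDiffAt (𝓡 n) 𝓘(ℝ, CurvSpace n p) ∞ (θ.curvature p) x := by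
  refine contMDiffAt_pi_space.2 fun k ↦ contMDiffAt_pi_space.2 fun i ↦ ?_
  exact θ.contMDiffAt_nablaRiemann hx k i

/-! ### Derivation rules -/

theorem frameDeriv_congr {f h : M → ℝ} (H : f =ᶠ[𝓝 x] h) (a : Fin n) :
    θ.frameDeriv a f x = θ.frameDeriv a h x := by
  simp only [frameDeriv, H.mfderiv_eq]
  rfl

theorem frameDeriv_const (c : ℝ) (a : Fin n) : θ.frameDeriv a (fun _ ↦ c) x = 0 := by
  simp only [frameDeriv, mfderiv_const]
  rfl

theorem frameDeriv_add {f h : M → ℝ} (hf : ContMDiffAt (𝓡 n) 𝓘(ℝ, ℝ) ∞ f x)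
    (hh : ContMDiffAt (𝓡 n) 𝓘(ℝ, ℝ) ∞ h x) (a : Fin n) :
    θ.frameDeriv a (fun y ↦ f y + h y) x = θ.frameDeriv a f x + θ.frameDeriv a h x := by
  have := (hf.mdifferentiableAt (by simp)).hasMFDerivAt.add
    (hh.mdifferentiableAt (by simp)).hasMFDerivAt
  exact congrArg (fun L ↦ L (θ.frame a x)) this.mfderiv

theorem frameDeriv_mul {f h : M → ℝ} (hf : ContMDiffAt (𝓡 n) 𝓘(ℝ, ℝ) ∞ f x)
    (hh : ContMDiffAt (𝓡 n) 𝓘(ℝ, ℝ) ∞ h x) (a : Fin n) :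
    θ.frameDeriv a (fun y ↦ f y * h y) x
      = f x * θ.frameDeriv a h x + θ.frameDeriv a f x * h x := by
  have := (hf.mdifferentiableAt (by simp)).hasMFDerivAt.mul
    (hh.mdifferentiableAt (by simp)).hasMFDerivAt
  refine (congrArg (fun L ↦ L (θ.frame a x)) this.mfderiv).trans ?_
  rw [mul_comm (θ.frameDeriv a f x)]
  rfl

theorem frameDeriv_sum {ι : Type*} (s : Finset ι) {f : ι → M → ℝ}
    (hf : ∀ i ∈ s, ContMDiffAt (𝓡 n) 𝓘(ℝ, ℝ) ∞ (f i) x) (a : Fin n) :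
    θ.frameDeriv a (fun y ↦ ∑ i ∈ s, f i y) x = ∑ i ∈ s, θ.frameDeriv a (f i) x := by
  classical
  induction s using Finset.induction_on with
  | empty => simpa using θ.frameDeriv_const 0 a
  | insert i s hi ih =>
    simp only [Finset.sum_insert hi]
    rw [θ.frameDeriv_add (hf i (by simp))
      (contMDiffAt_finsetSum fun j hj ↦ hf j (Finset.mem_insert_of_mem hj)),
      ih fun j hj ↦ hf j (Finset.mem_insert_of_mem hj)]

theorem frameDeriv_const_mul {f : M → ℝ} (hf : ContMDiffAt (𝓡 n) 𝓘(ℝ, ℝ) ∞ f x) (c : ℝ)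
    (a : Fin n) : θ.frameDeriv a (fun y ↦ c * f y) x = c * θ.frameDeriv a f x := by
  rw [θ.frameDeriv_mul contMDiffAt_const hf, θ.frameDeriv_const]; ring

theorem frameDeriv_prod {ι : Type*} [DecidableEq ι] (s : Finset ι) {f : ι → M → ℝ}
    (hf : ∀ i ∈ s, ContMDiffAt (𝓡 n) 𝓘(ℝ, ℝ) ∞ (f i) x) (a : Fin n) :
    θ.frameDeriv a (fun y ↦ ∏ i ∈ s, f i y) x
      = ∑ i ∈ s, θ.frameDeriv a (f i) x * ∏ j ∈ s.erase i, f j x := by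
  induction s using Finset.induction_on with
  | empty => simpa using θ.frameDeriv_const 1 a
  | insert i s hi ih =>
    simp only [Finset.prod_insert hi]
    rw [θ.frameDeriv_mul (hf i (by simp))
      (contMDiffAt_finsetProd fun j hj ↦ hf j (Finset.mem_insert_of_mem hj)),
      ih fun j hj ↦ hf j (Finset.mem_insert_of_mem hj), Finset.sum_insert hi,
      Finset.erase_insert hi, Finset.mul_sum, add_comm]
    congr 1
    refine Finset.sum_congr rfl fun j hj ↦ ?_
    have hij : i ≠ j := fun h ↦ hi (h ▸ hj)
    rw [Finset.erase_insert_of_ne hij, Finset.prod_insert (by simp [hi])]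
    ring

end MovingCoframe
end FrameCalculus

/-! ### Expansion in the frame, brackets, and the Levi-Civita symmetries -/

section FrameCalculus

variable {n : ℕ} {M : Type*} [TopologicalSpace M]
  [ChartedSpace (EuclideanSpace ℝ (Fin n)) M] [IsManifold (𝓡 n) ∞ M]
  {g : PseudoRiemannianMetric n M} {η : Matrix (Fin n) (Fin n) ℝ}

namespace MovingCoframe

variable (θ : MovingCoframe g η) {x : M}

theorem isSymm_of_mem (θ : MovingCoframe g η) (hx : x ∈ θ.domain) : η.IsSymm := by
  ext a b
  rw [Matrix.transpose_apply, ← θ.orthonormal x hx, ← θ.orthonormal x hx, g.symm]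

/-- The components of a tangent vector in the frame. -/
def coord (m : Fin n) (x : M) (v : TangentSpace (𝓡 n) x) : ℝ :=
  ∑ l, η⁻¹ m l * g.inner x v (θ.frame l x)

theorem inner_sum_frame (hx : x ∈ θ.domain) (c : Fin n → ℝ) (l : Fin n) :
    g.inner x (∑ m, c m • θ.frame m x) (θ.frame l x) = (c ᵥ* η) l := by
  rw [map_sum, sum_apply]
  refine Finset.sum_congr rfl fun m _ ↦ ?_
  rw [map_smul, smul_apply, θ.orthonormal x hx]
  rfl

theorem coord_sum_frame (hdet : IsUnit η.det) (hx : x ∈ θ.domain) (c : Fin n → ℝ) (m : Fin n) :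
    θ.coord m x (∑ m, c m • θ.frame m x) = c m := by
  have hs : η⁻¹.IsSymm := by
    rw [Matrix.IsSymm, Matrix.transpose_nonsing_inv, θ.isSymm_of_mem hx]
  calc θ.coord m x (∑ m, c m • θ.frame m x) = ∑ l, (c ᵥ* η) l * η⁻¹ l m := by
        refine Finset.sum_congr rfl fun l _ ↦ ?_
        rw [θ.inner_sum_frame hx, hs.apply, mul_comm]
    _ = (c ᵥ* η ᵥ* η⁻¹) m := rfl
    _ = c m := by rw [Matrix.vecMul_vecMul, Matrix.mul_nonsing_inv _ hdet, Matrix.vecMul_one]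

theorem linearIndependent_frame (hdet : IsUnit η.det) (hx : x ∈ θ.domain) :
    LinearIndependent ℝ (fun m ↦ θ.frame m x) := by
  rw [Fintype.linearIndependent_iff]
  intro c hc m
  rw [← θ.coord_sum_frame hdet hx c m, hc]
  simp [coord]

theorem sum_coord_frame (hdet : IsUnit η.det) (hx : x ∈ θ.domain) (v : TangentSpace (𝓡 n) x) :
    ∑ m, θ.coord m x v • θ.frame m x = v := by
  have hcard : Fintype.card (Fin n) = Module.finrank ℝ (TangentSpace (𝓡 n) x) := by
    change _ = Module.finrank ℝ (EuclideanSpace ℝ (Fin n))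
    simp
  have : FiniteDimensional ℝ (TangentSpace (𝓡 n) x) :=
    inferInstanceAs (FiniteDimensional ℝ (EuclideanSpace ℝ (Fin n)))
  have hspan := (θ.linearIndependent_frame hdet hx).span_eq_top_of_card_eq_finrank' hcard
  have hv : v ∈ Submodule.span ℝ (Set.range fun m ↦ θ.frame m x) := hspan ▸ Submodule.mem_top
  obtain ⟨c, rfl⟩ := (Submodule.mem_span_range_iff_exists_fun ℝ).1 hv
  simp only [θ.coord_sum_frame hdet hx]

theorem frame_ne_zero (hdet : IsUnit η.det) (hx : x ∈ θ.domain) (a : Fin n) :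
    θ.frame a x ≠ 0 := (θ.linearIndependent_frame hdet hx).ne_zero a

theorem mdifferentiableAt_frame (hx : x ∈ θ.domain) (a : Fin n) :
    MDifferentiableAt (𝓡 n) (𝓡 n).tangent
      (fun x ↦ (⟨x, θ.frame a x⟩ : TangentBundle (𝓡 n) M)) x :=
  (θ.contMDiffAt_frame hx a).mdifferentiableAt (by simp)

/-- The bracket with a product `f e_c`. -/
theorem mlieBracket_frame_smul (V : ∀ x : M, TangentSpace (𝓡 n) x) (hx : x ∈ θ.domain) (c : Fin n)
    {f : M → ℝ} (hf : ContMDiffAt (𝓡 n) 𝓘(ℝ, ℝ) ∞ f x) :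
    VectorField.mlieBracket (𝓡 n) V (f • θ.frame c) x
      = mvfderiv (𝓡 n) f x (V x) • θ.frame c x
        + f x • VectorField.mlieBracket (𝓡 n) V (θ.frame c) x := by
  have : IsManifold (𝓡 n) (minSmoothness ℝ 2) M :=
    IsManifold.of_le (n := ∞) (by simpa using! (mod_cast le_top : ((2 : ℕ∞) : WithTop ℕ∞) ≤ ((⊤ : ℕ∞) : WithTop ℕ∞)))
  exact VectorField.mlieBracket_smul_right (hf.mdifferentiableAt (by simp))
    (θ.mdifferentiableAt_frame hx c)

/-- The bracket `[e_a, f e_c]` to second order. -/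
theorem mlieBracket_mlieBracket_smul (hx : x ∈ θ.domain) (a b c : Fin n)
    {f : M → ℝ} (hf : ContMDiffAt (𝓡 n) 𝓘(ℝ, ℝ) ∞ f x)
    (hf' : ∀ᶠ y in 𝓝 x, ContMDiffAt (𝓡 n) 𝓘(ℝ, ℝ) ∞ f y) :
    VectorField.mlieBracket (𝓡 n) (θ.frame a)
        (VectorField.mlieBracket (𝓡 n) (θ.frame b) (f • θ.frame c)) x
      = θ.frameDeriv a (θ.frameDeriv b f) x • θ.frame c x
        + θ.frameDeriv b f x • VectorField.mlieBracket (𝓡 n) (θ.frame a) (θ.frame c) x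
        + (θ.frameDeriv a f x • VectorField.mlieBracket (𝓡 n) (θ.frame b) (θ.frame c) x
        + f x • VectorField.mlieBracket (𝓡 n) (θ.frame a)
          (VectorField.mlieBracket (𝓡 n) (θ.frame b) (θ.frame c)) x) := by
  have : IsManifold (𝓡 n) (minSmoothness ℝ 2) M :=
    IsManifold.of_le (n := ∞) (by simpa using! (mod_cast le_top : ((2 : ℕ∞) : WithTop ℕ∞) ≤ ((⊤ : ℕ∞) : WithTop ℕ∞)))
  have h1 : VectorField.mlieBracket (𝓡 n) (θ.frame b) (f • θ.frame c) =ᶠ[𝓝 x]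
      (θ.frameDeriv b f • θ.frame c + f • VectorField.mlieBracket (𝓡 n) (θ.frame b) (θ.frame c)) := by
    filter_upwards [hf', θ.isOpen_domain.mem_nhds hx] with y hy hy'
    exact θ.mlieBracket_frame_smul _ hy' c hy
  have h2 : MDifferentiableAt (𝓡 n) (𝓡 n).tangent (fun y ↦ (⟨y, VectorField.mlieBracket (𝓡 n)
      (θ.frame b) (θ.frame c) y⟩ : TangentBundle (𝓡 n) M)) x :=
    (θ.contMDiffAt_bracket hx b c).mdifferentiableAt (by simp)
  have h3 : MDifferentiableAt (𝓡 n) 𝓘(ℝ, ℝ) f x := hf.mdifferentiableAt (by simp)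
  have h4 : MDifferentiableAt (𝓡 n) 𝓘(ℝ, ℝ) (θ.frameDeriv b f) x :=
    (θ.contMDiffAt_frameDeriv hx b hf).mdifferentiableAt (by simp)
  refine (Filter.EventuallyEq.mlieBracket_vectorField_eq Filter.EventuallyEq.rfl h1).trans ?_
  refine (VectorField.mlieBracket_add_right
    (h4.smul_section (θ.mdifferentiableAt_frame hx c)) (h3.smul_section h2)).trans ?_
  exact congrArg₂ (· + ·) (VectorField.mlieBracket_smul_right h4 (θ.mdifferentiableAt_frame hx c))
    (VectorField.mlieBracket_smul_right h3 h2)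

/-- The Jacobi identity for `e_a`, `e_b` and `f e_a` does the work. Expand it by the Leibniz rule
and subtract `f` times the identity for `e_a`, `e_b`, `e_a`. All bracket terms cancel and what
remains is the wanted difference times `e_a`, which is nowhere zero. -/
theorem frameDeriv_comm (hdet : IsUnit η.det) (hx : x ∈ θ.domain) (a b : Fin n) {f : M → ℝ}
    (hf : ∀ᶠ y in 𝓝 x, ContMDiffAt (𝓡 n) 𝓘(ℝ, ℝ) ∞ f y) :
    θ.frameDeriv a (θ.frameDeriv b f) x - θ.frameDeriv b (θ.frameDeriv a f) x
      = mvfderiv (𝓡 n) f x (VectorField.mlieBracket (𝓡 n) (θ.frame a) (θ.frame b) x) := by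
  have hm : IsManifold (𝓡 n) (minSmoothness ℝ 3) M :=
    IsManifold.of_le (n := ∞)
      (by simpa using! (mod_cast le_top : ((3 : ℕ∞) : WithTop ℕ∞) ≤ ((⊤ : ℕ∞) : WithTop ℕ∞)))
  have hle : minSmoothness ℝ 2 ≤ ∞ := 
    (by simpa using! (mod_cast le_top : ((2 : ℕ∞) : WithTop ℕ∞) ≤ ((⊤ : ℕ∞) : WithTop ℕ∞)))
  have hfx := hf.self_of_nhds
  have hfr := fun c ↦ (θ.contMDiffAt_frame hx c).of_le hle
  have hW : ContMDiffAt (𝓡 n) (𝓡 n).tangent ∞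
      (fun y ↦ (⟨y, (f • θ.frame a) y⟩ : TangentBundle (𝓡 n) M)) x :=
    hfx.smul_section (θ.contMDiffAt_frame hx a)
  have h1 := VectorField.leibniz_identity_mlieBracket_apply (hfr a) (hfr b) (hW.of_le hle)
  have h0 := VectorField.leibniz_identity_mlieBracket_apply (hfr a) (hfr b) (hfr a)
  rw [θ.mlieBracket_mlieBracket_smul hx a b a hfx hf,
    θ.mlieBracket_mlieBracket_smul hx b a a hfx hf, θ.mlieBracket_frame_smul _ hx a hfx, h0] at h1
  have h2 : (θ.frameDeriv a (θ.frameDeriv b f) x - θ.frameDeriv b (θ.frameDeriv a f) x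
      - mvfderiv (𝓡 n) f x (VectorField.mlieBracket (𝓡 n) (θ.frame a) (θ.frame b) x))
        • θ.frame a x = 0 := by
    rw [← sub_eq_zero] at h1
    rw [← h1]
    module
  have h3 := (smul_eq_zero.1 h2).resolve_right (θ.frame_ne_zero hdet hx a)
  linarith

/-- The structure functions with the last index raised. -/
def structureCoeff (a b m : Fin n) (x : M) : ℝ := ∑ l, η⁻¹ m l * θ.structureFun a b l x

theorem mlieBracket_eq_sum (hdet : IsUnit η.det) (hx : x ∈ θ.domain) (a b : Fin n) :
    VectorField.mlieBracket (𝓡 n) (θ.frame a) (θ.frame b) x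
      = ∑ m, θ.structureCoeff a b m x • θ.frame m x :=
  (θ.sum_coord_frame hdet hx _).symm

theorem frameDeriv_comm_eq_sum (hdet : IsUnit η.det) (hx : x ∈ θ.domain) (a b : Fin n) {f : M → ℝ}
    (hf : ∀ᶠ y in 𝓝 x, ContMDiffAt (𝓡 n) 𝓘(ℝ, ℝ) ∞ f y) :
    θ.frameDeriv a (θ.frameDeriv b f) x - θ.frameDeriv b (θ.frameDeriv a f) x
      = ∑ m, θ.structureCoeff a b m x * θ.frameDeriv m f x := by
  rw [θ.frameDeriv_comm hdet hx a b hf, θ.mlieBracket_eq_sum hdet hx, map_sum]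
  refine Finset.sum_congr rfl fun m _ ↦ ?_
  rw [map_smul]
  rfl

theorem structureFun_swap (a b c : Fin n) (x : M) :
    θ.structureFun a b c x = -θ.structureFun b a c x := by
  rw [structureFun, structureFun, VectorField.mlieBracket_swap_apply, map_neg]
  rfl

/-- Metric compatibility: the Koszul expression inherits it from the antisymmetry of the bracket. -/
theorem connection_swap (a b c : Fin n) (x : M) :
    θ.connection a b c x = -θ.connection a c b x := by
  rw [connection, connection, θ.structureFun_swap a c b, θ.structureFun_swap c b a,
    θ.structureFun_swap b a c]
  ring

/-- Vanishing torsion, read in the frame. -/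
theorem structureFun_eq_connection (a b c : Fin n) (x : M) :
    θ.structureFun a b c x = θ.connection a b c x - θ.connection b a c x := by
  rw [connection, connection, θ.structureFun_swap b a c, θ.structureFun_swap a c b,
    θ.structureFun_swap c b a]
  ring

end MovingCoframe
end FrameCalculus

/-! ### Change of coframe: the connection transforms by a gauge transformation -/

section MatrixFunctions

variable {n : ℕ} {M : Type*} [TopologicalSpace M]
  [ChartedSpace (EuclideanSpace ℝ (Fin n)) M] {x : M}

/-- Entrywise smoothness at a point. -/
def MatSmoothAt (A : M → Matrix (Fin n) (Fin n) ℝ) (x : M) : Prop :=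
  ∀ i j, ContMDiffAt (𝓡 n) 𝓘(ℝ, ℝ) ∞ (fun y ↦ A y i j) x

theorem MatSmoothAt.mul {A B : M → Matrix (Fin n) (Fin n) ℝ}
    (hA : MatSmoothAt A x) (hB : MatSmoothAt B x) : MatSmoothAt (fun y ↦ A y * B y) x := by
  intro i j
  simp only [Matrix.mul_apply]
  exact contMDiffAt_finsetSum fun k _ ↦ (hA i k).mul (hB k j)

theorem MatSmoothAt.add {A B : M → Matrix (Fin n) (Fin n) ℝ}
    (hA : MatSmoothAt A x) (hB : MatSmoothAt B x) : MatSmoothAt (fun y ↦ A y + B y) x :=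
  fun i j ↦ (hA i j).add (hB i j)

theorem MatSmoothAt.transpose {A : M → Matrix (Fin n) (Fin n) ℝ}
    (hA : MatSmoothAt A x) : MatSmoothAt (fun y ↦ (A y)ᵀ) x := fun i j ↦ hA j i

theorem matSmoothAt_const (A : Matrix (Fin n) (Fin n) ℝ) :
    MatSmoothAt (fun _ : M ↦ A) x := fun _ _ ↦ contMDiffAt_const

end MatrixFunctions

section FrameChange

variable {n : ℕ} {M : Type*} [TopologicalSpace M]
  [ChartedSpace (EuclideanSpace ℝ (Fin n)) M] [IsManifold (𝓡 n) ∞ M]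
  {g : PseudoRiemannianMetric n M} {η : Matrix (Fin n) (Fin n) ℝ}

namespace MovingCoframe

variable (θ θ' : MovingCoframe g η) {x : M}

/-! ### Matrix-valued functions -/

/-- The entrywise frame derivative of a matrix-valued function. -/
def matDeriv (a : Fin n) (A : M → Matrix (Fin n) (Fin n) ℝ) (x : M) : Matrix (Fin n) (Fin n) ℝ :=
  Matrix.of fun i j ↦ θ.frameDeriv a (fun y ↦ A y i j) x

theorem matSmoothAt_matDeriv (hx : x ∈ θ.domain) {A : M → Matrix (Fin n) (Fin n) ℝ}
    (hA : MatSmoothAt A x) (a : Fin n) : MatSmoothAt (θ.matDeriv a A) x :=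
  fun i j ↦ θ.contMDiffAt_frameDeriv hx a (hA i j)

theorem matDeriv_mul {A B : M → Matrix (Fin n) (Fin n) ℝ} (hA : MatSmoothAt A x)
    (hB : MatSmoothAt B x) (a : Fin n) :
    θ.matDeriv a (fun y ↦ A y * B y) x = θ.matDeriv a A x * B x + A x * θ.matDeriv a B x := by
  ext i j
  simp only [matDeriv, Matrix.of_apply, Matrix.add_apply, Matrix.mul_apply]
  refine (θ.frameDeriv_sum _ (f := fun k y ↦ A y i k * B y k j)
    (fun k _ ↦ (hA i k).mul (hB k j)) a).trans ?_
  rw [← Finset.sum_add_distrib]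
  refine Finset.sum_congr rfl fun k _ ↦ ?_
  rw [θ.frameDeriv_mul (hA i k) (hB k j), add_comm]

theorem matDeriv_add {A B : M → Matrix (Fin n) (Fin n) ℝ} (hA : MatSmoothAt A x)
    (hB : MatSmoothAt B x) (a : Fin n) :
    θ.matDeriv a (fun y ↦ A y + B y) x = θ.matDeriv a A x + θ.matDeriv a B x := by
  ext i j
  exact θ.frameDeriv_add (hA i j) (hB i j) a

theorem matDeriv_transpose (A : M → Matrix (Fin n) (Fin n) ℝ) (a : Fin n) :
    θ.matDeriv a (fun y ↦ (A y)ᵀ) x = (θ.matDeriv a A x)ᵀ := rfl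

theorem matDeriv_const (A : Matrix (Fin n) (Fin n) ℝ) (a : Fin n) :
    θ.matDeriv a (fun _ ↦ A) x = 0 := by
  ext i j
  exact θ.frameDeriv_const _ a

theorem matDeriv_congr {A B : M → Matrix (Fin n) (Fin n) ℝ} (h : A =ᶠ[𝓝 x] B) (a : Fin n) :
    θ.matDeriv a A x = θ.matDeriv a B x := by
  ext i j
  exact θ.frameDeriv_congr (h.mono fun y hy ↦ by simp only [hy]) a

/-! ### The transition matrix -/

/-- The transition matrix `X` between two frames: `e'_a = ∑ b, X_ba e_b`. -/
def transition (x : M) : Matrix (Fin n) (Fin n) ℝ :=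
  Matrix.of fun b a ↦ θ.coord b x (θ'.frame a x)

variable {θ θ'}

theorem matSmoothAt_transition (hx : x ∈ θ.domain) (hx' : x ∈ θ'.domain) :
    MatSmoothAt (θ.transition θ') x := by
  intro b a
  change ContMDiffAt (𝓡 n) 𝓘(ℝ, ℝ) ∞
    (fun y ↦ ∑ l, η⁻¹ b l * g.inner y (θ'.frame a y) (θ.frame l y)) x
  exact contMDiffAt_finsetSum fun l _ ↦ contMDiffAt_const.mul
    (g.contMDiffAt_inner (θ'.contMDiffAt_frame hx' a) (θ.contMDiffAt_frame hx l))

theorem frame_eq_sum_transition (hdet : IsUnit η.det) (hx : x ∈ θ.domain) (a : Fin n) :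
    θ'.frame a x = ∑ b, θ.transition θ' x b a • θ.frame b x :=
  (θ.sum_coord_frame hdet hx _).symm

theorem transition_mem_orth (hdet : IsUnit η.det) (hx : x ∈ θ.domain) (hx' : x ∈ θ'.domain) :
    (θ.transition θ' x)ᵀ * η * θ.transition θ' x = η := by
  ext a b
  rw [← θ'.orthonormal x hx' a b, frame_eq_sum_transition hdet hx b, map_sum]
  rw [Matrix.mul_apply]
  refine Finset.sum_congr rfl fun c _ ↦ ?_
  rw [map_smul, frame_eq_sum_transition hdet hx a, θ.inner_sum_frame hx, smul_eq_mul, mul_comm]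
  rfl

theorem frameDeriv_eq_sum_transition (hdet : IsUnit η.det) (hx : x ∈ θ.domain) (a : Fin n)
    (f : M → ℝ) :
    θ'.frameDeriv a f x = ∑ b, θ.transition θ' x b a * θ.frameDeriv b f x := by
  have h : θ'.frameDeriv a f x = mvfderiv (𝓡 n) f x (θ'.frame a x) := rfl
  rw [h, frame_eq_sum_transition hdet hx, map_sum]
  refine Finset.sum_congr rfl fun b _ ↦ ?_
  rw [map_smul]
  rfl

theorem mlieBracket_sum_smul_frame (hx : x ∈ θ.domain) (V : ∀ x : M, TangentSpace (𝓡 n) x)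
    {f : Fin n → M → ℝ} (hf : ∀ d, ContMDiffAt (𝓡 n) 𝓘(ℝ, ℝ) ∞ (f d) x) :
    VectorField.mlieBracket (𝓡 n) V (∑ d, f d • θ.frame d) x
      = ∑ d, (mvfderiv (𝓡 n) (f d) x (V x) • θ.frame d x
        + f d x • VectorField.mlieBracket (𝓡 n) V (θ.frame d) x) := by
  have : IsManifold (𝓡 n) (minSmoothness ℝ 2) M :=
    IsManifold.of_le (n := ∞) (by simpa using! (mod_cast le_top : ((2 : ℕ∞) : WithTop ℕ∞) ≤ ((⊤ : ℕ∞) : WithTop ℕ∞)))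
  have key : ∀ s : Finset (Fin n), MDifferentiableAt (𝓡 n) (𝓡 n).tangent
      (fun y ↦ (⟨y, (∑ d ∈ s, f d • θ.frame d) y⟩ : TangentBundle (𝓡 n) M)) x ∧
      VectorField.mlieBracket (𝓡 n) V (∑ d ∈ s, f d • θ.frame d) x
      = ∑ d ∈ s, (mvfderiv (𝓡 n) (f d) x (V x) • θ.frame d x
        + f d x • VectorField.mlieBracket (𝓡 n) V (θ.frame d) x) := by
    intro s
    induction s using Finset.induction_on with
    | empty =>
      refine ⟨?_, by simp [VectorField.mlieBracket_zero_right]⟩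
      simp only [Finset.sum_empty]
      exact (Bundle.contMDiff_zeroSection ℝ (TangentSpace (𝓡 n))).mdifferentiable (n := ∞) (by simp) x
    | insert i s hi ih =>
      simp only [Finset.sum_insert hi]
      have h1 : MDifferentiableAt (𝓡 n) (𝓡 n).tangent
          (fun y ↦ (⟨y, (f i • θ.frame i) y⟩ : TangentBundle (𝓡 n) M)) x :=
        MDifferentiableAt.smul_section ((hf i).mdifferentiableAt (by simp)) (θ.mdifferentiableAt_frame hx i)
      refine ⟨mdifferentiableAt_add_section h1 ih.1, ?_⟩
      rw [VectorField.mlieBracket_add_right h1 ih.1, ih.2, θ.mlieBracket_frame_smul V hx i (hf i)]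
  exact (key Finset.univ).2

/-- Leibniz rule in both slots of the bracket. Only the second slot is expanded directly; the first
is reached by swapping the arguments. -/
theorem mlieBracket_transition (hdet : IsUnit η.det) (hx : x ∈ θ.domain) (hx' : x ∈ θ'.domain)
    (a b : Fin n) :
    VectorField.mlieBracket (𝓡 n) (θ'.frame a) (θ'.frame b) x
      = ∑ e, ((∑ d, θ.transition θ' x d a * θ.matDeriv d (θ.transition θ') x e b)
          - (∑ d, θ.transition θ' x d b * θ.matDeriv d (θ.transition θ') x e a)
          + ∑ c, ∑ d, θ.transition θ' x c a * θ.transition θ' x d b * θ.structureCoeff c d e x)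
        • θ.frame e x := by
  have hsm := matSmoothAt_transition hx hx'
  have heq : ∀ a, θ'.frame a =ᶠ[𝓝 x] ∑ b, (fun y ↦ θ.transition θ' y b a) • θ.frame b := by
    intro a
    filter_upwards [θ.isOpen_domain.mem_nhds hx] with y hy
    exact (frame_eq_sum_transition hdet hy a).trans
      (Finset.sum_apply y Finset.univ fun b ↦ (fun y ↦ θ.transition θ' y b a) • θ.frame b).symm
  have hright : ∀ (V : ∀ x : M, TangentSpace (𝓡 n) x) (b : Fin n),
      VectorField.mlieBracket (𝓡 n) V (θ'.frame b) x
        = ∑ d, (mvfderiv (𝓡 n) (fun y ↦ θ.transition θ' y d b) x (V x) • θ.frame d x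
          + θ.transition θ' x d b • VectorField.mlieBracket (𝓡 n) V (θ.frame d) x) := fun V b ↦
    (Filter.EventuallyEq.mlieBracket_vectorField_eq Filter.EventuallyEq.rfl (heq b)).trans
      (mlieBracket_sum_smul_frame hx V fun d ↦ hsm d b)
  have h1 : ∀ d, VectorField.mlieBracket (𝓡 n) (θ'.frame a) (θ.frame d) x
      = -∑ c, (θ.matDeriv d (θ.transition θ') x c a • θ.frame c x
          + θ.transition θ' x c a • ∑ e, θ.structureCoeff d c e x • θ.frame e x) := by
    intro d
    rw [VectorField.mlieBracket_swap_apply, hright]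
    simp only [θ.mlieBracket_eq_sum hdet hx]
    rfl
  have h2 : ∀ d, mvfderiv (𝓡 n) (fun y ↦ θ.transition θ' y d b) x (θ'.frame a x)
      = ∑ c, θ.transition θ' x c a * θ.matDeriv c (θ.transition θ') x d b :=
    fun d ↦ frameDeriv_eq_sum_transition hdet hx a _
  have hswap : ∀ d c e, θ.structureCoeff d c e x = -θ.structureCoeff c d e x := by
    intro d c e
    simp only [structureCoeff, ← Finset.sum_neg_distrib]
    exact Finset.sum_congr rfl fun l _ ↦ by rw [θ.structureFun_swap]; ring
  rw [hright]
  simp only [h1, h2, Finset.sum_add_distrib, add_smul, sub_smul, smul_neg, smul_add, neg_add_rev]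
  rw [Finset.sum_neg_distrib, Finset.sum_neg_distrib]
  have h3 : ∑ d, θ.transition θ' x d b • ∑ c, θ.matDeriv d (θ.transition θ') x c a • θ.frame c x
      = ∑ e, (∑ d, θ.transition θ' x d b * θ.matDeriv d (θ.transition θ') x e a) • θ.frame e x := by
    simp only [Finset.smul_sum, Finset.sum_smul, smul_smul]
    rw [Finset.sum_comm]
  have h4 : ∑ d, θ.transition θ' x d b • ∑ c, θ.transition θ' x c a •
        ∑ e, θ.structureCoeff d c e x • θ.frame e x
      = -∑ e, (∑ c, ∑ d, θ.transition θ' x c a * θ.transition θ' x d b * θ.structureCoeff c d e x)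
        • θ.frame e x := by
    simp only [Finset.smul_sum, Finset.sum_smul, smul_smul, ← Finset.sum_neg_distrib]
    rw [Finset.sum_comm]
    conv_rhs => rw [Finset.sum_comm]
    refine Finset.sum_congr rfl fun c _ ↦ ?_
    rw [Finset.sum_comm]
    refine Finset.sum_congr rfl fun e _ ↦ Finset.sum_congr rfl fun d _ ↦ ?_
    rw [hswap d c e, ← neg_smul]
    congr 1
    ring
  rw [Finset.sum_sub_distrib, h3, h4]
  abel

end MovingCoframe
end FrameChange

/-- The quadratic term of the curvature for two gauge transforms. The differentiated orthogonality
`hA` lets `X` be factored out on the left of the second factor, and `X * H * Xᵀ = H` then removes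
`X` from the middle. -/
theorem gauge_mul {n : ℕ} {X H η A B G K : Matrix (Fin n) (Fin n) ℝ} (hX : X * H * Xᵀ = H)
    (hηH : η * H = 1) (hHη : H * η = 1) (hA : Aᵀ * η * X = -(Xᵀ * η * A)) :
    (Xᵀ * G * X + Bᵀ * η * X) * H * (Xᵀ * K * X + Aᵀ * η * X)
      = Xᵀ * (G * H * K) * X - Xᵀ * G * A + Bᵀ * K * X - Bᵀ * η * A := by
  rw [hA]
  calc _ = (Xᵀ * G + Bᵀ * η) * (X * H * Xᵀ) * (K * X - η * A) := by noncomm_ring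
    _ = Xᵀ * (G * H * K) * X - Xᵀ * G * (H * η) * A + Bᵀ * (η * H) * K * X
          - Bᵀ * (η * H) * η * A := by
        rw [hX]; noncomm_ring
    _ = _ := by simp only [hηH, hHη, mul_one]

section FrameChange

variable {n : ℕ} {M : Type*} [TopologicalSpace M]
  [ChartedSpace (EuclideanSpace ℝ (Fin n)) M] [IsManifold (𝓡 n) ∞ M]
  {g : PseudoRiemannianMetric n M} {η : Matrix (Fin n) (Fin n) ℝ}

namespace MovingCoframe

variable (θ θ' : MovingCoframe g η) {x : M}

/-- The matrix of connection components `Γ_acd` for fixed `a`. -/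
def connMat (a : Fin n) (x : M) : Matrix (Fin n) (Fin n) ℝ :=
  Matrix.of fun c d ↦ θ.connection a c d x

/-- The matrix of curvature components `R_abcd` for fixed `a, b`. -/
def riemMat (a b : Fin n) (x : M) : Matrix (Fin n) (Fin n) ℝ :=
  Matrix.of fun c d ↦ θ.riemann a b c d x

theorem connMat_transpose (a : Fin n) (x : M) : (θ.connMat a x)ᵀ = -θ.connMat a x := by
  ext c d
  exact θ.connection_swap a d c x

theorem matSmoothAt_connMat (hx : x ∈ θ.domain) (a : Fin n) : MatSmoothAt (θ.connMat a) x :=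
  fun c d ↦ θ.contMDiffAt_connection hx a c d

theorem isSymm_inv (θ : MovingCoframe g η) (hx : x ∈ θ.domain) : η⁻¹.IsSymm := by
  rw [Matrix.IsSymm, Matrix.transpose_nonsing_inv, θ.isSymm_of_mem hx]

theorem riemMat_eq (hx : x ∈ θ.domain) (a b : Fin n) :
    θ.riemMat a b x = θ.matDeriv a (θ.connMat b) x - θ.matDeriv b (θ.connMat a) x
      + (θ.connMat b x * η⁻¹ * θ.connMat a x - θ.connMat a x * η⁻¹ * θ.connMat b x
        - ∑ m, θ.structureCoeff a b m x • θ.connMat m x) := by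
  ext c d
  have hs := θ.isSymm_inv hx
  simp only [riemMat, matDeriv, connMat, structureCoeff, riemann, Matrix.of_apply, Matrix.add_apply,
    Matrix.sub_apply, Matrix.mul_apply, Matrix.sum_apply, Matrix.smul_apply, smul_eq_mul]
  congr 1
  simp only [Finset.sum_mul, ← Finset.sum_sub_distrib]
  refine Finset.sum_congr rfl fun m _ ↦ Finset.sum_congr rfl fun l _ ↦ ?_
  rw [hs.apply m l]
  ring

variable {θ θ'}

theorem transition_mul_inv_mul (hdet : IsUnit η.det) (hx : x ∈ θ.domain) (hx' : x ∈ θ'.domain) :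
    θ.transition θ' x * η⁻¹ * (θ.transition θ' x)ᵀ = η⁻¹ := by
  set X := θ.transition θ' x
  have h1 : Xᵀ * η * X = η := transition_mem_orth hdet hx hx'
  have h2 : (η⁻¹ * Xᵀ * η) * X = 1 := by
    rw [mul_assoc, mul_assoc, ← mul_assoc Xᵀ, h1, Matrix.nonsing_inv_mul _ hdet]
  have h3 : X * (η⁻¹ * Xᵀ * η) = 1 := mul_eq_one_comm.1 h2
  calc X * η⁻¹ * Xᵀ = X * (η⁻¹ * Xᵀ * η) * η⁻¹ := by
        simp only [mul_assoc, Matrix.mul_nonsing_inv _ hdet, mul_one]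
    _ = η⁻¹ := by rw [h3, one_mul]

theorem matDeriv_transition_orth (hdet : IsUnit η.det) (hx : x ∈ θ.domain) (hx' : x ∈ θ'.domain)
    (a : Fin n) :
    (θ.matDeriv a (θ.transition θ') x)ᵀ * η * θ.transition θ' x
      = -((θ.transition θ' x)ᵀ * η * θ.matDeriv a (θ.transition θ') x) := by
  have hX := matSmoothAt_transition hx hx'
  have h1 : (fun y ↦ (θ.transition θ' y)ᵀ * η * θ.transition θ' y) =ᶠ[𝓝 x] fun _ ↦ η := by
    filter_upwards [θ.isOpen_domain.mem_nhds hx, θ'.isOpen_domain.mem_nhds hx'] with y hy hy'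
    exact transition_mem_orth hdet hy hy'
  have h2 := θ.matDeriv_congr h1 a
  rw [θ.matDeriv_const, θ.matDeriv_mul (hX.transpose.mul (matSmoothAt_const η)) hX,
    θ.matDeriv_mul hX.transpose (matSmoothAt_const η), θ.matDeriv_const, mul_zero, add_zero,
    θ.matDeriv_transpose] at h2
  exact eq_neg_of_add_eq_zero_left h2

variable (θ θ') in
/-- The gauge transform `Xᵀ Γ_a X + (e_a X)ᵀ η X` of the connection by the transition matrix. -/
def gaugeConn (a : Fin n) (x : M) : Matrix (Fin n) (Fin n) ℝ :=
  (θ.transition θ' x)ᵀ * θ.connMat a x * θ.transition θ' x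
    + (θ.matDeriv a (θ.transition θ') x)ᵀ * η * θ.transition θ' x

theorem gaugeConn_transpose (hdet : IsUnit η.det) (hx : x ∈ θ.domain) (hx' : x ∈ θ'.domain)
    (a : Fin n) : (θ.gaugeConn θ' a x)ᵀ = -θ.gaugeConn θ' a x := by
  have h1 := matDeriv_transition_orth hdet hx hx' a
  have h2 := θ.isSymm_of_mem hx
  rw [gaugeConn]
  simp only [Matrix.transpose_add, Matrix.transpose_mul, Matrix.transpose_transpose,
    θ.connMat_transpose, h2.eq]
  rw [h1]
  noncomm_ring

/-- The right side is the torsion-type difference of the candidate connection `∑ X_da • gaugeConn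
d`. Thus the candidate has the structure functions of the new frame, which is half of what
identifies it as the Levi-Civita connection. -/
theorem structureFun_transition (hdet : IsUnit η.det) (hx : x ∈ θ.domain) (hx' : x ∈ θ'.domain)
    (a b c : Fin n) :
    θ'.structureFun a b c x = (∑ d, θ.transition θ' x d a • θ.gaugeConn θ' d x) b c
      - (∑ d, θ.transition θ' x d b • θ.gaugeConn θ' d x) a c := by
  have h1 : θ'.structureFun a b c x = ∑ e, ((∑ d, θ.transition θ' x d a * θ.matDeriv d (θ.transition θ') x e b)
          - (∑ d, θ.transition θ' x d b * θ.matDeriv d (θ.transition θ') x e a)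
          + ∑ c, ∑ d, θ.transition θ' x c a * θ.transition θ' x d b * θ.structureCoeff c d e x)
        * (η * θ.transition θ' x) e c := by
    rw [structureFun, mlieBracket_transition hdet hx hx', map_sum, sum_apply]
    refine Finset.sum_congr rfl fun e _ ↦ ?_
    rw [map_smul, smul_apply, smul_eq_mul]
    congr 1
    rw [frame_eq_sum_transition hdet hx c, map_sum, Matrix.mul_apply]
    refine Finset.sum_congr rfl fun f _ ↦ ?_
    rw [map_smul, θ.orthonormal x hx, smul_eq_mul, mul_comm]
  have h2 : ∀ c' d c, ∑ e, θ.structureCoeff c' d e x * (η * θ.transition θ' x) e c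
      = ∑ f, (θ.connection c' d f x - θ.connection d c' f x) * θ.transition θ' x f c := by
    intro c' d c
    have h3 : ∀ e, θ.structureCoeff c' d e x = (η⁻¹ *ᵥ fun f ↦ θ.structureFun c' d f x) e :=
      fun _ ↦ rfl
    have h4 : ∀ f, θ.connection c' d f x - θ.connection d c' f x = θ.structureFun c' d f x :=
      fun f ↦ (θ.structureFun_eq_connection c' d f x).symm
    simp only [h3, h4]
    change ((η⁻¹ *ᵥ fun f ↦ θ.structureFun c' d f x) ᵥ* (η * θ.transition θ' x)) c =
      ((fun f ↦ θ.structureFun c' d f x) ᵥ* θ.transition θ' x) c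
    rw [← (θ.isSymm_inv hx).eq, Matrix.mulVec_transpose, Matrix.vecMul_vecMul, ← mul_assoc,
      Matrix.nonsing_inv_mul _ hdet, one_mul]
  have h5 : ∀ a b, (∑ d, θ.transition θ' x d a • θ.gaugeConn θ' d x) b c
      = (∑ d, ∑ e, ∑ f, θ.transition θ' x d a * θ.transition θ' x e b * 
            (θ.connection d e f x * θ.transition θ' x f c))
        + ∑ e, (∑ d, θ.transition θ' x d a * θ.matDeriv d (θ.transition θ') x e b)
          * (η * θ.transition θ' x) e c := by
    intro a b
    rw [Matrix.sum_apply]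
    simp only [Finset.sum_mul]
    conv_rhs => rw [add_comm, Finset.sum_comm, add_comm]
    rw [← Finset.sum_add_distrib]
    refine Finset.sum_congr rfl fun d _ ↦ ?_
    rw [Matrix.smul_apply, gaugeConn, Matrix.add_apply, smul_eq_mul, mul_add, mul_assoc _ _ (θ.transition θ' x),
      mul_assoc _ _ (θ.transition θ' x), Matrix.mul_apply, Matrix.mul_apply, Finset.mul_sum, Finset.mul_sum]
    congr 1
    · refine Finset.sum_congr rfl fun e _ ↦ ?_
      rw [Matrix.mul_apply, Finset.mul_sum, Finset.mul_sum]
      refine Finset.sum_congr rfl fun f _ ↦ ?_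
      simp only [connMat, Matrix.of_apply, Matrix.transpose_apply]
      ring
    · refine Finset.sum_congr rfl fun e _ ↦ ?_
      simp only [Matrix.transpose_apply]
      ring
  have h6 : ∑ e, (∑ c', ∑ d, θ.transition θ' x c' a * θ.transition θ' x d b * θ.structureCoeff c' d e x)
        * (η * θ.transition θ' x) e c
      = (∑ d, ∑ e, ∑ f, θ.transition θ' x d a * θ.transition θ' x e b * 
            (θ.connection d e f x * θ.transition θ' x f c))
        - (∑ d, ∑ e, ∑ f, θ.transition θ' x d b * θ.transition θ' x e a * 
            (θ.connection d e f x * θ.transition θ' x f c)) := by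
    simp only [Finset.sum_mul, mul_assoc]
    rw [Finset.sum_comm]
    conv_rhs => rw [sub_eq_add_neg, add_comm, Finset.sum_comm, add_comm, ← sub_eq_add_neg]
    rw [← Finset.sum_sub_distrib]
    refine Finset.sum_congr rfl fun d _ ↦ ?_
    rw [Finset.sum_comm, ← Finset.sum_sub_distrib]
    refine Finset.sum_congr rfl fun e _ ↦ ?_
    simp only [← Finset.mul_sum]
    rw [h2]
    simp only [sub_mul, Finset.sum_sub_distrib]
    ring
  rw [h1, h5, h5]
  simp only [add_mul, sub_mul, Finset.sum_add_distrib, Finset.sum_sub_distrib]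
  rw [h6]
  ring

/-- Uniqueness of the Levi-Civita connection: the gauge transform is antisymmetric in its last two
indices and has the right structure functions, and the Koszul formula recovers any such connection
from them. -/
theorem connMat_transition (hdet : IsUnit η.det) (hx : x ∈ θ.domain) (hx' : x ∈ θ'.domain)
    (a : Fin n) :
    θ'.connMat a x = ∑ d, θ.transition θ' x d a • θ.gaugeConn θ' d x := by
  have hanti : ∀ a b c, (∑ d, θ.transition θ' x d a • θ.gaugeConn θ' d x) b c
      = -(∑ d, θ.transition θ' x d a • θ.gaugeConn θ' d x) c b := by
    intro a b c
    rw [Matrix.sum_apply, Matrix.sum_apply, ← Finset.sum_neg_distrib]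
    refine Finset.sum_congr rfl fun d _ ↦ ?_
    have := congrFun (congrFun (gaugeConn_transpose hdet hx hx' d) c) b
    rw [Matrix.transpose_apply, Matrix.neg_apply] at this
    rw [Matrix.smul_apply, Matrix.smul_apply, this, smul_neg]
  ext b c
  rw [connMat, Matrix.of_apply, connection]
  simp only [structureFun_transition hdet hx hx']
  linarith [hanti a b c, hanti b c a, hanti c a b]

end MovingCoframe
end FrameChange

/-! ### The Riemann tensor under a change of coframe -/

section FrameChange

variable {n : ℕ} {M : Type*} [TopologicalSpace M]
  [ChartedSpace (EuclideanSpace ℝ (Fin n)) M] [IsManifold (𝓡 n) ∞ M]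
  {g : PseudoRiemannianMetric n M} {η : Matrix (Fin n) (Fin n) ℝ}

namespace MovingCoframe

variable (θ θ' : MovingCoframe g η) {x : M}

theorem matDeriv_sum_smul {f : Fin n → M → ℝ} {B : Fin n → M → Matrix (Fin n) (Fin n) ℝ}
    (hf : ∀ c, ContMDiffAt (𝓡 n) 𝓘(ℝ, ℝ) ∞ (f c) x) (hB : ∀ c, MatSmoothAt (B c) x) (a : Fin n) :
    θ.matDeriv a (fun y ↦ ∑ c, f c y • B c y) x
      = ∑ c, (θ.frameDeriv a (f c) x • B c x + f c x • θ.matDeriv a (B c) x) := by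
  ext i j
  rw [Matrix.sum_apply]
  have h : (fun y ↦ (∑ c, f c y • B c y) i j) = fun y ↦ ∑ c, f c y * B c y i j := by
    funext y
    rw [Matrix.sum_apply]
    rfl
  simp only [matDeriv, Matrix.of_apply, h]
  refine (θ.frameDeriv_sum _ (f := fun c y ↦ f c y * B c y i j)
    (fun c _ ↦ (hf c).mul (hB c i j)) a).trans ?_
  refine Finset.sum_congr rfl fun c _ ↦ ?_
  rw [θ.frameDeriv_mul (hf c) (hB c i j), add_comm]
  rfl

theorem matDeriv_comm (hdet : IsUnit η.det) (hx : x ∈ θ.domain)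
    {A : M → Matrix (Fin n) (Fin n) ℝ} (hA : ∀ᶠ y in 𝓝 x, MatSmoothAt A y) (a b : Fin n) :
    θ.matDeriv a (θ.matDeriv b A) x - θ.matDeriv b (θ.matDeriv a A) x
      = ∑ m, θ.structureCoeff a b m x • θ.matDeriv m A x := by
  ext i j
  rw [Matrix.sum_apply]
  exact θ.frameDeriv_comm_eq_sum hdet hx a b (hA.mono fun y hy ↦ hy i j)

variable {θ θ'}

theorem eventually_matSmoothAt_transition (hx : x ∈ θ.domain) (hx' : x ∈ θ'.domain) :
    ∀ᶠ y in 𝓝 x, MatSmoothAt (θ.transition θ') y := by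
  filter_upwards [θ.isOpen_domain.mem_nhds hx, θ'.isOpen_domain.mem_nhds hx'] with y hy hy'
  exact matSmoothAt_transition hy hy'

theorem matSmoothAt_gaugeConn (hx : x ∈ θ.domain) (hx' : x ∈ θ'.domain) (a : Fin n) :
    MatSmoothAt (θ.gaugeConn θ' a) x :=
  have hX := matSmoothAt_transition hx hx'
  ((hX.transpose.mul (θ.matSmoothAt_connMat hx a)).mul hX).add
    (((θ.matSmoothAt_matDeriv hx hX a).transpose.mul (matSmoothAt_const η)).mul hX)

theorem matDeriv_gaugeConn (hx : x ∈ θ.domain) (hx' : x ∈ θ'.domain) (a b : Fin n) :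
    θ.matDeriv a (θ.gaugeConn θ' b) x
      = (θ.matDeriv a (θ.transition θ') x)ᵀ * θ.connMat b x * θ.transition θ' x
        + (θ.transition θ' x)ᵀ * θ.matDeriv a (θ.connMat b) x * θ.transition θ' x
        + (θ.transition θ' x)ᵀ * θ.connMat b x * θ.matDeriv a (θ.transition θ') x
        + (θ.matDeriv a (θ.matDeriv b (θ.transition θ')) x)ᵀ * η * θ.transition θ' x
        + (θ.matDeriv b (θ.transition θ') x)ᵀ * η * θ.matDeriv a (θ.transition θ') x := by
  have hX := matSmoothAt_transition hx hx'
  have hG := θ.matSmoothAt_connMat hx b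
  have hdX := θ.matSmoothAt_matDeriv hx hX b
  have h1 : θ.gaugeConn θ' b = fun y ↦ (θ.transition θ' y)ᵀ * θ.connMat b y * θ.transition θ' y
    + (θ.matDeriv b (θ.transition θ') y)ᵀ * η * θ.transition θ' y := rfl
  rw [h1, θ.matDeriv_add ((hX.transpose.mul hG).mul hX)
      ((hdX.transpose.mul (matSmoothAt_const η)).mul hX),
    θ.matDeriv_mul (hX.transpose.mul hG) hX, θ.matDeriv_mul hX.transpose hG,
    θ.matDeriv_mul (hdX.transpose.mul (matSmoothAt_const η)) hX,
    θ.matDeriv_mul hdX.transpose (matSmoothAt_const η), θ.matDeriv_const, θ.matDeriv_transpose,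
    θ.matDeriv_transpose]
  noncomm_ring

/-- The curvature of the gauge transformed connection. -/
theorem gaugeConn_curvature (hdet : IsUnit η.det) (hx : x ∈ θ.domain) (hx' : x ∈ θ'.domain)
    (a b : Fin n) :
    θ.matDeriv a (θ.gaugeConn θ' b) x - θ.matDeriv b (θ.gaugeConn θ' a) x
      + (θ.gaugeConn θ' b x * η⁻¹ * θ.gaugeConn θ' a x
        - θ.gaugeConn θ' a x * η⁻¹ * θ.gaugeConn θ' b x
        - ∑ m, θ.structureCoeff a b m x • θ.gaugeConn θ' m x)
      = (θ.transition θ' x)ᵀ * θ.riemMat a b x * θ.transition θ' x := by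
  have h1 := transition_mul_inv_mul hdet hx hx'
  have h2 := Matrix.mul_nonsing_inv _ hdet
  have h3 := Matrix.nonsing_inv_mul _ hdet
  have h4 := fun c ↦ matDeriv_transition_orth hdet hx hx' c
  -- The second derivatives of the transition matrix do not commute; their commutator is exactly
  -- what cancels the inhomogeneous part of the structure-function term.
  have h5 := congrArg (fun A ↦ Aᵀ * η * θ.transition θ' x)
    (θ.matDeriv_comm hdet hx (eventually_matSmoothAt_transition hx hx') a b)
  simp only [Matrix.transpose_sub, Matrix.transpose_sum, Matrix.transpose_smul, sub_mul,
    Finset.sum_mul, smul_mul_assoc] at h5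
  have h6 : ∀ c d, θ.gaugeConn θ' c x * η⁻¹ * θ.gaugeConn θ' d x = _ :=
    fun c d ↦ gauge_mul h1 h2 h3 (h4 d)
  have h7 : ∑ m, θ.structureCoeff a b m x • θ.gaugeConn θ' m x
      = (θ.transition θ' x)ᵀ * (∑ m, θ.structureCoeff a b m x • θ.connMat m x)
          * θ.transition θ' x
        + ∑ m, θ.structureCoeff a b m x •
          ((θ.matDeriv m (θ.transition θ') x)ᵀ * η * θ.transition θ' x) := by
    simp only [gaugeConn, smul_add, Finset.sum_add_distrib, Finset.mul_sum, Finset.sum_mul,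
      mul_smul_comm, smul_mul_assoc]
  rw [h6, h6, h7, ← h5, matDeriv_gaugeConn hx hx', matDeriv_gaugeConn hx hx', θ.riemMat_eq hx]
  generalize θ.transition θ' x = X, θ.matDeriv a (θ.transition θ') x = Xa,
    θ.matDeriv b (θ.transition θ') x = Xb
  generalize (θ.matDeriv a (θ.matDeriv b (θ.transition θ')) x)ᵀ * η * X = Xab,
    (θ.matDeriv b (θ.matDeriv a (θ.transition θ')) x)ᵀ * η * X = Xba,
    ∑ m, θ.structureCoeff a b m x • θ.connMat m x = Z, θ.matDeriv a (θ.connMat b) x = Gab,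
    θ.matDeriv b (θ.connMat a) x = Gba
  generalize θ.connMat b x * η⁻¹ * θ.connMat a x = P, θ.connMat a x * η⁻¹ * θ.connMat b x = Q
  simp only [mul_add, add_mul, mul_sub, sub_mul]
  abel

theorem structureCoeff_transition (hdet : IsUnit η.det) (hx : x ∈ θ.domain) (hx' : x ∈ θ'.domain)
    (a b e : Fin n) :
    ∑ m, θ'.structureCoeff a b m x * θ.transition θ' x e m
      = (∑ d, θ.transition θ' x d a * θ.matDeriv d (θ.transition θ') x e b)
          - (∑ d, θ.transition θ' x d b * θ.matDeriv d (θ.transition θ') x e a)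
          + ∑ c, ∑ d, θ.transition θ' x c a * θ.transition θ' x d b * θ.structureCoeff c d e x := by
  have h1 := mlieBracket_transition hdet hx hx' a b
  rw [θ'.mlieBracket_eq_sum hdet hx'] at h1
  simp only [frame_eq_sum_transition (θ' := θ') hdet hx, Finset.smul_sum, smul_smul] at h1
  rw [Finset.sum_comm] at h1
  simp only [← Finset.sum_smul] at h1
  have h2 := congrArg (θ.coord e x) h1
  rwa [θ.coord_sum_frame hdet hx, θ.coord_sum_frame hdet hx] at h2

theorem matDeriv_connMat_transition (hdet : IsUnit η.det) (hx : x ∈ θ.domain)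
    (hx' : x ∈ θ'.domain) (a b : Fin n) :
    θ'.matDeriv a (θ'.connMat b) x = ∑ d, ∑ c,
      ((θ.transition θ' x d a * θ.matDeriv d (θ.transition θ') x c b) • θ.gaugeConn θ' c x
        + (θ.transition θ' x d a * θ.transition θ' x c b) • θ.matDeriv d (θ.gaugeConn θ' c) x) := by
  have hX := matSmoothAt_transition hx hx'
  have h1 : θ'.connMat b =ᶠ[𝓝 x] fun y ↦ ∑ c, θ.transition θ' y c b • θ.gaugeConn θ' c y := by
    filter_upwards [θ.isOpen_domain.mem_nhds hx, θ'.isOpen_domain.mem_nhds hx'] with y hy hy'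
    exact connMat_transition hdet hy hy' b
  rw [θ'.matDeriv_congr h1]
  have h2 : ∀ A : M → Matrix (Fin n) (Fin n) ℝ, θ'.matDeriv a A x
      = ∑ d, θ.transition θ' x d a • θ.matDeriv d A x := by
    intro A
    ext i j
    rw [Matrix.sum_apply]
    exact frameDeriv_eq_sum_transition hdet hx a _
  rw [h2]
  refine Finset.sum_congr rfl fun d _ ↦ ?_
  rw [θ.matDeriv_sum_smul (fun c ↦ hX c b) (fun c ↦ matSmoothAt_gaugeConn hx hx' c),
    Finset.smul_sum]
  refine Finset.sum_congr rfl fun c _ ↦ ?_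
  rw [smul_add, smul_smul, smul_smul]
  rfl

/-- Differentiating the factors `X_cb` in the new connection produces terms without curvature
meaning. `structureCoeff_transition` shows that the structure functions of the new frame produce the
same ones, so they cancel, and `gaugeConn_curvature` evaluates the rest. -/
theorem riemMat_transition (hdet : IsUnit η.det) (hx : x ∈ θ.domain)
    (hx' : x ∈ θ'.domain) (a b : Fin n) :
    θ'.riemMat a b x = ∑ d, ∑ c, (θ.transition θ' x d a * θ.transition θ' x c b) •
      ((θ.transition θ' x)ᵀ * θ.riemMat d c x * θ.transition θ' x) := by
  have key := fun d c ↦ (gaugeConn_curvature hdet hx hx' d c).symm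
  rw [Finset.sum_congr rfl fun d _ ↦ Finset.sum_congr rfl fun c _ ↦ by rw [key d c]]
  rw [θ'.riemMat_eq hx', matDeriv_connMat_transition hdet hx hx',
    matDeriv_connMat_transition hdet hx hx']
  set X := θ.transition θ' x
  set B := fun c ↦ θ.gaugeConn θ' c x
  have hB : ∀ a, θ'.connMat a x = ∑ d, X d a • B d := fun a ↦ connMat_transition hdet hx hx' a
  have h1 : ∀ a b, θ'.connMat b x * η⁻¹ * θ'.connMat a x
      = ∑ d, ∑ c, (X d a * X c b) • (B c * η⁻¹ * B d) := by
    intro a b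
    simp only [hB, Finset.sum_mul, Finset.mul_sum, smul_mul_assoc, mul_smul_comm, Finset.smul_sum,
      smul_smul]
  have h2 : ∑ m, θ'.structureCoeff a b m x • θ'.connMat m x
      = ∑ d, ∑ c, ((X d a * θ.matDeriv d (θ.transition θ') x c b) • B c
        - (X d b * θ.matDeriv d (θ.transition θ') x c a) • B c)
        + ∑ d, ∑ c, (X d a * X c b) • ∑ m, θ.structureCoeff d c m x • B m := by
    simp only [hB, Finset.smul_sum, smul_smul]
    rw [Finset.sum_comm]
    simp only [← Finset.sum_smul]
    have h3 := structureCoeff_transition hdet hx hx' a b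
    simp only [X, h3, add_smul, sub_smul, Finset.sum_add_distrib, Finset.sum_sub_distrib]
    congr 1
    · congr 1 <;> rw [Finset.sum_comm] <;> simp only [Finset.sum_smul]
    · rw [Finset.sum_comm_cycle]
      simp only [Finset.sum_smul]
  rw [h1, h1, h2]
  have h4 : ∀ F : Fin n → Fin n → Matrix (Fin n) (Fin n) ℝ,
      ∑ d, ∑ c, (X d b * X c a) • F d c = ∑ d, ∑ c, (X d a * X c b) • F c d := by
    intro F
    rw [Finset.sum_comm]
    exact Finset.sum_congr rfl fun d _ ↦ Finset.sum_congr rfl fun c _ ↦ by rw [mul_comm]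
  simp only [smul_add, smul_sub, Finset.sum_add_distrib, Finset.sum_sub_distrib]
  rw [h4, h4]
  abel

end MovingCoframe
end FrameChange

/-- Exchanging the entry `j s` with the free index `m` is an involution on pairs `(j, m)`. It is
used to move a connection matrix from a tensor slot to the transition matrix. -/
theorem sum_sum_update {ι α : Type*} [Fintype ι] [DecidableEq ι] [Fintype α]
    (s : ι) (F : (ι → α) → α → ℝ) :
    ∑ j, ∑ m, F j m = ∑ j, ∑ m, F (Function.update j s m) (j s) := by
  classical
  let e : ((ι → α) × α) → ((ι → α) × α) := fun p ↦ (Function.update p.1 s p.2, p.1 s)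
  have he : Function.Involutive e := fun p ↦ by simp [e]
  rw [← Fintype.sum_prod_type', ← Fintype.sum_prod_type']
  exact (Equiv.sum_comp he.toPerm fun p : (ι → α) × α ↦ F p.1 p.2).symm

theorem sum_fin_succ_fun {k : ℕ} {α : Type*} [Fintype α] (F : (Fin (k + 1) → α) → ℝ) :
    ∑ j, F j = ∑ a, ∑ j : Fin k → α, F (Fin.cons a j) := by
  rw [← Fintype.sum_prod_type']
  exact (Equiv.sum_comp (Fin.consEquiv fun _ : Fin (k + 1) ↦ α) F).symm

theorem sum_fin_succ_fun_snoc {k : ℕ} {α : Type*} [Fintype α] (F : (Fin (k + 1) → α) → ℝ) :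
    ∑ j, F j = ∑ a, ∑ j : Fin k → α, F (Fin.snoc (α := fun _ ↦ α) j a) := by
  rw [← Fintype.sum_prod_type']
  exact (Equiv.sum_comp (Fin.snocEquiv fun _ : Fin (k + 1) ↦ α) F).symm

theorem sum_fin_four_fun {α : Type*} [Fintype α] (F : (Fin 4 → α) → ℝ) :
    ∑ j, F j = ∑ a, ∑ b, ∑ c, ∑ d, F ![a, b, c, d] := by
  simp only [sum_fin_succ_fun, Fintype.sum_unique]
  refine Finset.sum_congr rfl fun a _ ↦ Finset.sum_congr rfl fun b _ ↦ Finset.sum_congr rfl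
    fun c _ ↦ Finset.sum_congr rfl fun d _ ↦ congrArg F ?_
  ext i
  fin_cases i <;> rfl

/-! ### Covariant derivatives of curvature under a change of coframe -/

section FrameChange

variable {n : ℕ} {M : Type*} [TopologicalSpace M]
  [ChartedSpace (EuclideanSpace ℝ (Fin n)) M] [IsManifold (𝓡 n) ∞ M]
  {g : PseudoRiemannianMetric n M} {η : Matrix (Fin n) (Fin n) ℝ}

namespace MovingCoframe

variable (θ θ' : MovingCoframe g η) {x : M}

theorem covDeriv_eq (hx : x ∈ θ.domain) {k : ℕ} (T : (Fin k → Fin n) → M → ℝ)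
    (i : Fin (k + 1) → Fin n) :
    θ.covDeriv T i x = θ.frameDeriv (i (Fin.last k)) (T (Fin.init i)) x
      - ∑ s : Fin k, ∑ m, (θ.connMat (i (Fin.last k)) x * η⁻¹) (Fin.init i s) m
        * T (Function.update (Fin.init i) s m) x := by
  rw [covDeriv]
  congr 1
  refine Finset.sum_congr rfl fun s _ ↦ Finset.sum_congr rfl fun m _ ↦ ?_
  rw [Matrix.mul_apply, Finset.sum_mul]
  refine Finset.sum_congr rfl fun l _ ↦ ?_
  rw [(θ.isSymm_inv hx).apply m l, mul_comm (η⁻¹ m l)]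
  rfl

variable {θ θ'}

/-- Multiplying the gauge formula by `η⁻¹ Xᵀ` turns the middle factor into `X η⁻¹ Xᵀ = η⁻¹`, so the
inhomogeneous term becomes the bare derivative of `X`, the form in which it meets the Leibniz terms
of a tensor. -/
theorem connMat_transition_mul (hdet : IsUnit η.det) (hx : x ∈ θ.domain) (hx' : x ∈ θ'.domain)
    (f c e : Fin n) :
    ∑ m, (θ'.connMat f x * η⁻¹) c m * θ.transition θ' x e m
      = ∑ b, θ.transition θ' x b f * (∑ d, θ.transition θ' x d c * (θ.connMat b x * η⁻¹) d e
          + θ.matDeriv b (θ.transition θ') x e c) := by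
  have h1 := transition_mul_inv_mul hdet hx hx'
  have h2 : θ'.connMat f x * η⁻¹ * (θ.transition θ' x)ᵀ
      = ∑ b, θ.transition θ' x b f • ((θ.transition θ' x)ᵀ * (θ.connMat b x * η⁻¹)
          + (θ.matDeriv b (θ.transition θ') x)ᵀ) := by
    rw [connMat_transition hdet hx hx', Finset.sum_mul, Finset.sum_mul]
    refine Finset.sum_congr rfl fun b _ ↦ ?_
    rw [smul_mul_assoc, smul_mul_assoc]
    congr 1
    calc θ.gaugeConn θ' b x * η⁻¹ * (θ.transition θ' x)ᵀ
        = ((θ.transition θ' x)ᵀ * θ.connMat b x + (θ.matDeriv b (θ.transition θ') x)ᵀ * η)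
          * (θ.transition θ' x * η⁻¹ * (θ.transition θ' x)ᵀ) := by
            rw [gaugeConn]; noncomm_ring
      _ = _ := by
        rw [h1, add_mul, mul_assoc (_)ᵀ η, Matrix.mul_nonsing_inv _ hdet, mul_one, mul_assoc]
  have h3 := congrFun (congrFun h2 c) e
  rw [Matrix.mul_apply, Matrix.sum_apply] at h3
  refine h3.trans (Finset.sum_congr rfl fun b _ ↦ ?_)
  rw [Matrix.smul_apply, Matrix.add_apply, Matrix.mul_apply]
  rfl

/-- Differentiating `∏ X` gives, for each slot, a term with one factor of `X` differentiated. The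
inhomogeneous part of the new connection gives the same term in the same slot, and the covariant
derivative subtracts it. -/
theorem covDeriv_transition (hdet : IsUnit η.det) (hx : x ∈ θ.domain) (hx' : x ∈ θ'.domain)
    {k : ℕ} {T T' : (Fin k → Fin n) → M → ℝ}
    (hT : ∀ j, ContMDiffAt (𝓡 n) 𝓘(ℝ, ℝ) ∞ (T j) x)
    (hT' : ∀ᶠ y in 𝓝 x, ∀ i, T' i y = ∑ j, (∏ s, θ.transition θ' y (j s) (i s)) * T j y)
    (i : Fin (k + 1) → Fin n) :
    θ'.covDeriv T' i x = ∑ j, (∏ s, θ.transition θ' x (j s) (i s)) * θ.covDeriv T j x := by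
  have hX := matSmoothAt_transition hx hx'
  set f := i (Fin.last k) with hf
  set i₀ : Fin k → Fin n := Fin.init i with hi₀
  have hD : ∀ b, θ.frameDeriv b (T' i₀) x
      = ∑ j, ((∏ s, θ.transition θ' x (j s) (i₀ s)) * θ.frameDeriv b (T j) x
        + ∑ s, θ.matDeriv b (θ.transition θ') x (j s) (i₀ s)
          * (∏ r ∈ Finset.univ.erase s, θ.transition θ' x (j r) (i₀ r)) * T j x) := by
    intro b
    rw [θ.frameDeriv_congr (hT'.mono fun y hy ↦ hy i₀)]
    have hprod : ∀ j : Fin k → Fin n, ContMDiffAt (𝓡 n) 𝓘(ℝ, ℝ) ∞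
        (fun y ↦ ∏ s, θ.transition θ' y (j s) (i₀ s)) x := fun j ↦
      contMDiffAt_finsetProd fun s _ ↦ hX _ _
    refine (θ.frameDeriv_sum _ (f := fun j y ↦ (∏ s, θ.transition θ' y (j s) (i₀ s)) * T j y)
      (fun j _ ↦ (hprod j).mul (hT j)) b).trans ?_
    refine Finset.sum_congr rfl fun j _ ↦ ?_
    rw [θ.frameDeriv_mul (hprod j) (hT j)]
    congr 1
    rw [← Finset.sum_mul]
    congr 1
    exact θ.frameDeriv_prod _ (f := fun s y ↦ θ.transition θ' y (j s) (i₀ s))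
      (fun s _ ↦ hX _ _) b
  have hΓ : ∀ s, ∑ m, (θ'.connMat f x * η⁻¹) (i₀ s) m * T' (Function.update i₀ s m) x
      = ∑ b, θ.transition θ' x b f * ∑ j,
        ((∏ r, θ.transition θ' x (j r) (i₀ r))
            * ∑ m, (θ.connMat b x * η⁻¹) (j s) m * T (Function.update j s m) x
        + θ.matDeriv b (θ.transition θ') x (j s) (i₀ s)
          * (∏ r ∈ Finset.univ.erase s, θ.transition θ' x (j r) (i₀ r)) * T j x) := by
    intro s
    have h1 : ∀ (m : Fin n) (j : Fin k → Fin n),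
        ∏ r, θ.transition θ' x (j r) (Function.update i₀ s m r)
          = θ.transition θ' x (j s) m
            * ∏ r ∈ Finset.univ.erase s, θ.transition θ' x (j r) (i₀ r) := by
      intro m j
      rw [← Finset.mul_prod_erase _ _ (Finset.mem_univ s), Function.update_self]
      congr 1
      refine Finset.prod_congr rfl fun r hr ↦ ?_
      rw [Function.update_of_ne (Finset.ne_of_mem_erase hr)]
    have h2 : ∀ b, ∑ j : Fin k → Fin n, (∏ r, θ.transition θ' x (j r) (i₀ r))
            * ∑ m, (θ.connMat b x * η⁻¹) (j s) m * T (Function.update j s m) x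
        = ∑ j : Fin k → Fin n, (∏ r ∈ Finset.univ.erase s, θ.transition θ' x (j r) (i₀ r))
          * (∑ d, θ.transition θ' x d (i₀ s) * (θ.connMat b x * η⁻¹) d (j s)) * T j x := by
      intro b
      simp only [Finset.mul_sum, Finset.sum_mul]
      -- Relabelling moves the connection matrix off the index of `T` and onto the factor of `X` in
      -- slot `s`.
      rw [sum_sum_update s]
      refine Finset.sum_congr rfl fun j _ ↦ Finset.sum_congr rfl fun m _ ↦ ?_
      rw [← Finset.mul_prod_erase _ _ (Finset.mem_univ s)]
      simp only [Function.update_self, Function.update_idem, Function.update_eq_self]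
      rw [Finset.prod_congr rfl fun r hr ↦ by
        rw [Function.update_of_ne (Finset.ne_of_mem_erase hr)]]
      ring
    simp only [hT'.self_of_nhds, h1]
    refine (Finset.sum_congr rfl fun m _ ↦ Finset.mul_sum _ _ _).trans ?_
    rw [Finset.sum_comm]
    refine Eq.trans ?_ (Finset.sum_congr rfl fun b _ ↦ by
      rw [Finset.sum_add_distrib, h2, ← Finset.sum_add_distrib, Finset.mul_sum])
    conv_rhs => rw [Finset.sum_comm]
    refine Finset.sum_congr rfl fun j _ ↦ ?_
    have h3 := congrArg (fun z ↦ z * ((∏ r ∈ Finset.univ.erase s, θ.transition θ' x (j r) (i₀ r))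
      * T j x)) (connMat_transition_mul hdet hx hx' f (i₀ s) (j s))
    simp only [Finset.sum_mul] at h3
    refine (Finset.sum_congr rfl fun m _ ↦ by ring).trans (h3.trans
      (Finset.sum_congr rfl fun b _ ↦ by ring))
  rw [θ'.covDeriv_eq hx', ← hf, ← hi₀, frameDeriv_eq_sum_transition hdet hx]
  simp only [hD, hΓ]
  rw [Finset.sum_comm, ← Finset.sum_sub_distrib, sum_fin_succ_fun_snoc]
  refine Finset.sum_congr rfl fun b _ ↦ ?_
  rw [← Finset.mul_sum, ← mul_sub, Finset.sum_comm, ← Finset.sum_sub_distrib, Finset.mul_sum]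
  refine Finset.sum_congr rfl fun j _ ↦ ?_
  rw [θ.covDeriv_eq hx, Fin.prod_univ_castSucc]
  simp only [Fin.snoc_last, Fin.snoc_castSucc, Fin.init_snoc, Finset.sum_add_distrib,
    ← Finset.mul_sum]
  -- Here the terms with a derivative of the transition matrix cancel.
  rw [← hf, add_sub_add_right_eq_sub, ← mul_sub]
  have : ∀ s, i₀ s = i s.castSucc := fun _ ↦ rfl
  simp only [this]
  ring

theorem nablaRiemann_transition (hdet : IsUnit η.det) (k : ℕ) :
    ∀ {x : M}, x ∈ θ.domain → x ∈ θ'.domain → ∀ i, θ'.nablaRiemann k i x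
      = ∑ j, (∏ s, θ.transition θ' x (j s) (i s)) * θ.nablaRiemann k j x := by
  induction k with
  | zero =>
    intro x hx hx' i
    have h1 := congrFun (congrFun (riemMat_transition hdet hx hx' (i 0) (i 1)) (i 2)) (i 3)
    refine h1.trans ?_
    refine Eq.trans ?_ (sum_fin_four_fun _).symm
    rw [Matrix.sum_apply]
    refine Finset.sum_congr rfl fun a _ ↦ ?_
    rw [Matrix.sum_apply]
    refine Finset.sum_congr rfl fun b _ ↦ ?_
    rw [Matrix.smul_apply, mul_assoc, Matrix.mul_apply, smul_eq_mul, Finset.mul_sum]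
    refine Finset.sum_congr rfl fun c _ ↦ ?_
    rw [Matrix.mul_apply, Finset.mul_sum, Finset.mul_sum]
    refine Finset.sum_congr rfl fun d _ ↦ ?_
    have h2 : ∏ s : Fin (4 + 0), θ.transition θ' x (![a, b, c, d] s) (i s)
        = θ.transition θ' x a (i 0) * θ.transition θ' x b (i 1) * θ.transition θ' x c (i 2)
          * θ.transition θ' x d (i 3) := Fin.prod_univ_four _
    rw [h2]
    simp only [riemMat, Matrix.of_apply, Matrix.transpose_apply]
    change _ = _ * θ.riemann a b c d x
    ring
  | succ k ih =>
    intro x hx hx' i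
    refine covDeriv_transition hdet hx hx' (fun j ↦ θ.contMDiffAt_nablaRiemann hx k j) ?_ i
    filter_upwards [θ.isOpen_domain.mem_nhds hx, θ'.isOpen_domain.mem_nhds hx'] with y hy hy' j
    exact ih hy hy' j

/-- The curvature components transform as a tensor. -/
theorem curvature_transition (hdet : IsUnit η.det) (hx : x ∈ θ.domain) (hx' : x ∈ θ'.domain)
    (p : ℕ) : θ'.curvature p x = pullTensor (θ.transition θ' x) (θ.curvature p x) := by
  funext k i
  exact nablaRiemann_transition hdet k hx hx' i

end MovingCoframe
end FrameChange

/-! ### The action of matrices on curvature space, and its derivative -/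

section PullTensor

variable {n p : ℕ}

theorem contDiff_pullTensor :
    ContDiff ℝ ∞ fun z : (Fin n → Fin n → ℝ) × CurvSpace n p ↦ pullTensor z.1 z.2 := by
  refine contDiff_pi.2 fun k ↦ contDiff_pi.2 fun i ↦ ?_
  refine ContDiff.sum fun j _ ↦ ContDiff.mul ?_ ?_
  · refine contDiff_prod fun s _ ↦ ?_
    exact ((contDiff_apply_apply ℝ ℝ (j s) (i s)).comp contDiff_fst)
  · exact contDiff_pi.1 (contDiff_pi.1 contDiff_snd k) j

theorem pullTensor_mul (X Y : Matrix (Fin n) (Fin n) ℝ) (T : CurvSpace n p) :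
    pullTensor (X * Y : Matrix (Fin n) (Fin n) ℝ) T = pullTensor Y (pullTensor X T) := by
  funext k i
  simp only [pullTensor, Matrix.mul_apply, Finset.mul_sum]
  rw [Finset.sum_comm]
  refine Finset.sum_congr rfl fun j _ ↦ ?_
  rw [Finset.prod_univ_sum, Finset.sum_mul, Fintype.piFinset_univ]
  refine Finset.sum_congr rfl fun m _ ↦ ?_
  rw [Finset.prod_mul_distrib]
  ring

theorem pullTensor_one (T : CurvSpace n p) :
    pullTensor (1 : Matrix (Fin n) (Fin n) ℝ) T = T := by
  funext k i
  change ∑ j, (∏ s, (1 : Matrix (Fin n) (Fin n) ℝ) (j s) (i s)) * T k j = T k i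
  rw [Finset.sum_eq_single i]
  · simp
  · intro j _ hj
    obtain ⟨s, hs⟩ := Function.ne_iff.1 hj
    have h : ∏ s, (1 : Matrix (Fin n) (Fin n) ℝ) (j s) (i s) = 0 :=
      Finset.prod_eq_zero (Finset.mem_univ s) (Matrix.one_apply_ne hs)
    rw [h, zero_mul]
  · simp

/-- Pull-back by a fixed matrix as a linear map. -/
def pullLin (X : Fin n → Fin n → ℝ) : CurvSpace n p →L[ℝ] CurvSpace n p :=
  LinearMap.toContinuousLinearMap
    { toFun := pullTensor X
      map_add' := fun S T ↦ by
        funext k i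
        simp [pullTensor, mul_add, Finset.sum_add_distrib]
      map_smul' := fun c T ↦ by
        funext k i
        simp only [pullTensor, Pi.smul_apply, smul_eq_mul, Finset.mul_sum, RingHom.id_apply]
        exact Finset.sum_congr rfl fun j _ ↦ by ring }

theorem differentiable_pullTensor (T : CurvSpace n p) :
    Differentiable ℝ fun X : Fin n → Fin n → ℝ ↦ pullTensor X T :=
  (contDiff_pullTensor.comp (contDiff_id.prodMk contDiff_const)).differentiable (by simp)

/-- The infinitesimal action of matrices on tensors. -/
def infAct (T : CurvSpace n p) : (Fin n → Fin n → ℝ) →L[ℝ] CurvSpace n p :=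
  fderiv ℝ (fun X ↦ pullTensor X T) (1 : Matrix (Fin n) (Fin n) ℝ)

/-- Multiplication by matrices on the left and on the right, as a continuous linear map. -/
def mulLin (X Y : Matrix (Fin n) (Fin n) ℝ) :
    (Fin n → Fin n → ℝ) →L[ℝ] (Fin n → Fin n → ℝ) :=
  LinearMap.toContinuousLinearMap
    { toFun := fun A ↦ (X * Matrix.of A * Y : Matrix (Fin n) (Fin n) ℝ)
      map_add' := fun A B ↦ by
        have : Matrix.of (A + B) = Matrix.of A + Matrix.of B := rfl
        rw [this, mul_add, add_mul]
        rfl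
      map_smul' := fun c A ↦ by
        have : Matrix.of (c • A) = c • Matrix.of A := rfl
        rw [this, mul_smul_comm, smul_mul_assoc]
        rfl }

theorem mulLin_apply (X Y A : Matrix (Fin n) (Fin n) ℝ) : mulLin X Y A = X * A * Y := rfl

/-- Pull-back reverses products, so a factor `X` on the right of `Y` acts after `Y`; differentiate
`pullTensor (Y * X) T` in `Y` at the identity. -/
theorem fderiv_pullTensor_mul_left (X A : Matrix (Fin n) (Fin n) ℝ) (T : CurvSpace n p) :
    fderiv ℝ (fun X ↦ pullTensor X T) X (A * X : Matrix (Fin n) (Fin n) ℝ)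
      = pullTensor X (infAct T A) := by
  have h1 : HasFDerivAt (fun Y ↦ pullTensor (mulLin 1 X Y) T)
      ((fderiv ℝ (fun X ↦ pullTensor X T) X).comp (mulLin 1 X)) (1 : Matrix (Fin n) (Fin n) ℝ) := by
    refine HasFDerivAt.comp _ (g := fun X ↦ pullTensor X T) ?_ (mulLin 1 X).hasFDerivAt
    rw [mulLin_apply, one_mul, one_mul]
    exact (differentiable_pullTensor T X).hasFDerivAt
  have h2 : HasFDerivAt (fun Y ↦ pullLin X (pullTensor Y T)) ((pullLin X).comp (infAct T))
      (1 : Matrix (Fin n) (Fin n) ℝ) :=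
    (pullLin X).hasFDerivAt.comp _ (differentiable_pullTensor T _).hasFDerivAt
  have h3 : (fun Y : Fin n → Fin n → ℝ ↦ pullTensor (mulLin 1 X Y) T)
      = fun Y ↦ pullLin X (pullTensor Y T) := by
    funext Y
    refine Eq.trans ?_ (pullTensor_mul (Matrix.of Y) X T)
    exact congrArg (fun Z ↦ pullTensor (Z * X) T) (one_mul (Matrix.of Y))
  rw [h3] at h1
  have h4 : (fderiv ℝ (fun X ↦ pullTensor X T) X) (mulLin 1 X A) = pullTensor X (infAct T A) :=
    congrArg (fun L ↦ L A) (h1.unique h2)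
  have h5 : mulLin 1 X A = A * X := by rw [mulLin_apply, one_mul]
  exact (congrArg (fderiv ℝ (fun X ↦ pullTensor X T) X) h5).symm.trans h4

/-- As before with the variable factor on the other side: now the infinitesimal action is applied to
the already transformed tensor. -/
theorem fderiv_pullTensor_mul_right (X A : Matrix (Fin n) (Fin n) ℝ) (T : CurvSpace n p) :
    fderiv ℝ (fun X ↦ pullTensor X T) X (X * A : Matrix (Fin n) (Fin n) ℝ)
      = infAct (pullTensor X T) A := by
  have h1 : HasFDerivAt (fun Y ↦ pullTensor (mulLin X 1 Y) T)
      ((fderiv ℝ (fun X ↦ pullTensor X T) X).comp (mulLin X 1)) (1 : Matrix (Fin n) (Fin n) ℝ) := by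
    refine HasFDerivAt.comp _ (g := fun X ↦ pullTensor X T) ?_ (mulLin X 1).hasFDerivAt
    rw [mulLin_apply, mul_one, mul_one]
    exact (differentiable_pullTensor T X).hasFDerivAt
  have h3 : (fun Y : Fin n → Fin n → ℝ ↦ pullTensor (mulLin X 1 Y) T)
      = fun Y ↦ pullTensor Y (pullTensor X T) := by
    funext Y
    refine Eq.trans ?_ (pullTensor_mul X (Matrix.of Y) T)
    exact congrArg (fun Z ↦ pullTensor Z T) (mul_one (X * Matrix.of Y))
  rw [h3] at h1
  have h4 : (fderiv ℝ (fun X ↦ pullTensor X T) X) (mulLin X 1 A) = infAct (pullTensor X T) A :=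
    congrArg (fun L ↦ L A) h1.fderiv.symm
  have h5 : mulLin X 1 A = X * A := by rw [mulLin_apply, mul_one]
  exact (congrArg (fderiv ℝ (fun X ↦ pullTensor X T) X) h5).symm.trans h4

/-- The one-parameter group `t ↦ exp (t ξ)`. -/
def oneParam (ξ : Matrix (Fin n) (Fin n) ℝ) (t : ℝ) : Matrix (Fin n) (Fin n) ℝ :=
  NormedSpace.exp (t • ξ)

theorem oneParam_zero (ξ : Matrix (Fin n) (Fin n) ℝ) : oneParam ξ 0 = 1 := by
  rw [oneParam, zero_smul, NormedSpace.exp_zero]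

theorem oneParam_comm (ξ : Matrix (Fin n) (Fin n) ℝ) (t : ℝ) :
    oneParam ξ t * ξ = ξ * oneParam ξ t :=
  (Commute.exp_left ((Commute.refl ξ).smul_left t)).eq

theorem oneParam_neg (ξ : Matrix (Fin n) (Fin n) ℝ) (t : ℝ) :
    oneParam ξ t * oneParam ξ (-t) = 1 := by
  rw [oneParam, oneParam, ← Matrix.exp_add_of_commute _ _
    (((Commute.refl ξ).smul_left t).smul_right (-t)), ← add_smul, add_neg_cancel, zero_smul,
    NormedSpace.exp_zero]

theorem hasDerivAt_oneParam_apply (ξ : Matrix (Fin n) (Fin n) ℝ) (t : ℝ) (i j : Fin n) :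
    HasDerivAt (fun t : ℝ ↦ oneParam ξ t i j) ((oneParam ξ t * ξ) i j) t := by
  -- A norm is needed only to differentiate the exponential; the conclusion is entrywise and does
  -- not mention it.
  let _ : NormedRing (Matrix (Fin n) (Fin n) ℝ) := Matrix.linftyOpNormedRing
  let _ : NormedAlgebra ℝ (Matrix (Fin n) (Fin n) ℝ) := Matrix.linftyOpNormedAlgebra
  have h1 : HasDerivAt (oneParam ξ) (oneParam ξ t * ξ) t := hasDerivAt_exp_smul_const ξ t
  have h2 := (LinearMap.toContinuousLinearMap
    (Matrix.entryLinearMap ℝ ℝ i j)).hasFDerivAt.comp_hasDerivAt t h1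
  exact h2

theorem hasDerivAt_oneParam (ξ : Matrix (Fin n) (Fin n) ℝ) (t : ℝ) :
    HasDerivAt (F := Fin n → Fin n → ℝ) (fun t : ℝ ↦ oneParam ξ t) (oneParam ξ t * ξ) t :=
  hasDerivAt_pi.2 fun i ↦ hasDerivAt_pi.2 fun j ↦ hasDerivAt_oneParam_apply ξ t i j

theorem hasDerivAt_pullTensor_oneParam (T : CurvSpace n p) (ξ : Matrix (Fin n) (Fin n) ℝ) (t : ℝ) :
    HasDerivAt (fun t : ℝ ↦ pullTensor (oneParam ξ t) T)
      (pullTensor (oneParam ξ t) (infAct T ξ)) t := by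
  have h0 : HasFDerivAt (fun X ↦ pullTensor X T)
      (fderiv ℝ (fun X ↦ pullTensor X T) (oneParam ξ t)) (oneParam ξ t) :=
    (differentiable_pullTensor T (oneParam ξ t)).hasFDerivAt
  have h1 := h0.comp_hasDerivAt t (hasDerivAt_oneParam ξ t)
  rw [oneParam_comm] at h1
  have h2 := fderiv_pullTensor_mul_left (oneParam ξ t) ξ T
  exact h2 ▸ h1

end PullTensor

/-! ### Stabilizers, their Lie algebras, and the Lie algebra of `O(1,2)` -/

section Stabilizer

variable {n p : ℕ}

/-- The infinitesimal stabilizer of a tensor in the Lie algebra of `O(η)`. -/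
def stabAlg (η : Matrix (Fin n) (Fin n) ℝ) (T : CurvSpace n p) : Submodule ℝ (Fin n → Fin n → ℝ) :=
  orthTangent η 1 ⊓ LinearMap.ker (infAct T).toLinearMap

theorem mem_orthTangent_one {η ξ : Matrix (Fin n) (Fin n) ℝ} :
    (ξ : Fin n → Fin n → ℝ) ∈ orthTangent η 1 ↔ ξᵀ * η + η * ξ = 0 := by
  have h : (ξ : Fin n → Fin n → ℝ) ∈ orthTangent η 1 ↔ ξᵀ * η * 1 + 1ᵀ * η * ξ = 0 := Iff.rfl
  rw [h, mul_one, Matrix.transpose_one, one_mul]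

theorem hasDerivAt_oneParam_orth (η ξ : Matrix (Fin n) (Fin n) ℝ) (i j : Fin n) (t : ℝ) :
    HasDerivAt (fun t ↦ ((oneParam ξ t)ᵀ * η * oneParam ξ t) i j)
      (((oneParam ξ t)ᵀ * (ξᵀ * η + η * ξ) * oneParam ξ t) i j) t := by
  have h1 : (oneParam ξ t)ᵀ * (ξᵀ * η + η * ξ) * oneParam ξ t
      = (oneParam ξ t * ξ)ᵀ * η * oneParam ξ t + (oneParam ξ t)ᵀ * η * (oneParam ξ t * ξ) := by
    rw [oneParam_comm, Matrix.transpose_mul]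
    noncomm_ring
  rw [h1]
  simp only [Matrix.add_apply, Matrix.mul_apply (N := oneParam ξ _),
    Matrix.mul_apply (N := oneParam ξ t * ξ), Matrix.mul_apply (N := η), Matrix.transpose_apply]
  rw [← Finset.sum_add_distrib]
  refine HasDerivAt.fun_sum fun m _ ↦ HasDerivAt.mul ?_ (hasDerivAt_oneParam_apply ξ t m j)
  exact HasDerivAt.fun_sum fun l _ ↦ (hasDerivAt_oneParam_apply ξ t l i).mul_const _

/-- One inclusion differentiates the two stabilizer conditions at `t = 0`. For the other, the
derivatives of both conditions along the one-parameter group are transforms of zero, so the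
conditions persist from `t = 0`. The set in `groupDim` is thus already a linear space and the span
adds nothing. -/
theorem groupDim_eq_finrank_stabAlg {η : Matrix (Fin n) (Fin n) ℝ} {G : Subgroup (GL (Fin n) ℝ)}
    {T : CurvSpace n p}
    (hG : ∀ X : GL (Fin n) ℝ, X ∈ G ↔
      X ∈ orthGroup η ∧ pullTensor (X : Matrix (Fin n) (Fin n) ℝ) T = T) :
    groupDim G = Module.finrank ℝ (stabAlg η T) := by
  have hset : {ξ : Matrix (Fin n) (Fin n) ℝ |
      ∀ t : ℝ, ∃ X ∈ G, (X : Matrix (Fin n) (Fin n) ℝ) = NormedSpace.exp (t • ξ)}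
      = ((stabAlg η T).map (Matrix.ofLinearEquiv ℝ).toLinearMap : Set _) := by
    ext ξ
    rw [Submodule.map_coe]
    constructor
    · intro h
      have horth : ∀ t, (oneParam ξ t)ᵀ * η * oneParam ξ t = η := by
        intro t
        obtain ⟨X, hX, hXe⟩ := h t
        have h1 : (X : Matrix (Fin n) (Fin n) ℝ)ᵀ * η * (X : Matrix (Fin n) (Fin n) ℝ) = η :=
          ((hG X).1 hX).1
        rwa [hXe] at h1
      have hfix : ∀ t, pullTensor (oneParam ξ t) T = T := by
        intro t
        obtain ⟨X, hX, hXe⟩ := h t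
        have h1 := ((hG X).1 hX).2
        rwa [hXe] at h1
      refine ⟨ξ, ⟨mem_orthTangent_one.2 ?_, ?_⟩, rfl⟩
      · ext i j
        have h1 := hasDerivAt_oneParam_orth η ξ i j 0
        simp only [horth, oneParam_zero, Matrix.transpose_one, one_mul, mul_one] at h1
        exact h1.unique (hasDerivAt_const 0 _)
      · have h1 := hasDerivAt_pullTensor_oneParam T ξ 0
        simp only [hfix, oneParam_zero] at h1
        rw [pullTensor_one] at h1
        exact h1.unique (hasDerivAt_const 0 _)
    · rintro ⟨ξ, ⟨h1, h2⟩, rfl⟩ t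
      change infAct T ξ = 0 at h2
      set ξ' : Matrix (Fin n) (Fin n) ℝ := Matrix.of ξ
      have h1' : ξ'ᵀ * η + η * ξ' = 0 := mem_orthTangent_one.1 h1
      have horth : (oneParam ξ' t)ᵀ * η * oneParam ξ' t = η := by
        ext i j
        have h3 : ∀ t, HasDerivAt (fun t ↦ ((oneParam ξ' t)ᵀ * η * oneParam ξ' t) i j) 0 t := by
          intro t
          have := hasDerivAt_oneParam_orth η ξ' i j t
          rwa [h1', mul_zero, zero_mul] at this
        have h4 := is_const_of_deriv_eq_zero (fun t ↦ (h3 t).differentiableAt)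
          (fun t ↦ (h3 t).deriv) t 0
        simpa [oneParam_zero] using h4
      have hfix : pullTensor (oneParam ξ' t) T = T := by
        have h3 : ∀ t, HasDerivAt (fun t ↦ pullTensor (oneParam ξ' t) T) 0 t := by
          intro t
          have h4 := hasDerivAt_pullTensor_oneParam T ξ' t
          have h5 : pullTensor (oneParam ξ' t) (infAct T ξ') = 0 := by
            have h6 : infAct T ξ' = 0 := h2
            rw [h6]
            exact map_zero (pullLin (oneParam ξ' t))
          rwa [h5] at h4
        have h4 := is_const_of_deriv_eq_zero (fun t ↦ (h3 t).differentiableAt)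
          (fun t ↦ (h3 t).deriv) t 0
        rw [h4, oneParam_zero]
        exact pullTensor_one T
      let X : GL (Fin n) ℝ := ⟨oneParam ξ' t, oneParam ξ' (-t), oneParam_neg ξ' t, by
        simpa using oneParam_neg ξ' (-t)⟩
      exact ⟨X, (hG X).2 ⟨horth, hfix⟩, rfl⟩
  rw [groupDim, hset, Submodule.span_eq]
  exact LinearEquiv.finrank_map_eq (Matrix.ofLinearEquiv ℝ) (stabAlg η T)

/-- The infinitesimal stabilizers of a tensor and of its transform are conjugate. -/
theorem finrank_stabAlg_pullTensor_le {η X Y : Matrix (Fin n) (Fin n) ℝ} (hX : Xᵀ * η * X = η)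
    (hXY : X * Y = 1) (T : CurvSpace n p) :
    Module.finrank ℝ (stabAlg η (pullTensor X T)) ≤ Module.finrank ℝ (stabAlg η T) := by
  have hYX : Y * X = 1 := mul_eq_one_comm.1 hXY
  have hY : Yᵀ * η * Y = η := by
    calc Yᵀ * η * Y = Yᵀ * (Xᵀ * η * X) * Y := by rw [hX]
      _ = (X * Y)ᵀ * η * (X * Y) := by rw [Matrix.transpose_mul]; noncomm_ring
      _ = η := by rw [hXY]; simp
  have hη : η * Y = Xᵀ * η := by
    calc η * Y = Xᵀ * η * (X * Y) := by rw [← mul_assoc, hX]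
      _ = _ := by rw [hXY, mul_one]
  have hη' : η * X = Yᵀ * η := by
    calc η * X = Yᵀ * η * (Y * X) := by rw [← mul_assoc, hY]
      _ = _ := by rw [hYX, mul_one]
  let f : (Fin n → Fin n → ℝ) →ₗ[ℝ] (Fin n → Fin n → ℝ) := (mulLin X Y).toLinearMap
  have hmaps : ∀ ξ ∈ stabAlg η (pullTensor X T), f ξ ∈ stabAlg η T := by
    rintro ξ ⟨h1, h2⟩
    set ξ' : Matrix (Fin n) (Fin n) ℝ := Matrix.of ξ
    have h1' : ξ'ᵀ * η + η * ξ' = 0 := mem_orthTangent_one.1 h1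
    have hf : f ξ = (X * ξ' * Y : Matrix (Fin n) (Fin n) ℝ) := rfl
    rw [hf]
    refine ⟨mem_orthTangent_one.2 ?_, ?_⟩
    · calc (X * ξ' * Y)ᵀ * η + η * (X * ξ' * Y)
          = Yᵀ * ξ'ᵀ * (Xᵀ * η) + (η * X) * ξ' * Y := by
            rw [Matrix.transpose_mul, Matrix.transpose_mul]; noncomm_ring
        _ = Yᵀ * (ξ'ᵀ * η + η * ξ') * Y := by rw [← hη, hη']; noncomm_ring
        _ = 0 := by rw [h1', mul_zero, zero_mul]
    · have h3 := fderiv_pullTensor_mul_right X ξ' T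
      have h4 := fderiv_pullTensor_mul_left X (X * ξ' * Y) T
      have h5 : X * ξ' * Y * X = X * ξ' := by rw [mul_assoc, hYX, mul_one]
      rw [h5] at h4
      have h6 : infAct (pullTensor X T) ξ' = 0 := h2
      have h7 : pullTensor X (infAct T (X * ξ' * Y : Matrix (Fin n) (Fin n) ℝ)) = 0 :=
        h4.symm.trans (h3.trans h6)
      have h8 := congrArg (pullLin Y) h7
      rw [map_zero] at h8
      have h9 := pullTensor_mul X Y (infAct T (X * ξ' * Y : Matrix (Fin n) (Fin n) ℝ))
      rw [hXY] at h9
      exact ((pullTensor_one _).symm.trans h9).trans h8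
  have hinj : Function.Injective (f.restrict hmaps) := by
    intro ξ ζ h
    have h1 : X * Matrix.of ξ.1 * Y = X * Matrix.of ζ.1 * Y := congrArg Subtype.val h
    have h2 : Matrix.of ξ.1 = Matrix.of ζ.1 := by
      calc Matrix.of ξ.1 = (Y * X) * Matrix.of ξ.1 * (Y * X) := by rw [hYX, one_mul, mul_one]
        _ = Y * (X * Matrix.of ξ.1 * Y) * X := by noncomm_ring
        _ = (Y * X) * Matrix.of ζ.1 * (Y * X) := by rw [h1]; noncomm_ring
        _ = Matrix.of ζ.1 := by rw [hYX, one_mul, mul_one]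
    exact Subtype.ext h2
  exact LinearMap.finrank_le_finrank_of_injective hinj

/-- A parametrization of the Lie algebra of the Lorentz group `O(1, 2)`. -/
def lorentzAlg : (Fin 3 → ℝ) →ₗ[ℝ] (Fin 3 → Fin 3 → ℝ) where
  toFun w := ![![0, w 0, w 1], ![w 0, 0, w 2], ![w 1, -w 2, 0]]
  map_add' u w := by
    ext i j
    fin_cases i <;> fin_cases j <;> simp [add_comm]
  map_smul' c w := by
    ext i j
    fin_cases i <;> fin_cases j <;> simp

theorem lorentzAlg_injective : Function.Injective lorentzAlg := by
  intro u w h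
  have h1 := congrFun (congrFun h 0) 1
  have h2 := congrFun (congrFun h 0) 2
  have h3 := congrFun (congrFun h 1) 2
  ext i
  fin_cases i
  · simpa [lorentzAlg] using h1
  · simpa [lorentzAlg] using h2
  · simpa [lorentzAlg] using h3

theorem range_lorentzAlg : LinearMap.range lorentzAlg = orthTangent lorentz 1 := by
  ext A
  have hmem : A ∈ orthTangent lorentz 1 ↔ (Matrix.of A)ᵀ * lorentz + lorentz * Matrix.of A = 0 :=
    mem_orthTangent_one (ξ := Matrix.of A)
  rw [hmem]
  constructor
  · rintro ⟨w, rfl⟩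
    ext i j
    fin_cases i <;> fin_cases j <;>
      simp [lorentzAlg, lorentz, Matrix.mul_apply, Fin.sum_univ_three, Matrix.diagonal_apply]
  · intro h
    have h' : ∀ i j, ((Matrix.of A)ᵀ * lorentz + lorentz * Matrix.of A) i j = 0 := by
      intro i j
      rw [h]
      rfl
    simp only [Matrix.add_apply, lorentz, Matrix.mul_diagonal, Matrix.diagonal_mul,
      Matrix.transpose_apply, Matrix.of_apply] at h'
    refine ⟨![A 0 1, A 0 2, A 1 2], ?_⟩
    have h00 := h' 0 0
    have h01 := h' 0 1
    have h02 := h' 0 2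
    have h11 := h' 1 1
    have h12 := h' 1 2
    have h22 := h' 2 2
    simp at h00 h01 h02 h11 h12 h22
    ext i j
    fin_cases i <;> fin_cases j <;> simp [lorentzAlg] <;> linarith

theorem finrank_orthTangent_lorentz : Module.finrank ℝ (orthTangent lorentz 1) = 3 := by
  rw [← range_lorentzAlg, LinearMap.finrank_range_of_inj lorentzAlg_injective]
  simp

theorem isUnit_det_lorentz : IsUnit lorentz.det := by
  rw [lorentz, Matrix.det_diagonal]
  simp [Fin.prod_univ_three]

end Stabilizer

/-! ### The differential of the lifted curvature map -/

section Lift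

variable {n : ℕ} {M : Type*} [TopologicalSpace M]
  [ChartedSpace (EuclideanSpace ℝ (Fin n)) M] [IsManifold (𝓡 n) ∞ M]
  {g : PseudoRiemannianMetric n M} {η : Matrix (Fin n) (Fin n) ℝ}

theorem fderiv_pullTensor_prod {p : ℕ} (X A : Fin n → Fin n → ℝ) (T S : CurvSpace n p) :
    fderiv ℝ (fun z : (Fin n → Fin n → ℝ) × CurvSpace n p ↦ pullTensor z.1 z.2) (X, T) (A, S)
      = fderiv ℝ (fun X ↦ pullTensor X T) X A + pullLin X S := by
  have h0 : HasFDerivAt (fun z : (Fin n → Fin n → ℝ) × CurvSpace n p ↦ pullTensor z.1 z.2) _ (X, T) :=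
    (contDiff_pullTensor.differentiable (by simp) (X, T)).hasFDerivAt
  have hi : HasFDerivAt (fun X : Fin n → Fin n → ℝ ↦ (X, T)) _ X :=
    (hasFDerivAt_id (𝕜 := ℝ) X).prodMk (hasFDerivAt_const T X)
  have hj : HasFDerivAt (fun T : CurvSpace n p ↦ (X, T)) _ T :=
    (hasFDerivAt_const (𝕜 := ℝ) X T).prodMk (hasFDerivAt_id T)
  have h1 : HasFDerivAt (fun X ↦ pullTensor X T) _ X := HasFDerivAt.comp (f := fun X : Fin n → Fin n → ℝ ↦ (X, T)) X h0 hi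
  have h2 : HasFDerivAt (fun T ↦ pullTensor X T) _ T := HasFDerivAt.comp (f := fun T : CurvSpace n p ↦ (X, T)) T h0 hj
  have h3 := congrArg (fun L ↦ L S) (h2.unique (pullLin X).hasFDerivAt)
  rw [h1.fderiv, ← h3]
  have h4 : (A, S) = (A, 0) + (0, S) := by simp
  rw [h4, map_add]
  rfl

namespace MovingCoframe

variable (θ : MovingCoframe g η) {x : M} {p : ℕ}

/-- The differential of the curvature map `R^(p)`. -/
def curvDeriv (p : ℕ) (x : M) : EuclideanSpace ℝ (Fin n) →L[ℝ] CurvSpace n p :=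
  mfderiv (𝓡 n) 𝓘(ℝ, CurvSpace n p) (θ.curvature p) x

theorem curvatureRank_eq (p : ℕ) (x : M) :
    θ.curvatureRank p x = Module.finrank ℝ (LinearMap.range (θ.curvDeriv p x).toLinearMap) := rfl

theorem hasMFDerivAt_curvature (hx : x ∈ θ.domain) (p : ℕ) :
    HasMFDerivAt (𝓡 n) 𝓘(ℝ, CurvSpace n p) (θ.curvature p) x (θ.curvDeriv p x) :=
  ((θ.contMDiffAt_curvature hx p).mdifferentiableAt (by simp)).hasMFDerivAt

/-- The differential of the lift of the curvature map. -/
def liftDeriv (p : ℕ) (x : M) (X : Fin n → Fin n → ℝ) :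
    (EuclideanSpace ℝ (Fin n) × (Fin n → Fin n → ℝ)) →L[ℝ] CurvSpace n p :=
  mfderiv ((𝓡 n).prod 𝓘(ℝ, Fin n → Fin n → ℝ)) 𝓘(ℝ, CurvSpace n p) (θ.lift p) (x, X)

theorem liftRank_eq_finrank_map (p : ℕ) (x : M) (X : Fin n → Fin n → ℝ) :
    θ.liftRank p x X = Module.finrank ℝ (Submodule.map (θ.liftDeriv p x X).toLinearMap
      ((⊤ : Submodule ℝ (EuclideanSpace ℝ (Fin n))).prod (orthTangent η (Matrix.of X)))) := rfl

theorem liftDeriv_apply (hx : x ∈ θ.domain) (X A : Fin n → Fin n → ℝ)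
    (v : EuclideanSpace ℝ (Fin n)) :
    θ.liftDeriv p x X (v, A)
      = fderiv ℝ (fun X ↦ pullTensor X (θ.curvature p x)) X A + pullLin X (θ.curvDeriv p x v) := by
  have h1 : HasMFDerivAt ((𝓡 n).prod 𝓘(ℝ, Fin n → Fin n → ℝ))
      𝓘(ℝ, CurvSpace n p) (fun z : M × (Fin n → Fin n → ℝ) ↦ θ.curvature p z.1) (x, X) _ :=
    HasMFDerivAt.comp (x, X) (θ.hasMFDerivAt_curvature hx p) (hasMFDerivAt_fst (x := (x, X)))
  have h2' := hasMFDerivAt_snd (I := 𝓡 n) (I' := 𝓘(ℝ, Fin n → Fin n → ℝ)) (x, X)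
  have h2 : HasMFDerivAt ((𝓡 n).prod 𝓘(ℝ, Fin n → Fin n → ℝ))
      𝓘(ℝ, (Fin n → Fin n → ℝ) × CurvSpace n p)
      (fun z : M × (Fin n → Fin n → ℝ) ↦ (z.2, θ.curvature p z.1)) (x, X) _ :=
    ⟨h2'.1.prodMk h1.1, h2'.2.prodMk h1.2⟩
  have h3 : HasMFDerivAt 𝓘(ℝ, (Fin n → Fin n → ℝ) × CurvSpace n p) 𝓘(ℝ, CurvSpace n p)
      (fun z : (Fin n → Fin n → ℝ) × CurvSpace n p ↦ pullTensor z.1 z.2) (X, θ.curvature p x) _ :=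
    (contDiff_pullTensor.differentiable (by simp) (X, θ.curvature p x)).hasFDerivAt.hasMFDerivAt
  have h4 := (HasMFDerivAt.comp (x, X) h3 h2).mfderiv
  have h5 := congrArg (fun L ↦ L ((v, A) : EuclideanSpace ℝ (Fin n) × (Fin n → Fin n → ℝ))) h4
  exact h5.trans (fderiv_pullTensor_prod X A _ _)

/-- The image splits as horizontal plus vertical because the lift is differentiated separately along
`M` and along the fibre; the sum need not be direct at this stage. -/
theorem liftRank_eq (hx : x ∈ θ.domain) (X : Matrix (Fin n) (Fin n) ℝ) :
    θ.liftRank p x X = Module.finrank ℝ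
      ((((LinearMap.range (θ.curvDeriv p x).toLinearMap).map (pullLin X).toLinearMap) ⊔
        (orthTangent η X).map
          (fderiv ℝ (fun X ↦ pullTensor X (θ.curvature p x)) X).toLinearMap :
            Submodule ℝ (CurvSpace n p))) := by
  have h : Submodule.map (θ.liftDeriv p x X).toLinearMap
    ((⊤ : Submodule ℝ (EuclideanSpace ℝ (Fin n))).prod (orthTangent η (Matrix.of X)))
    = (((LinearMap.range (θ.curvDeriv p x).toLinearMap).map (pullLin X).toLinearMap) ⊔
        (orthTangent η X).map
          (fderiv ℝ (fun X ↦ pullTensor X (θ.curvature p x)) X).toLinearMap :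
            Submodule ℝ (CurvSpace n p)) := by
    apply le_antisymm
    · rintro _ ⟨⟨v, A⟩, ⟨-, hA⟩, rfl⟩
      have h1 := θ.liftDeriv_apply (p := p) hx X A v
      refine Submodule.mem_sup.2 ⟨pullLin X (θ.curvDeriv p x v), ⟨_, ⟨v, rfl⟩, rfl⟩,
        fderiv ℝ (fun X ↦ pullTensor X (θ.curvature p x)) X A, ⟨A, hA, rfl⟩, ?_⟩
      exact (add_comm _ _).trans h1.symm
    · refine sup_le ?_ ?_
      · rintro _ ⟨_, ⟨v, rfl⟩, rfl⟩
        refine ⟨((v, 0) : EuclideanSpace ℝ (Fin n) × (Fin n → Fin n → ℝ)),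
          ⟨Submodule.mem_top, Submodule.zero_mem _⟩, ?_⟩
        refine (θ.liftDeriv_apply (p := p) hx X 0 v).trans ?_
        rw [map_zero, zero_add]
        rfl
      · rintro _ ⟨A, hA, rfl⟩
        refine ⟨((0, A) : EuclideanSpace ℝ (Fin n) × (Fin n → Fin n → ℝ)),
          ⟨Submodule.mem_top, hA⟩, ?_⟩
        refine (θ.liftDeriv_apply (p := p) hx X A 0).trans ?_
        rw [map_zero, map_zero, add_zero]
        rfl
  refine (θ.liftRank_eq_finrank_map p x X).trans ?_
  rw [h]

theorem liftRank_one (hx : x ∈ θ.domain) :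
    θ.liftRank p x (1 : Matrix (Fin n) (Fin n) ℝ) = Module.finrank ℝ
      ((LinearMap.range (θ.curvDeriv p x).toLinearMap ⊔
        (orthTangent η 1).map (infAct (θ.curvature p x)).toLinearMap :
            Submodule ℝ (CurvSpace n p))) := by
  rw [θ.liftRank_eq hx 1]
  have h : (pullLin (p := p) (1 : Matrix (Fin n) (Fin n) ℝ)).toLinearMap = LinearMap.id := by
    exact LinearMap.ext fun T ↦ pullTensor_one T
  rw [h, Submodule.map_id]
  rfl

end MovingCoframe

end Lift

/-! ### The Cayley transform as a smooth parametrization of `O(η)` near the identity -/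

section Cayley

variable {n : ℕ}

/-- The Cayley transform. -/
def cayley (ξ : Matrix (Fin n) (Fin n) ℝ) : Matrix (Fin n) (Fin n) ℝ := (1 + ξ) * (1 - ξ)⁻¹

theorem cayley_zero : cayley (0 : Matrix (Fin n) (Fin n) ℝ) = 1 := by simp [cayley]

theorem cayley_mul {ξ : Matrix (Fin n) (Fin n) ℝ} (h : IsUnit (1 - ξ).det) :
    cayley ξ * (1 - ξ) = 1 + ξ := by
  rw [cayley, mul_assoc, Matrix.nonsing_inv_mul _ h, mul_one]

/-- For `ξ` in the Lie algebra, `1 + ξ` and `1 - ξ` pull `η` back to the same form, so their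
quotient is orthogonal. -/
theorem cayley_mem_orth {η ξ : Matrix (Fin n) (Fin n) ℝ} (h : IsUnit (1 - ξ).det)
    (hξ : ξᵀ * η + η * ξ = 0) : (cayley ξ)ᵀ * η * cayley ξ = η := by
  have h1 : ξᵀ * η = -(η * ξ) := eq_neg_of_add_eq_zero_left hξ
  have h2 : (1 + ξ)ᵀ * η * (1 + ξ) = (1 - ξ)ᵀ * η * (1 - ξ) := by
    simp only [Matrix.transpose_add, Matrix.transpose_sub, Matrix.transpose_one, add_mul, sub_mul,
      one_mul, h1]
    noncomm_ring
  have h3 : (1 - ξ) * (1 - ξ)⁻¹ = 1 := Matrix.mul_nonsing_inv _ h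
  calc (cayley ξ)ᵀ * η * cayley ξ = (1 - ξ)⁻¹ᵀ * ((1 + ξ)ᵀ * η * (1 + ξ)) * (1 - ξ)⁻¹ := by
        rw [cayley, Matrix.transpose_mul]; noncomm_ring
    _ = ((1 - ξ) * (1 - ξ)⁻¹)ᵀ * η * ((1 - ξ) * (1 - ξ)⁻¹) := by
        rw [h2, Matrix.transpose_mul]; noncomm_ring
    _ = η := by rw [h3]; simp

/-- The Cayley transform on matrices regarded as functions. -/
def cayleyFun (A : Fin n → Fin n → ℝ) : Fin n → Fin n → ℝ := cayley (Matrix.of A)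

theorem contDiffAt_cayley {ξ : Matrix (Fin n) (Fin n) ℝ} (h : IsUnit (1 - ξ).det) :
    ContDiffAt ℝ ∞ cayleyFun (ξ : Fin n → Fin n → ℝ) := by
  have hentry : ∀ i j : Fin n, ContDiff ℝ ∞ fun A : Fin n → Fin n → ℝ ↦ A i j :=
    fun i j ↦ contDiff_apply_apply ℝ ℝ i j
  have h1 : ∀ i j : Fin n, ContDiff ℝ ∞ fun A : Fin n → Fin n → ℝ ↦ (1 - Matrix.of A) i j :=
    fun i j ↦ contDiff_const.sub (hentry i j)
  have hdet : ContDiff ℝ ∞ fun A : Fin n → Fin n → ℝ ↦ (1 - Matrix.of A).det := by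
    simp only [Matrix.det_apply']
    exact ContDiff.sum fun σ _ ↦ contDiff_const.mul (contDiff_prod fun i _ ↦ h1 _ _)
  have hadj : ∀ i j, ContDiff ℝ ∞ fun A : Fin n → Fin n → ℝ ↦ (1 - Matrix.of A).adjugate i j := by
    intro i j
    simp only [Matrix.adjugate_apply, Matrix.det_apply']
    refine ContDiff.sum fun σ _ ↦ contDiff_const.mul (contDiff_prod fun k _ ↦ ?_)
    simp only [Matrix.updateRow_apply]
    split_ifs
    · exact contDiff_const
    · exact h1 _ _
  refine contDiffAt_pi.2 fun i ↦ contDiffAt_pi.2 fun j ↦ ?_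
  have h2 : (fun A : Fin n → Fin n → ℝ ↦ cayley (Matrix.of A) i j) = fun A ↦
      ∑ k, (1 + Matrix.of A) i k * ((1 - Matrix.of A).det⁻¹ * (1 - Matrix.of A).adjugate k j) := by
    funext A
    simp only [cayley, Matrix.mul_apply, Matrix.inv_def, Matrix.smul_apply, smul_eq_mul,
      Ring.inverse_eq_inv']
  change ContDiffAt ℝ ∞ (fun A : Fin n → Fin n → ℝ ↦ cayley (Matrix.of A) i j)
    (ξ : Fin n → Fin n → ℝ)
  rw [h2]
  refine ContDiffAt.sum fun k _ ↦ ContDiffAt.mul ?_ (ContDiffAt.mul ?_ (hadj k j).contDiffAt)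
  · exact (contDiff_const.add (hentry i k)).contDiffAt
  · exact hdet.contDiffAt.inv h.ne_zero

theorem eventually_isUnit_det {ξ : Matrix (Fin n) (Fin n) ℝ} (h : IsUnit (1 - ξ).det) :
    ∀ᶠ A : Fin n → Fin n → ℝ in 𝓝 ξ, IsUnit (1 - Matrix.of A).det := by
  have hc : Continuous fun A : Fin n → Fin n → ℝ ↦ (1 - Matrix.of A).det := by
    have : Continuous fun A : Fin n → Fin n → ℝ ↦ (1 - Matrix.of A) :=
      continuous_const.sub continuous_id
    exact this.matrix_det
  filter_upwards [hc.continuousAt.eventually_ne h.ne_zero] with A hA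
  exact isUnit_iff_ne_zero.2 hA

/-- Differentiate `cayley A * (1 - A) = 1 + A`, which avoids differentiating the inverse. -/
theorem fderiv_cayley_mul {ξ : Matrix (Fin n) (Fin n) ℝ} (h : IsUnit (1 - ξ).det)
    (a : Matrix (Fin n) (Fin n) ℝ) :
    Matrix.of (fderiv ℝ cayleyFun (ξ : Fin n → Fin n → ℝ) a) * (1 - ξ) = (1 + cayley ξ) * a := by
  set D := fderiv ℝ cayleyFun (ξ : Fin n → Fin n → ℝ)
  have h1 : HasFDerivAt cayleyFun D (ξ : Fin n → Fin n → ℝ) :=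
    ((contDiffAt_cayley h).differentiableAt (by simp)).hasFDerivAt
  ext i j
  have h2 : ∀ i m, HasFDerivAt (fun A : Fin n → Fin n → ℝ ↦ cayley (Matrix.of A) i m)
      ((ContinuousLinearMap.proj m).comp ((ContinuousLinearMap.proj i).comp D))
      (ξ : Fin n → Fin n → ℝ) := fun i m ↦
    hasFDerivAt_pi'.1 (hasFDerivAt_pi'.1 h1 i) m
  have h3 : ∀ m j, HasFDerivAt (fun A : Fin n → Fin n → ℝ ↦ A m j)
      ((ContinuousLinearMap.proj (R := ℝ) (φ := fun _ : Fin n ↦ ℝ) j).comp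
        (ContinuousLinearMap.proj (R := ℝ) (φ := fun _ : Fin n ↦ Fin n → ℝ) m))
      (ξ : Fin n → Fin n → ℝ) := fun m j ↦
    ((ContinuousLinearMap.proj (R := ℝ) (φ := fun _ : Fin n ↦ ℝ) j).comp
        (ContinuousLinearMap.proj (R := ℝ) (φ := fun _ : Fin n ↦ Fin n → ℝ) m)).hasFDerivAt
  have h4 : HasFDerivAt (fun A : Fin n → Fin n → ℝ ↦ ∑ m, cayley (Matrix.of A) i m
      * ((1 : Matrix (Fin n) (Fin n) ℝ) m j - A m j)) _ (ξ : Fin n → Fin n → ℝ) :=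
    HasFDerivAt.fun_sum fun m _ ↦ (h2 i m).mul ((hasFDerivAt_const _ _).sub (h3 m j))
  have h5 : (fun A : Fin n → Fin n → ℝ ↦ ∑ m, cayley (Matrix.of A) i m
      * ((1 : Matrix (Fin n) (Fin n) ℝ) m j - A m j)) =ᶠ[𝓝 (ξ : Fin n → Fin n → ℝ)]
      fun A ↦ (1 : Matrix (Fin n) (Fin n) ℝ) i j + A i j := by
    filter_upwards [eventually_isUnit_det h] with A hA
    exact congrFun (congrFun (cayley_mul hA) i) j
  have h6 := h4.unique (((hasFDerivAt_const _ _).add (h3 i j)).congr_of_eventuallyEq h5)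
  have h7 : ∑ m, (cayley ξ i m * (0 - a m j)
      + ((1 : Matrix (Fin n) (Fin n) ℝ) m j - ξ m j) * D a i m) = 0 + a i j :=
    (sum_apply (F := (Fin n → Fin n → ℝ) →L[ℝ] ℝ) _ _ a).symm.trans (congrArg (fun L ↦ L a) h6)
  rw [add_mul, one_mul, Matrix.add_apply, Matrix.mul_apply, Matrix.mul_apply, ← zero_add (a i j),
    ← h7, ← Finset.sum_add_distrib]
  refine Finset.sum_congr rfl fun m _ ↦ ?_
  simp only [Matrix.of_apply, Matrix.sub_apply]
  ring

/-- The differential of the Cayley transform maps the Lie algebra onto the tangent space. -/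
theorem map_fderiv_cayley {η ξ : Matrix (Fin n) (Fin n) ℝ} (h : IsUnit (1 - ξ).det)
    (hξ : ξᵀ * η + η * ξ = 0) :
    (orthTangent η 1).map (fderiv ℝ cayleyFun (ξ : Fin n → Fin n → ℝ)).toLinearMap
      = orthTangent η (cayley ξ) := by
  have h3 : (1 - ξ) * (1 - ξ)⁻¹ = 1 := Matrix.mul_nonsing_inv _ h
  have h3' : (1 - ξ)⁻¹ * (1 - ξ) = 1 := Matrix.nonsing_inv_mul _ h
  have hX := cayley_mul h
  have h2 : (1 + cayley ξ) * (1 - ξ) = (2 : ℝ) • 1 := by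
    rw [add_mul, hX, two_smul]
    noncomm_ring
  have h4 : η * (1 - ξ) = (1 - ξ)ᵀ * (cayley ξ)ᵀ * η := by
    rw [← Matrix.transpose_mul, hX, Matrix.transpose_add, Matrix.transpose_one, add_mul, one_mul,
      eq_neg_of_add_eq_zero_left hξ]
    noncomm_ring
  have h5 : (1 - ξ)ᵀ * η = η * cayley ξ * (1 - ξ) := by
    rw [mul_assoc, hX, Matrix.transpose_sub, Matrix.transpose_one, sub_mul, one_mul,
      eq_neg_of_add_eq_zero_left hξ]
    noncomm_ring
  have hmem : ∀ A : Matrix (Fin n) (Fin n) ℝ, (A : Fin n → Fin n → ℝ) ∈ orthTangent η (cayley ξ) ↔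
      Aᵀ * η * cayley ξ + (cayley ξ)ᵀ * η * A = 0 := fun A ↦ Iff.rfl
  -- Sandwiching by `1 - ξ` translates tangency at `cayley ξ` into membership in the Lie algebra.
  have key : ∀ A : Matrix (Fin n) (Fin n) ℝ,
      ((1 - ξ) * A * (1 - ξ))ᵀ * η + η * ((1 - ξ) * A * (1 - ξ))
        = (1 - ξ)ᵀ * (Aᵀ * η * cayley ξ + (cayley ξ)ᵀ * η * A) * (1 - ξ) := by
    intro A
    calc ((1 - ξ) * A * (1 - ξ))ᵀ * η + η * ((1 - ξ) * A * (1 - ξ))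
        = (1 - ξ)ᵀ * Aᵀ * ((1 - ξ)ᵀ * η) + (η * (1 - ξ)) * A * (1 - ξ) := by
          rw [Matrix.transpose_mul, Matrix.transpose_mul]; noncomm_ring
      _ = _ := by rw [h5, h4]; noncomm_ring
  apply le_antisymm
  · rintro _ ⟨a, ha, rfl⟩
    set A : Matrix (Fin n) (Fin n) ℝ :=
      Matrix.of (fderiv ℝ cayleyFun (ξ : Fin n → Fin n → ℝ) a) with hA
    have ha' : (Matrix.of a)ᵀ * η + η * Matrix.of a = 0 :=
      mem_orthTangent_one (ξ := Matrix.of a).1 ha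
    have h6 : A * (1 - ξ) = (1 + cayley ξ) * Matrix.of a := fderiv_cayley_mul h (Matrix.of a)
    have h7 : (1 - ξ) * A * (1 - ξ) = (2 : ℝ) • Matrix.of a := by
      have h8 : (1 - ξ) * (1 + cayley ξ) = (2 : ℝ) • 1 := by
        have h9 : (1 + cayley ξ) * ((2 : ℝ)⁻¹ • (1 - ξ)) = 1 := by
          rw [mul_smul_comm, h2, smul_smul]
          norm_num
        have h10 := mul_eq_one_comm.1 h9
        rw [smul_mul_assoc] at h10
        calc (1 - ξ) * (1 + cayley ξ) = (2 : ℝ) • (2 : ℝ)⁻¹ • ((1 - ξ) * (1 + cayley ξ)) := by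
              rw [smul_smul]; norm_num
          _ = (2 : ℝ) • 1 := by rw [h10]
      rw [mul_assoc, h6, ← mul_assoc, h8, smul_mul_assoc, one_mul]
    have h8 := key A
    rw [h7, Matrix.transpose_smul, smul_mul_assoc, mul_smul_comm, ← smul_add, ha', smul_zero] at h8
    refine (hmem A).2 ?_
    calc _ = ((1 - ξ) * (1 - ξ)⁻¹)ᵀ * (Aᵀ * η * cayley ξ + (cayley ξ)ᵀ * η * A)
            * ((1 - ξ) * (1 - ξ)⁻¹) := by rw [h3]; simp
      _ = (1 - ξ)⁻¹ᵀ * ((1 - ξ)ᵀ * (Aᵀ * η * cayley ξ + (cayley ξ)ᵀ * η * A) * (1 - ξ))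
            * (1 - ξ)⁻¹ := by rw [Matrix.transpose_mul]; noncomm_ring
      _ = 0 := by rw [← h8, mul_zero, zero_mul]
  · intro A hA
    have hA' := (hmem (Matrix.of A)).1 hA
    set B : Matrix (Fin n) (Fin n) ℝ := Matrix.of A
    have hk := key B
    rw [hA', mul_zero, zero_mul] at hk
    -- The factor one half compensates `(1 + cayley ξ) * (1 - ξ) = 2`.
    refine ⟨((2 : ℝ)⁻¹ • ((1 - ξ) * B * (1 - ξ)) : Matrix (Fin n) (Fin n) ℝ),
      mem_orthTangent_one.2 ?_, ?_⟩
    · rw [Matrix.transpose_smul, smul_mul_assoc, mul_smul_comm, ← smul_add, hk, smul_zero]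
    · have h6 := fderiv_cayley_mul h ((2 : ℝ)⁻¹ • ((1 - ξ) * B * (1 - ξ)))
      have h7 : (1 + cayley ξ) * ((2 : ℝ)⁻¹ • ((1 - ξ) * B * (1 - ξ))) = B * (1 - ξ) := by
        rw [mul_smul_comm, ← mul_assoc, ← mul_assoc, h2, smul_mul_assoc, smul_mul_assoc, one_mul,
          smul_smul]
        norm_num
      rw [h7] at h6
      have hcancel : ∀ Z W : Matrix (Fin n) (Fin n) ℝ, Z * (1 - ξ) = W * (1 - ξ) → Z = W := by
        intro Z W hZW
        calc Z = Z * (1 - ξ) * (1 - ξ)⁻¹ := by rw [mul_assoc, h3, mul_one]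
          _ = W := by rw [hZW, mul_assoc, h3, mul_one]
      exact hcancel _ _ h6

end Cayley

/-! ### Transversality of horizontal and vertical directions -/

section Transversality

variable {n : ℕ} {M : Type*} [TopologicalSpace M]
  [ChartedSpace (EuclideanSpace ℝ (Fin n)) M] [IsManifold (𝓡 n) ∞ M]
  {g : PseudoRiemannianMetric n M} {η : Matrix (Fin n) (Fin n) ℝ}

theorem exists_orthGroup_eq {X : Matrix (Fin n) (Fin n) ℝ} (hdet : IsUnit η.det)
    (hX : Xᵀ * η * X = η) : ∃ Y ∈ orthGroup η, (Y : Matrix (Fin n) (Fin n) ℝ) = X := by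
  have h : η⁻¹ * Xᵀ * η * X = 1 := by
    rw [mul_assoc, mul_assoc, ← mul_assoc Xᵀ, hX, Matrix.nonsing_inv_mul _ hdet]
  exact ⟨⟨X, η⁻¹ * Xᵀ * η, mul_eq_one_comm.1 h, h⟩, hX, rfl⟩

namespace MovingCoframe

variable (θ : MovingCoframe g η) {x : M} {p : ℕ}

/-- The curvature map read in the preferred chart at `x₀`. -/
def chartCurvature (p : ℕ) (x₀ : M) (e : EuclideanSpace ℝ (Fin n)) : CurvSpace n p :=
  θ.curvature p ((extChartAt (𝓡 n) x₀).symm e)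

theorem contDiffAt_chartCurvature {x₀ : M} {e : EuclideanSpace ℝ (Fin n)}
    (he : e ∈ (extChartAt (𝓡 n) x₀).target) (hx : (extChartAt (𝓡 n) x₀).symm e ∈ θ.domain) :
    ContDiffAt ℝ ∞ (θ.chartCurvature p x₀) e := by
  have h1 : ContMDiffAt 𝓘(ℝ, EuclideanSpace ℝ (Fin n)) (𝓡 n) ∞ (extChartAt (𝓡 n) x₀).symm e :=
    (contMDiffOn_extChartAt_symm x₀).contMDiffAt ((isOpen_extChartAt_target x₀).mem_nhds he)
  exact ((θ.contMDiffAt_curvature hx p).comp e h1).contDiffAt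

theorem exists_hasFDerivAt_chartCurvature {x₀ : M} {e : EuclideanSpace ℝ (Fin n)}
    (he : e ∈ (extChartAt (𝓡 n) x₀).target) (hx : (extChartAt (𝓡 n) x₀).symm e ∈ θ.domain) :
    ∃ L : EuclideanSpace ℝ (Fin n) →L[ℝ] EuclideanSpace ℝ (Fin n), Function.Surjective L ∧
      HasFDerivAt (θ.chartCurvature p x₀)
        ((θ.curvDeriv p ((extChartAt (𝓡 n) x₀).symm e)).comp L) e := by
  have h1 : ContMDiffAt 𝓘(ℝ, EuclideanSpace ℝ (Fin n)) (𝓡 n) ∞ (extChartAt (𝓡 n) x₀).symm e :=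
    (contMDiffOn_extChartAt_symm x₀).contMDiffAt ((isOpen_extChartAt_target x₀).mem_nhds he)
  have h2 := (h1.mdifferentiableAt (by simp)).hasMFDerivAt
  have h3 := HasMFDerivAt.comp e (θ.hasMFDerivAt_curvature hx p) h2
  refine ⟨mfderiv 𝓘(ℝ, EuclideanSpace ℝ (Fin n)) (𝓡 n) (extChartAt (𝓡 n) x₀).symm e, ?_,
    h3.hasFDerivAt⟩
  have h4 := mfderivWithin_extChartAt_symm_comp_mfderiv_extChartAt (I := 𝓡 n) he
  rw [ModelWithCorners.Boundaryless.range_eq_univ, mfderivWithin_univ] at h4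
  intro v
  exact ⟨_, congrArg (fun L ↦ L v) h4⟩

/-- On normalizing coframes, the horizontal and the vertical parts of the differential of the
lifted curvature map are transverse. -/
theorem disjoint_range_curvDeriv (hdet : IsUnit η.det) {r : ℕ}
    (hrank : ∀ y ∈ θ.domain, ∀ X ∈ orthGroup η,
      θ.liftRank p y (X : Matrix (Fin n) (Fin n) ℝ) = r)
    (hinj : ∀ y ∈ θ.domain, ∀ y' ∈ θ.domain, ∀ X : Matrix (Fin n) (Fin n) ℝ, Xᵀ * η * X = η →
      pullTensor X (θ.curvature p y') = θ.curvature p y → θ.curvature p y' = θ.curvature p y)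
    (hx : x ∈ θ.domain) :
    Disjoint (LinearMap.range (θ.curvDeriv p x).toLinearMap)
      ((orthTangent η 1).map (infAct (θ.curvature p x)).toLinearMap) := by
  set φ := extChartAt (𝓡 n) x with hφ
  set z₀ := φ x
  have hz : φ.symm z₀ = x := extChartAt_to_inv x
  have hgood : ∀ᶠ e in 𝓝 z₀, e ∈ φ.target ∧ φ.symm e ∈ θ.domain := by
    have h0 : ∀ᶠ e in 𝓝 z₀, e ∈ φ.target := extChartAt_target_mem_nhds x
    refine h0.and ?_
    have h1 : ContinuousAt φ.symm z₀ := continuousAt_extChartAt_symm x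
    refine h1.eventually ?_
    rw [hz]
    exact θ.isOpen_domain.mem_nhds hx
  let K := orthTangent η (1 : Matrix (Fin n) (Fin n) ℝ)
  -- The lift in local coordinates: a chart of `M` and Cayley coordinates on the group make it a map
  -- between vector spaces, to which the constant rank theorem applies.
  let f : EuclideanSpace ℝ (Fin n) × K → CurvSpace n p :=
    fun z ↦ pullTensor (cayleyFun z.2) (θ.chartCurvature p x z.1)
  have hK : ∀ ξ : K, (Matrix.of ξ.1)ᵀ * η + η * Matrix.of ξ.1 = 0 := fun ξ ↦
    mem_orthTangent_one (ξ := Matrix.of ξ.1).1 ξ.2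
  have hderiv : ∀ (e : EuclideanSpace ℝ (Fin n)) (ξ : K), e ∈ φ.target → φ.symm e ∈ θ.domain →
      IsUnit (1 - Matrix.of ξ.1).det → ∀ (v : EuclideanSpace ℝ (Fin n)) (a : K),
      fderiv ℝ f (e, ξ) (v, a) = fderiv ℝ (fun X ↦ pullTensor X (θ.chartCurvature p x e))
        (cayleyFun ξ) (fderiv ℝ cayleyFun ξ.1 a.1)
        + pullLin (cayleyFun ξ) (fderiv ℝ (θ.chartCurvature p x) e v) := by
    intro e ξ he hd hu v a
    have h1 : HasFDerivAt (fun z : EuclideanSpace ℝ (Fin n) × K ↦ θ.chartCurvature p x z.1)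
        ((fderiv ℝ (θ.chartCurvature p x) e).comp (ContinuousLinearMap.fst ℝ _ K)) (e, ξ) :=
      HasFDerivAt.comp (g := θ.chartCurvature p x) (e, ξ)
        ((θ.contDiffAt_chartCurvature he hd).differentiableAt (by simp)).hasFDerivAt
        (ContinuousLinearMap.fst ℝ (EuclideanSpace ℝ (Fin n)) K).hasFDerivAt
    have h2 : HasFDerivAt (fun z : EuclideanSpace ℝ (Fin n) × K ↦ cayleyFun z.2.1)
        ((fderiv ℝ cayleyFun ξ.1).comp
          (K.subtypeL.comp (ContinuousLinearMap.snd ℝ (EuclideanSpace ℝ (Fin n)) K))) (e, ξ) :=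
      HasFDerivAt.comp (g := cayleyFun) (e, ξ)
        ((contDiffAt_cayley hu).differentiableAt (by simp)).hasFDerivAt
        (K.subtypeL.comp (ContinuousLinearMap.snd ℝ (EuclideanSpace ℝ (Fin n)) K)).hasFDerivAt
    have h3 : HasFDerivAt f _ (e, ξ) :=
      HasFDerivAt.comp (g := fun z : (Fin n → Fin n → ℝ) × CurvSpace n p ↦ pullTensor z.1 z.2)
        (e, ξ) ((contDiff_pullTensor.differentiable (by simp)
          (cayleyFun ξ.1, θ.chartCurvature p x e)).hasFDerivAt) (h2.prodMk h1)
    rw [h3.fderiv]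
    exact fderiv_pullTensor_prod _ _ _ _
  have hcont : ContDiffAt ℝ ∞ f (z₀, 0) := by
    have h1 := θ.contDiffAt_chartCurvature (p := p) (mem_extChartAt_target (I := 𝓡 n) x)
      (hz.symm ▸ hx)
    have h2 : ContDiffAt ℝ ∞ cayleyFun ((0 : K) : Fin n → Fin n → ℝ) :=
      contDiffAt_cayley (ξ := 0) (by simp)
    refine ContDiffAt.comp (g := fun z : (Fin n → Fin n → ℝ) × CurvSpace n p ↦
      pullTensor z.1 z.2) (f := fun z : EuclideanSpace ℝ (Fin n) × K ↦
        (cayleyFun z.2.1, θ.chartCurvature p x z.1)) (z₀, 0) contDiff_pullTensor.contDiffAt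
      (ContDiffAt.prodMk ?_ ?_)
    · exact ContDiffAt.comp (g := cayleyFun) (f := fun z : EuclideanSpace ℝ (Fin n) × K ↦ z.2.1)
        (z₀, 0) h2
        (K.subtypeL.comp (ContinuousLinearMap.snd ℝ (EuclideanSpace ℝ (Fin n)) K)).contDiff.contDiffAt
    · exact ContDiffAt.comp (g := θ.chartCurvature p x)
        (f := fun z : EuclideanSpace ℝ (Fin n) × K ↦ z.1) (z₀, 0) h1 contDiffAt_fst
  have hev : ∀ᶠ z : EuclideanSpace ℝ (Fin n) × K in 𝓝 (z₀, 0),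
      (z.1 ∈ φ.target ∧ φ.symm z.1 ∈ θ.domain) ∧ IsUnit (1 - Matrix.of z.2.1).det := by
    have h0 : ContinuousAt (fun z : EuclideanSpace ℝ (Fin n) × K ↦ z.1) (z₀, 0) := continuousAt_fst
    refine (h0.eventually hgood).and ?_
    have h1 : ContinuousAt (fun z : EuclideanSpace ℝ (Fin n) × K ↦ z.2.1) (z₀, 0) :=
      (K.subtypeL.comp
        (ContinuousLinearMap.snd ℝ (EuclideanSpace ℝ (Fin n)) K)).continuous.continuousAt
    exact h1.eventually (eventually_isUnit_det (ξ := 0) (by simp))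
  -- Both coordinate changes are onto the relevant tangent spaces, so the rank of `f` is the rank of
  -- the lift, constant at all nearby points and group elements.
  have hr : ∀ᶠ z in 𝓝 ((z₀, 0) : EuclideanSpace ℝ (Fin n) × K),
      Module.finrank ℝ (LinearMap.range (fderiv ℝ f z).toLinearMap) = r := by
    filter_upwards [hev]
    rintro ⟨e, ξ⟩ ⟨⟨he, hd⟩, hu⟩
    obtain ⟨X, hX, hXe⟩ := exists_orthGroup_eq hdet (cayley_mem_orth hu (hK ξ))
    rw [← hrank _ hd X hX, hXe, θ.liftRank_eq hd, ← map_fderiv_cayley hu (hK ξ)]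
    obtain ⟨L, hL, hD⟩ := θ.exists_hasFDerivAt_chartCurvature (p := p) he hd
    have heq : LinearMap.range (fderiv ℝ f (e, ξ)).toLinearMap =
      (LinearMap.range (θ.curvDeriv p (φ.symm e)).toLinearMap).map
        (pullLin (cayleyFun ξ)).toLinearMap ⊔ ((orthTangent η 1).map
        (fderiv ℝ cayleyFun ξ.1).toLinearMap).map
        (fderiv ℝ (fun X ↦ pullTensor X (θ.chartCurvature p x e)) (cayleyFun ξ)).toLinearMap := by
      apply le_antisymm
      · rintro _ ⟨⟨v, a⟩, rfl⟩
        refine Submodule.mem_sup.2 ⟨_, ⟨_, ⟨L v, rfl⟩, rfl⟩, _, ⟨_, ⟨a.1, a.2, rfl⟩, rfl⟩, ?_⟩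
        refine Eq.trans ?_ (hderiv e ξ he hd hu v a).symm
        rw [hD.fderiv]
        exact add_comm _ _
      · refine sup_le ?_ ?_
        · rintro _ ⟨_, ⟨v, rfl⟩, rfl⟩
          obtain ⟨w, rfl⟩ := hL v
          refine ⟨(w, 0), (hderiv e ξ he hd hu w 0).trans ?_⟩
          rw [hD.fderiv]
          simp [hφ]
        · rintro _ ⟨_, ⟨a, ha, rfl⟩, rfl⟩
          refine ⟨(0, ⟨a, ha⟩), (hderiv e ξ he hd hu 0 ⟨a, ha⟩).trans ?_⟩
          simp
    rw [heq]
    rfl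
  rw [Submodule.disjoint_def]
  rintro u ⟨v, hv⟩ ⟨A, hA, hAu⟩
  have hu0 : IsUnit (1 - Matrix.of ((0 : K) : Fin n → Fin n → ℝ)).det := by
    change IsUnit (1 - (0 : Matrix (Fin n) (Fin n) ℝ)).det
    simp
  have hzt := mem_extChartAt_target (I := 𝓡 n) x
  have hzd : φ.symm z₀ ∈ θ.domain := hz.symm ▸ hx
  obtain ⟨L, hL, hD⟩ := θ.exists_hasFDerivAt_chartCurvature (p := p) hzt hzd
  obtain ⟨w, hw⟩ := hL v
  have hDw : fderiv ℝ (θ.chartCurvature p x) z₀ w = u := by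
    rw [hD.fderiv]
    change θ.curvDeriv p (φ.symm z₀) (L w) = u
    rw [hw, hz]
    exact hv
  have hc0 : θ.chartCurvature p x z₀ = θ.curvature p x := congrArg (θ.curvature p) hz
  have hcay0 : cayleyFun ((0 : K) : Fin n → Fin n → ℝ) = (1 : Matrix (Fin n) (Fin n) ℝ) :=
    cayley_zero
  -- The Cayley transform has derivative `2` at the origin; the scalar `-1/2` makes it hit `-A`.
  have hcay : fderiv ℝ cayleyFun ((0 : K) : Fin n → Fin n → ℝ) ((-(2 : ℝ)⁻¹) • A) = -A := by
    have h1 := fderiv_cayley_mul (ξ := (0 : Matrix (Fin n) (Fin n) ℝ)) (by simp)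
      ((-(2 : ℝ)⁻¹) • Matrix.of A)
    rw [sub_zero, mul_one, cayley_zero, add_mul, one_mul, ← add_smul] at h1
    have h2 : (-(2 : ℝ)⁻¹ + -(2 : ℝ)⁻¹) • Matrix.of A = -Matrix.of A := by
      norm_num
    exact h1.trans h2
  -- A common vector `u` is reached horizontally by `w` and vertically by `A`; moving along `w` and
  -- against `A` at once is a kernel direction.
  have hker : fderiv ℝ f (z₀, 0) (w, (-(2 : ℝ)⁻¹) • ⟨A, hA⟩) = 0 := by
    rw [hderiv z₀ 0 hzt hzd hu0, hDw, hcay0]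
    have h1 := congrArg (fderiv ℝ (fun X ↦ pullTensor X (θ.chartCurvature p x z₀))
      (1 : Matrix (Fin n) (Fin n) ℝ)) hcay
    have h2 : pullLin (1 : Matrix (Fin n) (Fin n) ℝ) u = u := pullTensor_one u
    rw [h2]
    refine (congrArg (· + u) h1).trans ?_
    rw [hc0, map_neg]
    exact neg_add_eq_zero.2 hAu
  obtain ⟨γ, hγ0, hγ, hγf⟩ := exists_curve_of_constant_rank hcont hr hker
  have h1 : HasDerivAt (fun t ↦ (γ t).1) w 0 :=
    (hasFDerivAt_fst (𝕜 := ℝ) (p := γ 0)).comp_hasDerivAt 0 hγ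
  have h2 : HasFDerivAt (θ.chartCurvature p x) (fderiv ℝ (θ.chartCurvature p x) z₀) (γ 0).1 := by
    rw [hγ0]
    exact ((θ.contDiffAt_chartCurvature hzt hzd).differentiableAt (by simp)).hasFDerivAt
  have h3 := h2.comp_hasDerivAt 0 h1
  rw [hDw] at h3
  -- Along the curve the curvature values are in the orbit of the value at `x`, hence equal to it by
  -- `hinj`. Their velocity is `u`, so `u = 0`.
  have h4 : (fun t ↦ θ.chartCurvature p x (γ t).1) =ᶠ[𝓝 0] fun _ ↦ θ.curvature p x := by
    have h5 : ContinuousAt γ 0 := hγ.continuousAt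
    have h6 := h5.eventually (hγ0.symm ▸ hev)
    filter_upwards [h6, hγf] with t ht htf
    refine hinj x hx _ ht.1.2 _ (cayley_mem_orth ht.2 (hK (γ t).2)) ?_
    refine Eq.trans htf ?_
    change pullTensor (cayleyFun ((0 : K) : Fin n → Fin n → ℝ)) (θ.chartCurvature p x z₀) = _
    rw [hcay0, hc0]
    exact pullTensor_one _
  exact h3.unique ((hasDerivAt_const 0 _).congr_of_eventuallyEq h4)

end MovingCoframe

end Transversality

/-! ### Schur's lemma in dimension three -/

section SchurAlgebra

/-- The algebraic content of Schur's lemma in dimension three: `G`, `D`, `D2` are the values of the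
connection components and of their first and second frame derivatives at a point. -/
theorem schur_algebra {G : Fin 3 → Fin 3 → Fin 3 → ℝ} {D : Fin 3 → Fin 3 → Fin 3 → Fin 3 → ℝ}
    {D2 : Fin 3 → Fin 3 → Fin 3 → Fin 3 → Fin 3 → ℝ} {K : ℝ} {DK : Fin 3 → ℝ}
    (hG : ∀ a b c, G a b c = -G a c b) (hD : ∀ d a b c, D d a b c = -D d a c b)
    (hcomm : ∀ d e a b c, D2 d e a b c - D2 e d a b c
      = ∑ m, ∑ l, lorentz m l * (G d e l - G e d l) * D m a b c)
    (hR : ∀ a b c d, D a b c d - D b a c d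
      + ∑ m, ∑ l, lorentz m l * (G b c l * G a m d - G a c l * G b m d
        - (G a b l - G b a l) * G m c d)
      = K * (lorentz a d * lorentz b c - lorentz a c * lorentz b d))
    (hDR : ∀ f a b c d, D2 f a b c d - D2 f b a c d
      + ∑ m, ∑ l, lorentz m l * (D f b c l * G a m d + G b c l * D f a m d
        - (D f a c l * G b m d + G a c l * D f b m d)
        - ((D f a b l - D f b a l) * G m c d + (G a b l - G b a l) * D f m c d))
      = DK f * (lorentz a d * lorentz b c - lorentz a c * lorentz b d)) : DK = 0 := by
  have g0 : ∀ a b, G a b b = 0 := fun a b ↦ self_eq_neg.1 (hG a b b)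
  have d0 : ∀ d a b, D d a b b = 0 := fun d a b ↦ self_eq_neg.1 (hD d a b b)
  have g10 : ∀ a, G a 1 0 = -G a 0 1 := fun a ↦ hG a 1 0
  have g20 : ∀ a, G a 2 0 = -G a 0 2 := fun a ↦ hG a 2 0
  have g21 : ∀ a, G a 2 1 = -G a 1 2 := fun a ↦ hG a 2 1
  have d10 : ∀ d a, D d a 1 0 = -D d a 0 1 := fun d a ↦ hD d a 1 0
  have d20 : ∀ d a, D d a 2 0 = -D d a 0 2 := fun d a ↦ hD d a 2 0
  have d21 : ∀ d a, D d a 2 1 = -D d a 1 2 := fun d a ↦ hD d a 2 1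
  have k0 : DK 0 = 0 := by
    -- A second Bianchi identity, with the first three indices running cyclically over `0, 1, 2`.
    -- The last pair `1 2` is chosen so that only `DK 0` survives; the pairs `0 2` and `0 1` isolate
    -- `DK 1` and `DK 2` below. The commutators remove the second derivatives, and the remaining
    -- terms are connection components times curvature equations.
    have e0 := hDR 2 0 1 1 2
    have e1 := hDR 0 1 2 1 2
    have e2 := hDR 1 2 0 1 2
    have e3 := hcomm 2 0 1 1 2
    have e4 := hcomm 0 1 2 1 2
    have e5 := hcomm 1 2 0 1 2
    have e6 := hR 0 2 1 2
    have e7 := hR 1 2 0 2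
    have e8 := hR 0 1 1 2
    have e9 := hR 1 2 0 1
    have e10 := hR 0 1 0 2
    have e11 := hR 0 2 0 1
    have e12 := hR 0 2 0 2
    have e13 := hR 1 2 1 2
    have e14 := hR 0 1 0 1
    simp [Fin.sum_univ_three, lorentz, Matrix.diagonal_apply, g0, g10, g20, g21, d0, d10,
      d20, d21] at e0 e1 e2 e3 e4 e5 e6 e7 e8 e9 e10 e11 e12 e13 e14
    linear_combination
      e0 + e1 + e2 - e3 - e4 - e5 - G 0 0 1 * e6 - G 0 0 1 * e7 + G 0 0 2 * e8 + G 0 0 2 * e9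
        + G 0 1 2 * e10 - G 0 1 2 * e11 + G 1 0 1 * e12 + G 1 0 1 * e13 - G 1 0 2 * e11
        - 2 * G 1 1 2 * e8 + G 1 1 2 * e9 - G 2 0 1 * e10 + G 2 0 2 * e14 + G 2 0 2 * e13
        - 2 * G 2 1 2 * e6 + G 2 1 2 * e7
  have k1 : DK 1 = 0 := by
    have e0 := hDR 2 0 1 0 2
    have e1 := hDR 0 1 2 0 2
    have e2 := hDR 1 2 0 0 2
    have e3 := hcomm 2 0 1 0 2
    have e4 := hcomm 0 1 2 0 2
    have e5 := hcomm 1 2 0 0 2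
    have e6 := hR 0 2 0 2
    have e7 := hR 1 2 1 2
    have e8 := hR 0 1 0 2
    have e9 := hR 0 2 0 1
    have e10 := hR 1 2 0 1
    have e11 := hR 0 2 1 2
    have e12 := hR 1 2 0 2
    have e13 := hR 0 1 1 2
    have e14 := hR 0 1 0 1
    simp [Fin.sum_univ_three, lorentz, Matrix.diagonal_apply, g0, g10, g20, g21, d0, d10,
      d20, d21] at e0 e1 e2 e3 e4 e5 e6 e7 e8 e9 e10 e11 e12 e13 e14
    linear_combination
      e0 + e1 + e2 - e3 - e4 - e5 - G 0 0 1 * e6 - G 0 0 1 * e7 + 2 * G 0 0 2 * e8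
        - G 0 0 2 * e9 + G 0 1 2 * e10 + G 1 0 1 * e11 + G 1 0 1 * e12 - G 1 0 2 * e13
        + G 1 0 2 * e10 - G 1 1 2 * e8 - G 1 1 2 * e9 - G 2 0 1 * e13 - G 2 0 2 * e11
        + 2 * G 2 0 2 * e12 + G 2 1 2 * e14 - G 2 1 2 * e6
  have k2 : DK 2 = 0 := by
    have e0 := hDR 2 0 1 0 1
    have e1 := hDR 0 1 2 0 1
    have e2 := hDR 1 2 0 0 1
    have e3 := hcomm 2 0 1 0 1
    have e4 := hcomm 0 1 2 0 1
    have e5 := hcomm 1 2 0 0 1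
    have e6 := hR 0 1 0 2
    have e7 := hR 0 2 0 1
    have e8 := hR 0 1 0 1
    have e9 := hR 1 2 1 2
    have e10 := hR 1 2 0 2
    have e11 := hR 0 1 1 2
    have e12 := hR 1 2 0 1
    have e13 := hR 0 2 1 2
    have e14 := hR 0 2 0 2
    simp [Fin.sum_univ_three, lorentz, Matrix.diagonal_apply, g0, g10, g20, g21, d0, d10,
      d20, d21] at e0 e1 e2 e3 e4 e5 e6 e7 e8 e9 e10 e11 e12 e13 e14
    linear_combination
      -e0 - e1 - e2 + e3 + e4 + e5 - G 0 0 1 * e6 + 2 * G 0 0 1 * e7 - G 0 0 2 * e8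
        - G 0 0 2 * e9 + G 0 1 2 * e10 + G 1 0 1 * e11 - 2 * G 1 0 1 * e12 + G 1 0 2 * e13
        + G 1 1 2 * e8 - G 1 1 2 * e14 + G 2 0 1 * e13 - G 2 0 1 * e10 - G 2 0 2 * e11
        - G 2 0 2 * e12 + G 2 1 2 * e6 + G 2 1 2 * e7
  funext i
  fin_cases i
  · exact k0
  · exact k1
  · exact k2

end SchurAlgebra

theorem lorentz_inv : lorentz⁻¹ = lorentz := by
  apply Matrix.inv_eq_right_inv
  ext i j
  fin_cases i <;> fin_cases j <;> simp [lorentz, Matrix.mul_apply, Fin.sum_univ_three]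

section Schur

variable {n : ℕ} {M : Type*} [TopologicalSpace M]
  [ChartedSpace (EuclideanSpace ℝ (Fin n)) M] [IsManifold (𝓡 n) ∞ M]
  {g : PseudoRiemannianMetric n M} {η : Matrix (Fin n) (Fin n) ℝ}

namespace MovingCoframe

variable (θ : MovingCoframe g η) {x : M}

/-- Structure functions are eliminated and differences written as sums with a factor `-1`, so that
the sum, scalar and product rules for `frameDeriv` suffice to differentiate it. -/
theorem riemann_eq (a b c d : Fin n) (x : M) :
    θ.riemann a b c d x = θ.frameDeriv a (θ.connection b c d) x
      + (-1 : ℝ) * θ.frameDeriv b (θ.connection a c d) x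
      + ∑ m, ∑ l, η⁻¹ m l * (θ.connection b c l x * θ.connection a m d x
        + (-1 : ℝ) * (θ.connection a c l x * θ.connection b m d x)
        + (-1 : ℝ) * ((θ.connection a b l x + (-1 : ℝ) * θ.connection b a l x)
          * θ.connection m c d x)) := by
  rw [riemann]
  simp only [structureFun_eq_connection]
  have h : ∀ m l, η⁻¹ m l * (θ.connection b c l x * θ.connection a m d x
        + (-1 : ℝ) * (θ.connection a c l x * θ.connection b m d x)
        + (-1 : ℝ) * ((θ.connection a b l x + (-1 : ℝ) * θ.connection b a l x)
          * θ.connection m c d x))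
      = η⁻¹ m l * (θ.connection b c l x * θ.connection a m d x
        - θ.connection a c l x * θ.connection b m d x
        - (θ.connection a b l x - θ.connection b a l x) * θ.connection m c d x) := by
    intro m l
    ring
  simp only [h]
  ring

theorem frameDeriv_riemann (hx : x ∈ θ.domain) (f a b c d : Fin n) :
    θ.frameDeriv f (θ.riemann a b c d) x
      = θ.frameDeriv f (θ.frameDeriv a (θ.connection b c d)) x
        - θ.frameDeriv f (θ.frameDeriv b (θ.connection a c d)) x
      + ∑ m, ∑ l, η⁻¹ m l * (θ.frameDeriv f (θ.connection b c l) x * θ.connection a m d x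
        + θ.connection b c l x * θ.frameDeriv f (θ.connection a m d) x
        - (θ.frameDeriv f (θ.connection a c l) x * θ.connection b m d x
        + θ.connection a c l x * θ.frameDeriv f (θ.connection b m d) x)
        - ((θ.frameDeriv f (θ.connection a b l) x - θ.frameDeriv f (θ.connection b a l) x)
            * θ.connection m c d x
          + (θ.connection a b l x - θ.connection b a l x)
            * θ.frameDeriv f (θ.connection m c d) x)) := by
  have hc := fun a b c ↦ θ.contMDiffAt_connection hx a b c
  have hd := fun e a b c ↦ θ.contMDiffAt_frameDeriv hx e (hc a b c)
  have hmul : ∀ {u v : M → ℝ}, ContMDiffAt (𝓡 n) 𝓘(ℝ, ℝ) ∞ u x →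
      ContMDiffAt (𝓡 n) 𝓘(ℝ, ℝ) ∞ v x → ContMDiffAt (𝓡 n) 𝓘(ℝ, ℝ) ∞ (fun y ↦ u y * v y) x :=
    fun hu hv ↦ ContMDiffAt.mul hu hv
  have hadd : ∀ {u v : M → ℝ}, ContMDiffAt (𝓡 n) 𝓘(ℝ, ℝ) ∞ u x →
      ContMDiffAt (𝓡 n) 𝓘(ℝ, ℝ) ∞ v x → ContMDiffAt (𝓡 n) 𝓘(ℝ, ℝ) ∞ (fun y ↦ u y + v y) x :=
    fun hu hv ↦ ContMDiffAt.add hu hv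
  have hcm : ∀ (r : ℝ) {u : M → ℝ}, ContMDiffAt (𝓡 n) 𝓘(ℝ, ℝ) ∞ u x →
      ContMDiffAt (𝓡 n) 𝓘(ℝ, ℝ) ∞ (fun y ↦ r * u y) x :=
    fun r _ hu ↦ ContMDiffAt.mul contMDiffAt_const hu
  have hsum : ∀ {u : Fin n → M → ℝ}, (∀ m, ContMDiffAt (𝓡 n) 𝓘(ℝ, ℝ) ∞ (u m) x) →
      ContMDiffAt (𝓡 n) 𝓘(ℝ, ℝ) ∞ (fun y ↦ ∑ m, u m y) x :=
    fun hu ↦ ContMDiffAt.sum fun m _ ↦ hu m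
  have hq1 := fun m l ↦ hmul (hc b c l) (hc a m d)
  have hq2 := fun m l ↦ hmul (hc a c l) (hc b m d)
  have hs := fun l ↦ hadd (hc a b l) (hcm (-1) (hc b a l))
  have hq3 := fun m l ↦ hmul (hs l) (hc m c d)
  have hq := fun m l ↦ hadd (hadd (hq1 m l) (hcm (-1) (hq2 m l))) (hcm (-1) (hq3 m l))
  have hqs := fun m ↦ hsum fun l ↦ hcm (η⁻¹ m l) (hq m l)
  have h0 : θ.riemann a b c d = _ := funext fun y ↦ θ.riemann_eq a b c d y
  rw [h0, θ.frameDeriv_add (hadd (hd a b c d) (hcm (-1) (hd b a c d))) (hsum hqs),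
    θ.frameDeriv_add (hd a b c d) (hcm (-1) (hd b a c d)),
    θ.frameDeriv_const_mul (hd b a c d), θ.frameDeriv_sum _ fun m _ ↦ hqs m]
  congr 1
  · ring
  refine Finset.sum_congr rfl fun m _ ↦ ?_
  rw [θ.frameDeriv_sum _ fun l _ ↦ hcm (η⁻¹ m l) (hq m l)]
  refine Finset.sum_congr rfl fun l _ ↦ ?_
  rw [θ.frameDeriv_const_mul (hq m l),
    θ.frameDeriv_add (hadd (hq1 m l) (hcm (-1) (hq2 m l))) (hcm (-1) (hq3 m l)),
    θ.frameDeriv_add (hq1 m l) (hcm (-1) (hq2 m l)), θ.frameDeriv_const_mul (hq2 m l),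
    θ.frameDeriv_const_mul (hq3 m l), θ.frameDeriv_mul (hc b c l) (hc a m d),
    θ.frameDeriv_mul (hc a c l) (hc b m d), θ.frameDeriv_mul (hs l) (hc m c d),
    θ.frameDeriv_add (hc a b l) (hcm (-1) (hc b a l)), θ.frameDeriv_const_mul (hc b a l)]
  ring

theorem frameDeriv_connection_swap (hx : x ∈ θ.domain) (d a b c : Fin n) :
    θ.frameDeriv d (θ.connection a b c) x = -θ.frameDeriv d (θ.connection a c b) x := by
  have h : θ.connection a b c = fun y ↦ (-1 : ℝ) * θ.connection a c b y := by
    funext y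
    rw [θ.connection_swap a b c]
    ring
  rw [h, θ.frameDeriv_const_mul (θ.contMDiffAt_connection hx a c b)]
  ring

end MovingCoframe

/-- Schur's lemma in dimension three. -/
theorem MovingCoframe.frameDeriv_eq_zero_of_riemann_eq {M : Type*} [TopologicalSpace M]
    [ChartedSpace (EuclideanSpace ℝ (Fin 3)) M] [IsManifold (𝓡 3) ∞ M]
    {g : PseudoRiemannianMetric 3 M} (θ : MovingCoframe g lorentz) {K : M → ℝ} {x : M}
    (hx : x ∈ θ.domain) (hK : ContMDiffAt (𝓡 3) 𝓘(ℝ, ℝ) ∞ K x)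
    (h : ∀ y ∈ θ.domain, ∀ a b c d, θ.riemann a b c d y
      = K y * (lorentz a d * lorentz b c - lorentz a c * lorentz b d)) (f : Fin 3) :
    θ.frameDeriv f K x = 0 := by
  refine congrFun (schur_algebra (G := fun a b c ↦ θ.connection a b c x)
    (D := fun d a b c ↦ θ.frameDeriv d (θ.connection a b c) x)
    (D2 := fun e d a b c ↦ θ.frameDeriv e (θ.frameDeriv d (θ.connection a b c)) x)
    (K := K x) (DK := fun f ↦ θ.frameDeriv f K x) (fun a b c ↦ θ.connection_swap a b c x)
    (fun d a b c ↦ θ.frameDeriv_connection_swap hx d a b c) ?_ ?_ ?_) f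
  · intro d e a b c
    rw [θ.frameDeriv_comm_eq_sum isUnit_det_lorentz hx d e]
    · refine Finset.sum_congr rfl fun m _ ↦ ?_
      rw [structureCoeff, lorentz_inv, Finset.sum_mul]
      simp only [structureFun_eq_connection]
    · filter_upwards [θ.isOpen_domain.mem_nhds hx] with y hy
      exact θ.contMDiffAt_connection hy a b c
  · intro a b c d
    rw [← h x hx a b c d, riemann, lorentz_inv]
    simp only [structureFun_eq_connection]
  · intro f a b c d
    have h1 : θ.riemann a b c d =ᶠ[𝓝 x] fun y ↦
        (lorentz a d * lorentz b c - lorentz a c * lorentz b d) * K y := by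
      filter_upwards [θ.isOpen_domain.mem_nhds hx] with y hy
      rw [h y hy, mul_comm]
    have h2 := θ.frameDeriv_riemann hx f a b c d
    rw [θ.frameDeriv_congr h1 f, θ.frameDeriv_const_mul hK, lorentz_inv] at h2
    rw [mul_comm, h2]

end Schur

/-! ### Isotropy of three-dimensional curvature tensors -/

section InfinitesimalAction

/-- Product rule at the identity: one factor is differentiated and the others are Kronecker deltas,
so only multi-indices that agree with `i` outside one slot survive. -/
theorem infAct_apply {n p : ℕ} (T : CurvSpace n p) (ξ : Fin n → Fin n → ℝ) (k : Fin (p + 1))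
    (i : Fin (4 + (k : ℕ)) → Fin n) :
    infAct T ξ k i = ∑ s, ∑ m, ξ m (i s) * T k (Function.update i s m) := by
  have h1 : HasFDerivAt (fun X ↦ pullTensor X T) (infAct T) (1 : Matrix (Fin n) (Fin n) ℝ) :=
    (differentiable_pullTensor T _).hasFDerivAt
  have h2 := hasFDerivAt_pi'.1 (hasFDerivAt_pi'.1 h1 k) i
  have h3 : ∀ a b : Fin n, HasFDerivAt (fun X : Fin n → Fin n → ℝ ↦ X a b)
      ((ContinuousLinearMap.proj (R := ℝ) (φ := fun _ : Fin n ↦ ℝ) b).comp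
        (ContinuousLinearMap.proj (R := ℝ) (φ := fun _ : Fin n ↦ Fin n → ℝ) a))
      (1 : Matrix (Fin n) (Fin n) ℝ) := fun a b ↦
    ((ContinuousLinearMap.proj (R := ℝ) (φ := fun _ : Fin n ↦ ℝ) b).comp
        (ContinuousLinearMap.proj (R := ℝ) (φ := fun _ : Fin n ↦ Fin n → ℝ) a)).hasFDerivAt
  have h4 : HasFDerivAt (fun X : Fin n → Fin n → ℝ ↦
      ∑ j : Fin (4 + (k : ℕ)) → Fin n, (∏ s, X (j s) (i s)) * T k j) _
      (1 : Matrix (Fin n) (Fin n) ℝ) :=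
    HasFDerivAt.fun_sum fun j _ ↦
      (HasFDerivAt.finsetProd fun s _ ↦ h3 (j s) (i s)).mul_const (T k j)
  have h5 := congrArg (fun L ↦ L ξ) (h2.unique h4)
  refine h5.trans ?_
  simp only [sum_apply, smul_apply, smul_eq_mul, ContinuousLinearMap.comp_apply,
    ContinuousLinearMap.proj_apply, Finset.mul_sum]
  rw [Finset.sum_comm]
  refine Finset.sum_congr rfl fun s _ ↦ ?_
  symm
  refine Finset.sum_of_injOn (fun m ↦ Function.update i s m)
    (fun m _ m' _ h ↦ by simpa using congrFun h s) (fun _ _ ↦ Finset.mem_coe.2 (Finset.mem_univ _))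
    ?_ ?_
  · intro j _ hj
    have h6 : ∃ s' ∈ Finset.univ.erase s, j s' ≠ i s' := by
      by_contra! hcon
      refine hj ⟨j s, Finset.mem_coe.2 (Finset.mem_univ _), ?_⟩
      funext s'
      by_cases hs : s' = s
      · subst hs
        simp
      · simpa [hs] using (hcon s' (by simp [hs])).symm
    obtain ⟨s', hs', hne⟩ := h6
    have h7 : ∏ s' ∈ Finset.univ.erase s, (1 : Matrix (Fin n) (Fin n) ℝ) (j s') (i s') = 0 :=
      Finset.prod_eq_zero hs' (Matrix.one_apply_ne hne)
    rw [h7]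
    simp
  · intro m _
    have h7 : ∏ s' ∈ Finset.univ.erase s,
        (1 : Matrix (Fin n) (Fin n) ℝ) (Function.update i s m s') (i s') = 1 :=
      Finset.prod_eq_one fun s' hs' ↦ by
        rw [Function.update_of_ne (Finset.ne_of_mem_erase hs'), Matrix.one_apply_eq]
    rw [h7, Function.update_self]
    ring

theorem infAct_zero_apply {n : ℕ} (T : CurvSpace n 0) (ξ : Fin n → Fin n → ℝ) (a b c d : Fin n) :
    infAct T ξ 0 ![a, b, c, d] = ∑ m, (ξ m a * T 0 ![m, b, c, d] + ξ m b * T 0 ![a, m, c, d]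
      + ξ m c * T 0 ![a, b, m, d] + ξ m d * T 0 ![a, b, c, m]) := by
  have h : infAct T ξ 0 ![a, b, c, d] = ∑ s : Fin 4, ∑ m, ξ m ((![a, b, c, d] : Fin 4 → Fin n) s)
      * T 0 (Function.update (![a, b, c, d] : Fin 4 → Fin n) s m) := infAct_apply T ξ 0 ![a, b, c, d]
  rw [h, Fin.sum_univ_four, ← Finset.sum_add_distrib, ← Finset.sum_add_distrib,
    ← Finset.sum_add_distrib]
  refine Finset.sum_congr rfl fun m _ ↦ ?_
  have u0 : Function.update (![a, b, c, d] : Fin 4 → Fin n) 0 m = ![m, b, c, d] := by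
    ext s; fin_cases s <;> rfl
  have u1 : Function.update (![a, b, c, d] : Fin 4 → Fin n) 1 m = ![a, m, c, d] := by
    ext s; fin_cases s <;> rfl
  have u2 : Function.update (![a, b, c, d] : Fin 4 → Fin n) 2 m = ![a, b, m, d] := by
    ext s; fin_cases s <;> rfl
  have u3 : Function.update (![a, b, c, d] : Fin 4 → Fin n) 3 m = ![a, b, c, m] := by
    ext s; fin_cases s <;> rfl
  rw [u0, u1, u2, u3]
  rfl

end InfinitesimalAction

section Isotropy

theorem exists_mem_ne_zero_apply_eq_zero {W : Submodule ℝ (Fin 3 → ℝ)}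
    (hW : 2 ≤ Module.finrank ℝ W) (i : Fin 3) : ∃ w ∈ W, w ≠ 0 ∧ w i = 0 := by
  have h : LinearMap.ker ((LinearMap.proj (R := ℝ) (φ := fun _ : Fin 3 ↦ ℝ) i).comp W.subtype) ≠ ⊥ :=
    LinearMap.ker_ne_bot_of_finrank_lt (by rw [Module.finrank_self]; omega)
  obtain ⟨w, hw, hne⟩ := (Submodule.ne_bot_iff _).1 h
  exact ⟨w.1, w.2, fun h0 ↦ hne (Subtype.ext h0), hw⟩

/-- Gaussian elimination: the three cases are the possible positions of two pivots among three
columns. Dimension three is covered too, since only two vectors of `W` are asserted. -/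
theorem exists_reduced_basis {W : Submodule ℝ (Fin 3 → ℝ)} (hW : 2 ≤ Module.finrank ℝ W) :
    (∃ α β : ℝ, ![1, 0, α] ∈ W ∧ ![0, 1, β] ∈ W) ∨ (∃ α : ℝ, ![1, α, 0] ∈ W ∧ ![0, 0, 1] ∈ W) ∨
      (![0, 1, 0] ∈ W ∧ ![0, 0, 1] ∈ W) := by
  obtain ⟨u, hu, hu0, hui⟩ := exists_mem_ne_zero_apply_eq_zero hW 0
  have hsc : ∀ (w : Fin 3 → ℝ) (r a b c : ℝ), w ∈ W → r * w 0 = a → r * w 1 = b → r * w 2 = c →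
      ![a, b, c] ∈ W := by
    intro w r a b c hw h0 h1 h2
    have h : ![a, b, c] = r • w := by
      ext i
      fin_cases i
      · exact h0.symm
      · exact h1.symm
      · exact h2.symm
    rw [h]
    exact W.smul_mem r hw
  by_cases hu1 : u 1 = 0
  · have hu2 : u 2 ≠ 0 := fun h ↦ hu0 (by ext i; fin_cases i <;> assumption)
    have e2 : ![0, 0, 1] ∈ W :=
      hsc u (u 2)⁻¹ 0 0 1 hu (by rw [hui, mul_zero]) (by rw [hu1, mul_zero]) (inv_mul_cancel₀ hu2)
    obtain ⟨v, hv, hv0, hvi⟩ := exists_mem_ne_zero_apply_eq_zero hW 2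
    by_cases h0 : v 0 = 0
    · have hv1 : v 1 ≠ 0 := fun h ↦ hv0 (by ext i; fin_cases i <;> assumption)
      exact Or.inr (Or.inr ⟨hsc v (v 1)⁻¹ 0 1 0 hv (by rw [h0, mul_zero]) (inv_mul_cancel₀ hv1)
        (by rw [hvi, mul_zero]), e2⟩)
    · exact Or.inr (Or.inl ⟨_, hsc v (v 0)⁻¹ 1 _ 0 hv (inv_mul_cancel₀ h0) rfl
        (by rw [hvi, mul_zero]), e2⟩)
  · have e1 : ![0, 1, (u 1)⁻¹ * u 2] ∈ W :=
      hsc u (u 1)⁻¹ 0 1 _ hu (by rw [hui, mul_zero]) (inv_mul_cancel₀ hu1) rfl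
    obtain ⟨v, hv, hv0, hvi⟩ := exists_mem_ne_zero_apply_eq_zero hW 1
    by_cases h0 : v 0 = 0
    · have hv2 : v 2 ≠ 0 := fun h ↦ hv0 (by ext i; fin_cases i <;> assumption)
      have e2 : ![0, 0, 1] ∈ W := hsc v (v 2)⁻¹ 0 0 1 hv (by rw [h0, mul_zero])
        (by rw [hvi, mul_zero]) (inv_mul_cancel₀ hv2)
      refine Or.inr (Or.inr ⟨?_, e2⟩)
      have h := W.sub_mem e1 (W.smul_mem ((u 1)⁻¹ * u 2) e2)
      convert h using 1
      ext i
      fin_cases i <;> simp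
    · exact Or.inl ⟨_, _, hsc v (v 0)⁻¹ 1 0 _ hv (inv_mul_cancel₀ h0) (by rw [hvi, mul_zero]) rfl,
        e1⟩

/-- A three-dimensional curvature tensor with an isotropy algebra of dimension at least two has
constant curvature. -/
theorem eq_of_two_le_finrank_isotropy {R : Fin 3 → Fin 3 → Fin 3 → Fin 3 → ℝ}
    (h1 : ∀ a b c d, R a b c d = -R b a c d) (h2 : ∀ a b c d, R a b c d = -R a b d c)
    {W : Submodule ℝ (Fin 3 → ℝ)} (hW : 2 ≤ Module.finrank ℝ W)
    (hk : ∀ w ∈ W, ∀ a b c d, ∑ m, (lorentzAlg w m a * R m b c d + lorentzAlg w m b * R a m c d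
      + lorentzAlg w m c * R a b m d + lorentzAlg w m d * R a b c m) = 0) (a b c d : Fin 3) :
    R a b c d = R 0 1 0 1 * (lorentz a d * lorentz b c - lorentz a c * lorentz b d) := by
  have l0 : ∀ a c d, R a a c d = 0 := fun a c d ↦ self_eq_neg.1 (h1 a a c d)
  have r0 : ∀ a b c, R a b c c = 0 := fun a b c ↦ self_eq_neg.1 (h2 a b c c)
  have l10 : ∀ c d, R 1 0 c d = -R 0 1 c d := h1 1 0
  have l20 : ∀ c d, R 2 0 c d = -R 0 2 c d := h1 2 0
  have l21 : ∀ c d, R 2 1 c d = -R 1 2 c d := h1 2 1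
  have r10 : ∀ a b, R a b 1 0 = -R a b 0 1 := fun a b ↦ h2 a b 1 0
  have r20 : ∀ a b, R a b 2 0 = -R a b 0 2 := fun a b ↦ h2 a b 2 0
  have r21 : ∀ a b, R a b 2 1 = -R a b 1 2 := fun a b ↦ h2 a b 2 1
  -- The invariance equations on the bivectors `01`, `02`, `12`, as nine linear relations. Neither
  -- pair symmetry nor the first Bianchi identity is assumed, so the nine components are unrelated a
  -- priori.
  have key : ∀ w0 w1 w2 : ℝ, ![w0, w1, w2] ∈ W →
      -w2 * R 0 2 0 1 - w1 * R 1 2 0 1 + (-w2 * R 0 1 0 2 - w1 * R 0 1 1 2) = 0 ∧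
      -w2 * R 0 2 0 2 - w1 * R 1 2 0 2 + (w2 * R 0 1 0 1 + w0 * R 0 1 1 2) = 0 ∧
      -w2 * R 0 2 1 2 - w1 * R 1 2 1 2 + (-w1 * R 0 1 0 1 + w0 * R 0 1 0 2) = 0 ∧
      w2 * R 0 1 0 1 + w0 * R 1 2 0 1 + (-w2 * R 0 2 0 2 - w1 * R 0 2 1 2) = 0 ∧
      w2 * R 0 1 0 2 + w0 * R 1 2 0 2 + (w2 * R 0 2 0 1 + w0 * R 0 2 1 2) = 0 ∧
      w2 * R 0 1 1 2 + w0 * R 1 2 1 2 + (-w1 * R 0 2 0 1 + w0 * R 0 2 0 2) = 0 ∧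
      -w1 * R 0 1 0 1 + w0 * R 0 2 0 1 + (-w2 * R 1 2 0 2 - w1 * R 1 2 1 2) = 0 ∧
      -w1 * R 0 1 0 2 + w0 * R 0 2 0 2 + (w2 * R 1 2 0 1 + w0 * R 1 2 1 2) = 0 ∧
      -w1 * R 0 1 1 2 + w0 * R 0 2 1 2 + (-w1 * R 1 2 0 1 + w0 * R 1 2 0 2) = 0 := by
    intro w0 w1 w2 hw
    have h := hk _ hw
    have e1 := h 0 1 0 1
    have e2 := h 0 1 0 2
    have e3 := h 0 1 1 2
    have e4 := h 0 2 0 1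
    have e5 := h 0 2 0 2
    have e6 := h 0 2 1 2
    have e7 := h 1 2 0 1
    have e8 := h 1 2 0 2
    have e9 := h 1 2 1 2
    simp [Fin.sum_univ_three, lorentzAlg, l0, r0, l10, l21, r10, r21]
      at e1 e2 e3 e4 e5 e6 e7 e8 e9
    refine ⟨?_, ?_, ?_, ?_, ?_, ?_, ?_, ?_, ?_⟩ <;> linarith
  -- Two independent isotropy vectors in reduced form leave only one free component. It is the
  -- constant curvature itself, since the model tensor has value `1` at `0 1 0 1`.
  have hq : R 0 1 0 2 = 0 ∧ R 0 1 1 2 = 0 ∧ R 0 2 0 1 = 0 ∧ R 0 2 1 2 = 0 ∧ R 1 2 0 1 = 0 ∧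
      R 1 2 0 2 = 0 ∧ R 0 2 0 2 = R 0 1 0 1 ∧ R 1 2 1 2 = -R 0 1 0 1 := by
    clear hk h1 h2 l0 r0 l10 l20 l21 r10 r20 r21
    rcases exists_reduced_basis hW with ⟨α, β, hu, hv⟩ | ⟨α, hu, hv⟩ | ⟨hu, hv⟩
    all_goals
      have k1 := key _ _ _ hu
      have k2 := key _ _ _ hv
      clear key hu hv hW
      simp only [zero_mul, one_mul, neg_zero, zero_add, add_zero, sub_zero, neg_mul] at k1 k2
      obtain ⟨a1, a2, a3, a4, a5, a6, a7, a8, a9⟩ := k1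
      obtain ⟨b1, b2, b3, b4, b5, b6, b7, b8, b9⟩ := k2
      grind
  obtain ⟨q1, q2, q3, q4, q5, q6, q7, q8⟩ := hq
  fin_cases a <;> fin_cases b <;> fin_cases c <;> fin_cases d <;>
    simp [l0, r0, l10, l20, l21, r10, r20, r21, q1, q2, q3, q4, q5, q6, q7, q8, lorentz]

/-- Constant curvature tensors are invariant. -/
theorem sum_lorentzAlg_eq_zero (w : Fin 3 → ℝ) (a b c d : Fin 3) :
    ∑ m, (lorentzAlg w m a * (lorentz m d * lorentz b c - lorentz m c * lorentz b d)
      + lorentzAlg w m b * (lorentz a d * lorentz m c - lorentz a c * lorentz m d)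
      + lorentzAlg w m c * (lorentz a d * lorentz b m - lorentz a m * lorentz b d)
      + lorentzAlg w m d * (lorentz a m * lorentz b c - lorentz a c * lorentz b m)) = 0 := by
  have h : ∀ i j, ∑ m, (lorentzAlg w m i * lorentz m j + lorentzAlg w m j * lorentz i m) = 0 := by
    intro i j
    fin_cases i <;> fin_cases j <;> simp [Fin.sum_univ_three, lorentzAlg, lorentz]
  have h1 : ∀ m, (lorentzAlg w m a * (lorentz m d * lorentz b c - lorentz m c * lorentz b d)
      + lorentzAlg w m b * (lorentz a d * lorentz m c - lorentz a c * lorentz m d)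
      + lorentzAlg w m c * (lorentz a d * lorentz b m - lorentz a m * lorentz b d)
      + lorentzAlg w m d * (lorentz a m * lorentz b c - lorentz a c * lorentz b m))
      = lorentz b c * (lorentzAlg w m a * lorentz m d + lorentzAlg w m d * lorentz a m)
        - lorentz b d * (lorentzAlg w m a * lorentz m c + lorentzAlg w m c * lorentz a m)
        + lorentz a d * (lorentzAlg w m b * lorentz m c + lorentzAlg w m c * lorentz b m)
        - lorentz a c * (lorentzAlg w m b * lorentz m d + lorentzAlg w m d * lorentz b m) :=
    fun m ↦ by ring
  simp only [h1, Finset.sum_add_distrib (f := fun m ↦ _ - _), Finset.sum_sub_distrib,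
    ← Finset.mul_sum, h]
  ring

end Isotropy

/-! ### Frame freedom of dimension two or more makes the curvature map locally trivial -/

section ConstantCurvature

variable {M : Type*} [TopologicalSpace M]
  [ChartedSpace (EuclideanSpace ℝ (Fin 3)) M] [IsManifold (𝓡 3) ∞ M]
  {g : PseudoRiemannianMetric 3 M}

namespace MovingCoframe

variable (θ : MovingCoframe g lorentz) {x : M}

theorem riemann_swap_left (a b c d : Fin 3) (x : M) :
    θ.riemann a b c d x = -θ.riemann b a c d x := by
  rw [riemann_eq, riemann_eq, neg_add, ← Finset.sum_neg_distrib]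
  congr 1
  · ring
  · refine Finset.sum_congr rfl fun m _ ↦ ?_
    rw [← Finset.sum_neg_distrib]
    refine Finset.sum_congr rfl fun l _ ↦ ?_
    ring

theorem riemann_swap_right (hx : x ∈ θ.domain) (a b c d : Fin 3) :
    θ.riemann a b c d x = -θ.riemann a b d c x := by
  rw [riemann_eq, riemann_eq, lorentz_inv, θ.frameDeriv_connection_swap hx a b c d,
    θ.frameDeriv_connection_swap hx b a c d]
  have h : ∀ (e : Fin 3) (i j : Fin 3), θ.connection e i j x = -θ.connection e j i x :=
    fun e i j ↦ θ.connection_swap e i j x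
  have h0 : ∀ e i, θ.connection e i i x = 0 := fun e i ↦ self_eq_neg.1 (h e i i)
  simp only [Fin.sum_univ_three, h _ 0 c, h _ 1 c, h _ 2 c, h _ 0 d, h _ 1 d, h _ 2 d]
  simp only [h _ d c]
  simp [lorentz]
  ring

/-- The isotropy lemma puts the curvature in the form `K` times the model tensor on the whole
domain. Schur's lemma gives `dK = 0`, so the horizontal part vanishes, and invariance of the model
tensor kills the vertical part. -/
theorem liftRank_zero_eq_zero (h : ∀ y ∈ θ.domain,
      2 ≤ Module.finrank ℝ (stabAlg lorentz (θ.curvature 0 y))) (hx : x ∈ θ.domain) :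
    θ.liftRank 0 x (1 : Matrix (Fin 3) (Fin 3) ℝ) = 0 := by
  have hform : ∀ y ∈ θ.domain, ∀ a b c d, θ.riemann a b c d y = θ.riemann 0 1 0 1 y
      * (lorentz a d * lorentz b c - lorentz a c * lorentz b d) := by
    intro y hy
    let W := (stabAlg lorentz (θ.curvature 0 y)).comap lorentzAlg
    have hW : W.map lorentzAlg = stabAlg lorentz (θ.curvature 0 y) := by
      rw [Submodule.map_comap_eq, range_lorentzAlg]
      exact inf_eq_right.2 inf_le_left
    have hW2 : 2 ≤ Module.finrank ℝ W := by
      refine (h y hy).trans ?_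
      rw [← hW]
      exact Submodule.finrank_map_le lorentzAlg W
    refine eq_of_two_le_finrank_isotropy (R := fun a b c d ↦ θ.riemann a b c d y)
      (fun a b c d ↦ θ.riemann_swap_left a b c d y) (fun a b c d ↦ θ.riemann_swap_right hy a b c d)
      hW2 ?_
    intro w hw a b c d
    have h1 : infAct (θ.curvature 0 y) (lorentzAlg w) = 0 := hw.2
    have h2 := infAct_zero_apply (θ.curvature 0 y) (lorentzAlg w) a b c d
    rw [h1] at h2
    exact h2.symm
  have hsmooth : ContMDiffAt (𝓡 3) 𝓘(ℝ, ℝ) ∞ (θ.riemann 0 1 0 1) x :=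
    θ.contMDiffAt_riemann hx 0 1 0 1
  have hcurv : θ.curvDeriv 0 x = 0 := by
    have hK := (hsmooth.mdifferentiableAt (by simp)).hasMFDerivAt
    have hK0 : mfderiv (𝓡 3) 𝓘(ℝ, ℝ) (θ.riemann 0 1 0 1) x = 0 := by
      ext v
      rw [← θ.sum_coord_frame isUnit_det_lorentz hx v, map_sum]
      refine Finset.sum_eq_zero fun m _ ↦ ?_
      rw [map_smul]
      have h1 : mfderiv (𝓡 3) 𝓘(ℝ, ℝ) (θ.riemann 0 1 0 1) x (θ.frame m x) = (0 : ℝ) :=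
        θ.frameDeriv_eq_zero_of_riemann_eq hx hsmooth hform m
      rw [h1]
      exact (smul_zero (θ.coord m x v) : θ.coord m x v • (0 : ℝ) = 0)
    let E : CurvSpace 3 0 := fun _ i ↦ lorentz (i 0) (i 3) * lorentz (i 1) (i 2)
      - lorentz (i 0) (i 2) * lorentz (i 1) (i 3)
    let L : ℝ →L[ℝ] CurvSpace 3 0 := (1 : ℝ →L[ℝ] ℝ).smulRight E
    have h1 : HasMFDerivAt (𝓡 3) 𝓘(ℝ, CurvSpace 3 0) (fun y ↦ L (θ.riemann 0 1 0 1 y)) x _ :=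
      HasMFDerivAt.comp x L.hasMFDerivAt hK
    have h2 : θ.curvature 0 =ᶠ[𝓝 x] fun y ↦ L (θ.riemann 0 1 0 1 y) := by
      filter_upwards [θ.isOpen_domain.mem_nhds hx] with y hy
      funext k i
      obtain rfl : k = 0 := Fin.fin_one_eq_zero k
      exact hform y hy _ _ _ _
    rw [hK0] at h1
    have h3 := hasMFDerivAt_unique (θ.hasMFDerivAt_curvature hx 0) (h1.congr_of_eventuallyEq h2)
    exact h3.trans (ContinuousLinearMap.comp_zero L)
  have hinf : (orthTangent lorentz 1).map (infAct (θ.curvature 0 x)).toLinearMap = ⊥ := by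
    rw [eq_bot_iff]
    rintro _ ⟨A, hA, rfl⟩
    have hA' : A ∈ LinearMap.range lorentzAlg := range_lorentzAlg ▸ hA
    obtain ⟨w, rfl⟩ := hA'
    rw [Submodule.mem_bot]
    funext k i
    obtain rfl : k = 0 := Fin.fin_one_eq_zero k
    have hi : i = (![i 0, i 1, i 2, i 3] : Fin 4 → Fin 3) := by
      ext s
      fin_cases s <;> rfl
    rw [hi]
    refine (infAct_zero_apply _ _ _ _ _ _).trans ?_
    have hv : ∀ a b c d, θ.curvature 0 x 0 ![a, b, c, d] = θ.riemann 0 1 0 1 x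
      * (lorentz a d * lorentz b c - lorentz a c * lorentz b d) := hform x hx
    have h1 := sum_lorentzAlg_eq_zero w (i 0) (i 1) (i 2) (i 3)
    have h2 := congrArg (fun r ↦ θ.riemann 0 1 0 1 x * r) h1
    rw [mul_zero, Finset.mul_sum] at h2
    refine Eq.trans (Finset.sum_congr rfl fun m _ ↦ ?_) h2
    simp only [hv]
    ring
  rw [θ.liftRank_one hx, hcurv, hinf]
  simp

end MovingCoframe

end ConstantCurvature

/-! ### Dependence on the order, and the dimension count -/

section Truncation

/-- The projection `𝓡^(p+1) → 𝓡^p`. -/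
def truncate (n p : ℕ) : CurvSpace n (p + 1) →L[ℝ] CurvSpace n p :=
  ContinuousLinearMap.pi fun k ↦
    ContinuousLinearMap.proj (R := ℝ) (φ := fun k : Fin (p + 2) ↦ (Fin (4 + (k : ℕ)) → Fin n) → ℝ)
      k.castSucc

theorem infAct_truncate {n p : ℕ} (T : CurvSpace n (p + 1)) (ξ : Fin n → Fin n → ℝ) :
    infAct (truncate n p T) ξ = truncate n p (infAct T ξ) := by
  funext k i
  rw [infAct_apply]
  exact (infAct_apply T ξ k.castSucc i).symm

theorem stabAlg_le_stabAlg_truncate {n p : ℕ} (η : Matrix (Fin n) (Fin n) ℝ)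
    (T : CurvSpace n (p + 1)) : stabAlg η T ≤ stabAlg η (truncate n p T) := by
  rintro ξ ⟨h1, h2⟩
  refine ⟨h1, (infAct_truncate T ξ).trans ?_⟩
  have h3 : infAct T ξ = 0 := h2
  rw [h3, map_zero]

end Truncation

section Rank

variable {n : ℕ} {M : Type*} [TopologicalSpace M]
  [ChartedSpace (EuclideanSpace ℝ (Fin n)) M] [IsManifold (𝓡 n) ∞ M]
  {g : PseudoRiemannianMetric n M} {η : Matrix (Fin n) (Fin n) ℝ}

namespace MovingCoframe

variable (θ : MovingCoframe g η) {x : M} {p : ℕ}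

theorem curvDeriv_succ (hx : x ∈ θ.domain) (p : ℕ) :
    θ.curvDeriv p x = (truncate n p).comp (θ.curvDeriv (p + 1) x) := by
  have h1 : HasMFDerivAt (𝓡 n) 𝓘(ℝ, CurvSpace n p)
      (fun y ↦ truncate n p (θ.curvature (p + 1) y)) x _ :=
    HasMFDerivAt.comp x (truncate n p).hasMFDerivAt (θ.hasMFDerivAt_curvature hx (p + 1))
  exact hasMFDerivAt_unique (θ.hasMFDerivAt_curvature hx p) h1

theorem liftRank_one_le_succ (hx : x ∈ θ.domain) (p : ℕ) :
    θ.liftRank p x (1 : Matrix (Fin n) (Fin n) ℝ)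
      ≤ θ.liftRank (p + 1) x (1 : Matrix (Fin n) (Fin n) ℝ) := by
  rw [θ.liftRank_one hx, θ.liftRank_one hx]
  have h : LinearMap.range (θ.curvDeriv p x).toLinearMap ⊔
      (orthTangent η 1).map (infAct (θ.curvature p x)).toLinearMap
      = (LinearMap.range (θ.curvDeriv (p + 1) x).toLinearMap ⊔
        (orthTangent η 1).map (infAct (θ.curvature (p + 1) x)).toLinearMap).map
          (truncate n p).toLinearMap := by
    have h1 : (infAct (θ.curvature p x)).toLinearMap
        = (truncate n p).toLinearMap.comp (infAct (θ.curvature (p + 1) x)).toLinearMap :=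
      LinearMap.ext fun ξ ↦ infAct_truncate (θ.curvature (p + 1) x) ξ
    rw [Submodule.map_sup, ← LinearMap.range_comp, h1, Submodule.map_comp, θ.curvDeriv_succ hx]
    rfl
  rw [h]
  exact Submodule.finrank_map_le _ _

theorem liftRank_one_le (hx : x ∈ θ.domain) (p : ℕ) :
    θ.liftRank p x (1 : Matrix (Fin n) (Fin n) ℝ) ≤ n + Module.finrank ℝ (orthTangent η 1) := by
  rw [θ.liftRank_one hx]
  refine (Submodule.finrank_add_le_finrank_add_finrank _ _).trans (add_le_add ?_ ?_)
  · simpa using LinearMap.finrank_range_le (θ.curvDeriv p x).toLinearMap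
  · exact Submodule.finrank_map_le _ _

/-- Infinitesimal orbit-stabilizer formula, that is, rank-nullity for the action restricted to the
Lie algebra. -/
theorem finrank_map_infAct_add (η : Matrix (Fin n) (Fin n) ℝ) (T : CurvSpace n p) :
    Module.finrank ℝ ((orthTangent η 1).map (infAct T).toLinearMap)
      + Module.finrank ℝ (stabAlg η T) = Module.finrank ℝ (orthTangent η 1) := by
  have h := LinearMap.finrank_range_add_finrank_ker
    ((infAct T).toLinearMap.domRestrict (orthTangent η 1))
  rw [LinearMap.range_domRestrict] at h
  rw [← h]
  congr 1
  have h2 : stabAlg η T = (LinearMap.ker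
      ((infAct T).toLinearMap.domRestrict (orthTangent η 1))).map (orthTangent η 1).subtype := by
    ext ξ
    constructor
    · rintro ⟨h1, h2⟩
      exact ⟨⟨ξ, h1⟩, h2, rfl⟩
    · rintro ⟨ζ, h2, rfl⟩
      exact ⟨ζ.2, h2⟩
  rw [h2, Submodule.finrank_map_subtype_eq]

/-- Disjointness makes the sum of horizontal and vertical parts direct, and the orbit-stabilizer
formula replaces the vertical dimension. -/
theorem liftRank_one_add_finrank_stabAlg (hx : x ∈ θ.domain)
    (hdisj : Disjoint (LinearMap.range (θ.curvDeriv p x).toLinearMap)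
      ((orthTangent η 1).map (infAct (θ.curvature p x)).toLinearMap)) :
    θ.liftRank p x (1 : Matrix (Fin n) (Fin n) ℝ)
      + Module.finrank ℝ (stabAlg η (θ.curvature p x))
      = θ.curvatureRank p x + Module.finrank ℝ (orthTangent η 1) := by
  have h := Submodule.finrank_sup_add_finrank_inf_eq
    (LinearMap.range (θ.curvDeriv p x).toLinearMap)
    ((orthTangent η 1).map (infAct (θ.curvature p x)).toLinearMap)
  rw [hdisj.eq_bot, finrank_bot, add_zero] at h
  rw [θ.liftRank_one hx, h, add_assoc, finrank_map_infAct_add, curvatureRank_eq]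

theorem finrank_stabAlg_curvature_le (θ θ' : MovingCoframe g η) (hdet : IsUnit η.det)
    (hx : x ∈ θ.domain) (hx' : x ∈ θ'.domain) (p : ℕ) :
    Module.finrank ℝ (stabAlg η (θ'.curvature p x))
      ≤ Module.finrank ℝ (stabAlg η (θ.curvature p x)) := by
  have hX := θ.transition_mem_orth (θ' := θ') hdet hx hx'
  obtain ⟨Y, -, hY⟩ := exists_orthGroup_eq hdet hX
  rw [curvature_transition hdet hx hx' p]
  refine finrank_stabAlg_pullTensor_le hX (Y := ((Y⁻¹ : GL (Fin n) ℝ) : Matrix (Fin n) (Fin n) ℝ)) ?_ _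
  rw [← hY]
  exact Units.mul_inv Y

end MovingCoframe

theorem HasRank.eq_liftRank_one {p r : ℕ} (h : HasRank g η p r) (θ : MovingCoframe g η) {x : M}
    (hx : x ∈ θ.domain) : θ.liftRank p x (1 : Matrix (Fin n) (Fin n) ℝ) = r :=
  h θ x hx 1 (one_mem _)

namespace IsNormalizingCrossSection

variable {p : ℕ} {S : Set (CurvSpace n p)} {G : Subgroup (GL (Fin n) ℝ)}

/-- (N1) gives one inclusion; (N2) applied to a group element fixing `T` gives the other. The
inverses appear because `act` pulls back by the inverse matrix. -/
theorem mem_iff (h : IsNormalizingCrossSection g η p S G) {T : CurvSpace n p} (hT : T ∈ S)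
    (X : GL (Fin n) ℝ) :
    X ∈ G ↔ X ∈ orthGroup η ∧ pullTensor (X : Matrix (Fin n) (Fin n) ℝ) T = T := by
  have hact : act X⁻¹ T = pullTensor (X : Matrix (Fin n) (Fin n) ℝ) T := by
    rw [act, inv_inv]
  constructor
  · intro hX
    exact ⟨h.le_orthGroup hX, hact ▸ h.fixes _ (inv_mem hX) T hT⟩
  · rintro ⟨hX, hXT⟩
    refine inv_mem_iff.1 (h.maximal _ (inv_mem hX) ⟨T, ⟨T, hT, ?_⟩, hT⟩)
    rw [hact, hXT]

/-- An orbit meets the cross-section at most once: (N2) puts the connecting element in `G`, and (N1)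
says that it fixes the point. -/
theorem eq_of_pullTensor_eq (h : IsNormalizingCrossSection g η p S G) (hdet : IsUnit η.det)
    {T T' : CurvSpace n p} (hT : T ∈ S) (hT' : T' ∈ S) {X : Matrix (Fin n) (Fin n) ℝ}
    (hX : Xᵀ * η * X = η) (hXT : pullTensor X T' = T) : T' = T := by
  obtain ⟨Y, hY, rfl⟩ := exists_orthGroup_eq hdet hX
  have hact : act Y⁻¹ T' = T := by
    rw [act, inv_inv, hXT]
  have hG := h.maximal _ (inv_mem hY) ⟨T, ⟨T', hT', hact⟩, hT⟩
  rw [← hact, h.fixes _ hG T' hT']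

theorem groupDim_eq (h : IsNormalizingCrossSection g η p S G) {T : CurvSpace n p} (hT : T ∈ S) :
    groupDim G = Module.finrank ℝ (stabAlg η T) :=
  groupDim_eq_finrank_stabAlg (h.mem_iff hT)

theorem rank_add_groupDim (h : IsNormalizingCrossSection g η p S G) (hdet : IsUnit η.det) {r : ℕ}
    (hr : HasRank g η p r) {θ : MovingCoframe g η} (hθ : ∀ y ∈ θ.domain, θ.curvature p y ∈ S)
    {x : M} (hx : x ∈ θ.domain) :
    r + groupDim G = θ.curvatureRank p x + Module.finrank ℝ (orthTangent η 1) := by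
  rw [h.groupDim_eq (hθ x hx), ← hr.eq_liftRank_one θ hx]
  refine θ.liftRank_one_add_finrank_stabAlg hx (θ.disjoint_range_curvDeriv hdet (r := r)
    (fun y hy X hX ↦ hr θ y hy X hX) (fun y hy y' hy' X hX hXT ↦ ?_) hx)
  exact h.eq_of_pullTensor_eq hdet (hθ y hy) (hθ y' hy') hX hXT

theorem groupDim_eq_groupDim [Nonempty M] (h : IsNormalizingCrossSection g η p S G)
    (hdet : IsUnit η.det) {S' : Set (CurvSpace n p)} {G' : Subgroup (GL (Fin n) ℝ)}
    (h' : IsNormalizingCrossSection g η p S' G') : groupDim G = groupDim G' := by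
  obtain ⟨x⟩ := ‹Nonempty M›
  obtain ⟨θ, hx, hθ⟩ := h.cover x
  obtain ⟨θ', hx', hθ'⟩ := h'.cover x
  rw [h.groupDim_eq (hθ x hx), h'.groupDim_eq (hθ' x hx')]
  exact le_antisymm (MovingCoframe.finrank_stabAlg_curvature_le θ' θ hdet hx' hx p)
    (MovingCoframe.finrank_stabAlg_curvature_le θ θ' hdet hx hx' p)

/-- A coframe normalizing at order `p + 1` need not normalize at order `p`. The two are compared at
a common point, where changing the coframe only conjugates the stabilizer and truncation enlarges
it. -/
theorem groupDim_succ_le [Nonempty M] (h : IsNormalizingCrossSection g η p S G)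
    (hdet : IsUnit η.det) {S' : Set (CurvSpace n (p + 1))} {G' : Subgroup (GL (Fin n) ℝ)}
    (h' : IsNormalizingCrossSection g η (p + 1) S' G') : groupDim G' ≤ groupDim G := by
  obtain ⟨x⟩ := ‹Nonempty M›
  obtain ⟨θ, hx, hθ⟩ := h.cover x
  obtain ⟨θ', hx', hθ'⟩ := h'.cover x
  rw [h.groupDim_eq (hθ x hx), h'.groupDim_eq (hθ' x hx')]
  refine le_trans ?_ (MovingCoframe.finrank_stabAlg_curvature_le θ θ' hdet hx hx' p)
  exact Submodule.finrank_mono (stabAlg_le_stabAlg_truncate η (θ'.curvature (p + 1) x))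

end IsNormalizingCrossSection

end Rank

/-! ### Independence of the choice of cross-section and coframe -/

section FrameFreedom

variable {n : ℕ} {M : Type*} [TopologicalSpace M]
  [ChartedSpace (EuclideanSpace ℝ (Fin n)) M] [IsManifold (𝓡 n) ∞ M]
  {g : PseudoRiemannianMetric n M} {η : Matrix (Fin n) (Fin n) ℝ}

theorem MovingCoframe.curvatureRank_le (θ : MovingCoframe g η) (p : ℕ) (x : M) :
    θ.curvatureRank p x ≤ n := by
  rw [θ.curvatureRank_eq]
  simpa using LinearMap.finrank_range_le (θ.curvDeriv p x).toLinearMap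

namespace IsNormalizingCrossSection

variable {p : ℕ} {S : Set (CurvSpace n p)} {G : Subgroup (GL (Fin n) ℝ)}

theorem hasFrameFreedom [Nonempty M] (h : IsNormalizingCrossSection g η p S G)
    (hdet : IsUnit η.det) : HasFrameFreedom g η p (groupDim G) :=
  ⟨⟨S, G, h⟩, fun _ _ h' ↦ h'.groupDim_eq_groupDim hdet h⟩

/-- The rank identity determines `t_p` from `r_p` and `s_p`, and neither of these depends on the
choices. -/
theorem hasHorizontalRank [Nonempty M] (h : IsNormalizingCrossSection g η p S G)
    (hdet : IsUnit η.det) {r t : ℕ} (hr : HasRank g η p r)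
    (ht : r + groupDim G = t + Module.finrank ℝ (orthTangent η 1)) :
    HasHorizontalRank g η p t := by
  refine ⟨⟨S, G, h⟩, fun S' G' h' θ hθ x hx ↦ ?_⟩
  have h1 := h'.rank_add_groupDim hdet hr hθ hx
  rw [h'.groupDim_eq_groupDim hdet h, ht] at h1
  exact (Nat.add_right_cancel h1).symm

theorem exists_rank_add_groupDim [Nonempty M] (h : IsNormalizingCrossSection g η p S G)
    (hdet : IsUnit η.det) {r : ℕ} (hr : HasRank g η p r) :
    ∃ t ≤ n, r + groupDim G = t + Module.finrank ℝ (orthTangent η 1) := by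
  obtain ⟨x⟩ := ‹Nonempty M›
  obtain ⟨θ, hx, hθ⟩ := h.cover x
  exact ⟨_, θ.curvatureRank_le p x, h.rank_add_groupDim hdet hr hθ hx⟩

end IsNormalizingCrossSection

end FrameFreedom

/-! ### The bound on frame freedom and the final rank arithmetic -/

section Lorentz

variable {M : Type*} [TopologicalSpace M]
  [ChartedSpace (EuclideanSpace ℝ (Fin 3)) M] [IsManifold (𝓡 3) ∞ M]
  {g : PseudoRiemannianMetric 3 M}

/-- A three-dimensional Lorentz manifold whose curvature has a frame freedom of dimension at least
two has constant curvature. -/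
theorem IsNormalizingCrossSection.groupDim_le_one [Nonempty M] {S : Set (CurvSpace 3 0)}
    {G : Subgroup (GL (Fin 3) ℝ)} (h : IsNormalizingCrossSection g lorentz 0 S G) {r : ℕ}
    (hr : HasRank g lorentz 0 r) (hr0 : r ≠ 0) : groupDim G ≤ 1 := by
  by_contra! hG
  obtain ⟨x⟩ := ‹Nonempty M›
  obtain ⟨θ, hx, hθ⟩ := h.cover x
  refine hr0 ((hr.eq_liftRank_one θ hx).symm.trans (θ.liftRank_zero_eq_zero (fun y hy ↦ ?_) hx))
  rw [← h.groupDim_eq (hθ y hy)]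
  exact hG

end Lorentz

end LorentzOrder

end

theorem mainTheorem5 {M : Type*} [TopologicalSpace M]
    [ChartedSpace (EuclideanSpace ℝ (Fin 3)) M] [IsManifold (𝓡 3) ∞ M] [Nonempty M]
    (g : LorentzOrder.PseudoRiemannianMetric 3 M)
    (hsig : g.HasSignature LorentzOrder.lorentz)
    (hfull : LorentzOrder.FullyRegular g LorentzOrder.lorentz)
    (hcurv : LorentzOrder.CurvatureRegular g LorentzOrder.lorentz)
    (hord : LorentzOrder.HasOrder g LorentzOrder.lorentz 4) :
    (∀ p : Fin 6, LorentzOrder.HasRank g LorentzOrder.lorentz p (![2, 3, 4, 5, 6, 6] p)) ∧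
      (LorentzOrder.IsProperlyCH g LorentzOrder.lorentz 1 ∨
        (LorentzOrder.IsProperlyCH g LorentzOrder.lorentz 0 ∧
          LorentzOrder.HasPseudoStabilization g LorentzOrder.lorentz 1)) := by
  obtain ⟨q, hstab, h4⟩ := hord
  obtain rfl : q = 5 := by omega
  obtain ⟨r, hr, hq⟩ := id hstab
  choose S G hS using hcurv
  have hdet := LorentzOrder.isUnit_det_lorentz
  have hdim := LorentzOrder.finrank_orthTangent_lorentz
  obtain ⟨θ, x, hx⟩ : ∃ θ : LorentzOrder.MovingCoframe g LorentzOrder.lorentz, ∃ x, x ∈ θ.domain := by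
    obtain ⟨x⟩ := ‹Nonempty M›
    obtain ⟨θ, hx, -⟩ := (hS 0).cover x
    exact ⟨θ, x, hx⟩
  have hmono : ∀ p, r p ≤ r (p + 1) := by
    intro p
    rw [← (hr p).eq_liftRank_one θ hx, ← (hr (p + 1)).eq_liftRank_one θ hx]
    exact θ.liftRank_one_le_succ hx p
  -- Three dimensions of `M` plus three of the Lorentz group.
  have hle : r 5 ≤ 6 := by
    rw [← (hr 5).eq_liftRank_one θ hx]
    exact (θ.liftRank_one_le hx 5).trans (by rw [hdim])
  -- Minimality of the stabilization index. The case `m = 0` compares with `r_{-1} = 0` and so says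
  -- that the curvature map is not of rank zero, which is what the bound `s_0 ≤ 1` needs.
  have hne : ∀ m < 5, LorentzOrder.prevRank r m ≠ r m := fun m hm h ↦
    absurd (hq.2 h) (not_le.2 hm)
  have n0 : 0 ≠ r 0 := hne 0 (by norm_num)
  have n1 : r 0 ≠ r 1 := hne 1 (by norm_num)
  have n2 : r 1 ≠ r 2 := hne 2 (by norm_num)
  have n3 : r 2 ≠ r 3 := hne 3 (by norm_num)
  have n4 : r 3 ≠ r 4 := hne 4 (by norm_num)
  have n5 : r 4 = r 5 := hq.1
  have m0 : r 0 ≤ r 1 := hmono 0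
  have m1 : r 1 ≤ r 2 := hmono 1
  have m2 : r 2 ≤ r 3 := hmono 2
  have m3 : r 3 ≤ r 4 := hmono 3
  have ht : ∀ p, ∃ t ≤ 3, r p + LorentzOrder.groupDim (G p) = t + 3 := by
    intro p
    have h := (hS p).exists_rank_add_groupDim hdet (hr p)
    rwa [hdim] at h
  have hs0 := (hS 0).groupDim_le_one (hr 0) n0.symm
  obtain ⟨t0, -, ht0⟩ := ht 0
  obtain ⟨t1, -, ht1⟩ := ht 1
  obtain ⟨t2, -, ht2⟩ := ht 2
  obtain ⟨t5, ht5', ht5⟩ := ht 5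
  have hs1 := (hS 0).groupDim_succ_le hdet (hS 1)
  have hs2 := (hS 1).groupDim_succ_le hdet (hS 2)
  have hT : ∀ p t, r p + LorentzOrder.groupDim (G p) = t + 3 →
      LorentzOrder.HasHorizontalRank g LorentzOrder.lorentz p t := fun p t h ↦
    (hS p).hasHorizontalRank hdet (hr p) (by rw [hdim, h])
  -- The identity at order 0 with `s_0 ≤ 1` gives `r_0 ≥ 2`; four strict increases up to `r_4 = r_5
  -- ≤ 6` give `r_0 ≤ 2`. The same squeeze fixes all later ranks.
  have r0 : r 0 = 2 := by omega
  have r1 : r 1 = 3 := by omega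
  have r2 : r 2 = 4 := by omega
  have r3 : r 3 = 5 := by omega
  have r4 : r 4 = 6 := by omega
  have r5 : r 5 = 6 := by omega
  have hreg : LorentzOrder.CurvatureRegular g LorentzOrder.lorentz := fun p ↦ ⟨S p, G p, hS p⟩
  refine ⟨?_, ?_⟩
  · have hR : ∀ p m, r p = m → LorentzOrder.HasRank g LorentzOrder.lorentz p m := by
      rintro p _ rfl
      exact hr p
    intro p
    fin_cases p
    · exact hR 0 _ r0
    · exact hR 1 _ r1
    · exact hR 2 _ r2
    · exact hR 3 _ r3
    · exact hR 4 _ r4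
    · exact hR 5 _ r5
  -- Since `r_1 = 3`, the identity reads `t_1 = s_1`. If `s_1 = 0`, then `s_2 = 0` and `r_2 = 4`
  -- gives `t_2 = 1`. Otherwise `s_0 = s_1 = 1`, hence `t_0 = 0` and `t_1 = 1`.
  · rcases Nat.eq_zero_or_pos (LorentzOrder.groupDim (G 1)) with h1 | h1
    · exact Or.inl ⟨hreg, hT 1 0 (by omega), 1, one_pos, hT 2 1 (by omega)⟩
    · have e1 : LorentzOrder.groupDim (G 1) = 1 := by omega
      have e0 : LorentzOrder.groupDim (G 0) = 1 := by omega
      -- The identity at order 5 is `6 + s_5 = t_5 + 3` with `t_5 ≤ 3`, so no frame freedom is left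
      -- and the pseudo-stabilization inequality is strict.
      have e5 : LorentzOrder.groupDim (G 5) = 0 := by omega
      have hF : ∀ p m, LorentzOrder.groupDim (G p) = m →
          LorentzOrder.HasFrameFreedom g LorentzOrder.lorentz p m := by
        rintro p _ rfl
        exact (hS p).hasFrameFreedom hdet
      refine Or.inr ⟨⟨hreg, hT 0 0 (by omega), 1, one_pos, hT 1 1 (by omega)⟩, le_rfl, hreg, 5, 1, 0,
        hstab, hF 1 1 e1, hF 0 1 e0, hF 5 0 e5, one_pos⟩
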